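/- Call a sequence $(f_n)_{n\ge 0}$ of numbers *Hausdorff* if there is a constant $M>0$ with $$(n+1)\sum_{i=0}^n \binom{n}{i}^2\,|\Delta^i f_{n-i}|^2 < M\qquad(n=0,1,2,\dots),\qquad \Delta f_n=f_{n+1}-f_n .$$ Let $H^2(\mathbb C_{-1/2})$ be the space of functions $\tilde a$ holomorphic in $\mathrm{Re}\,\lambda>-1/2$ with $\sup_{\sigma>-1/2}\int_{-\infty}^{\infty}|\tilde a(\sigma+i\nu)|^2d\nu<\infty$, the values on the line $\mathrm{Re}\,\lambda=-1/2$ being the boundary values (as $L^2$ limits). A Carlsonian interpolation of $(a_n)_{n\ge 0}$ is an $\tilde a\in H^2(\mathbb C_{-1/2})$ with $\tilde a(n)=a_n$ for $n=0,1,2,\dots$ **Proposition 5.** Let $(a_n)_{n\in\mathbb Z}$ be numbers with $a_{-n}=a_n$ and let $p\ge 1$ be an integer. Suppose that the sequences $(n^p a_n)_{n\ge0}$ and $(a_n)_{n\ge 0}$ are Hausdorff, and that $|a_n|\le C\,e^{-(n-m)\xi_0}$ for all $n>m$, with some constants $C$, $m>0$, $\xi_0>0$. Then: 1. The series $\frac1{2\pi}\sum_{n=-\infty}^{+\infty}a_n\cos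 n\theta$ converges uniformly in the strip $|\mathrm{Im}\,\theta|<\xi_0$ to a function $f(\theta)$ analytic in this strip. 2. $f$ admits a holomorphic extension to the doubly cut plane $\mathbb C\setminus\{2k\pi+iv : k\in\mathbb Z,\ v\in\mathbb R,\ |v|\ge\xi_0\}$. 3. $(a_n)_{n\ge0}$ has a Carlsonian interpolation $\tilde a$, unique in $\mathrm{Re}\,\lambda>-1/2$. The boundary values of $f$ from the right and from the left exist at every point $2k\pi\pm iv$ ($k\in\mathbb Z$, $v>\xi_0$) of the cuts. The discontinuity of $if$ (value from the right minus value from the left) is $F(v)$ at $2k\pi+iv$ and $-F(v)$ at $2k\pi-iv$, with one function $F$ independent of $k$, which we extend by $F(v)=0$ for $v\le\xi_0$. This jump function has the following properties: - $F$ is of class $C^{p-1}$, and for all $\sigma\ge-\frac12$ and $v>0$ $$|F(v)|\le\|\tilde a_\sigma\|_1e^{\sigma v},\qquad \|\tilde a_\sigma\|_1=\frac1{2\pi}\int_{-\infty}^{+\infty}|\tilde a(\sigma+i\nu)|\,d\nu<\infty ;$$ - $\tilde a(\sigma+i\nu)=\int_0^{+\infty}F(v)e^{-(\sigma+i\nu)v}\,dv$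 for all $\sigma>-\frac12$, $\nu\in\mathbb R$, the integral converging absolutely; - $\int_{-\infty}^{+\infty}|\tilde a(\sigma+i\nu)|^2d\nu=2\pi\int_0^{+\infty}|F(v)e^{-\sigma v}|^2dv<\infty$ for all $\sigma\ge-\frac12$. -/

import Mathlib

open Filter Topology MeasureTheory Set

/-- The square-summability condition of Hausdorff type on a sequence `f₀, f₁, …`:
there is a positive constant `M` with
`(n + 1) ∑_{i=0}^{n} (n choose i)² |Δ^i f_{n-i}|² < M` for all `n`,
where `Δ f_n = f_{n+1} - f_n`. -/
def HausdorffL2 (f : ℕ → ℂ) : Prop :=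
  ∃ M : ℝ, 0 < M ∧ ∀ n : ℕ,
    ((n : ℝ) + 1) * ∑ i ∈ Finset.range (n + 1),
      ((n.choose i : ℝ)) ^ 2 * ‖(fwdDiff (1 : ℕ))^[i] f (n - i)‖ ^ 2 < M

/-- `A` belongs to the Hardy space `H²` of the half-plane `Re z > -1/2`, that is, `A` is
holomorphic there and its `L²` norms on the lines `Re z = σ`, `σ > -1/2`, are bounded.  The values
of `A` on the boundary line `Re z = -1/2` are its boundary values, in the sense of `L²` limits. -/
structure IsHardyFunction (A : ℂ → ℂ) : Prop where
  holomorphic : DifferentiableOn ℂ A {z : ℂ | -(1 / 2 : ℝ) < z.re}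
  bounded : ∃ K : NNReal, ∀ σ : ℝ, -(1 / 2 : ℝ) < σ →
    eLpNorm (fun ν : ℝ => A (σ + ν * Complex.I)) 2 volume ≤ K
  boundary_memLp :
    MemLp (fun ν : ℝ => A (((-(1 / 2) : ℝ) : ℂ) + ν * Complex.I)) 2 volume
  boundary_tendsto :
    Tendsto
      (fun σ : ℝ => eLpNorm
        (fun ν : ℝ => A (σ + ν * Complex.I) - A (((-(1 / 2) : ℝ) : ℂ) + ν * Complex.I)) 2 volume)
      (𝓝[>] (-(1 / 2 : ℝ))) (𝓝 0)

/-- `A` is a Carlsonian interpolation of the sequence `a₀, a₁, …`: a function of the Hardy space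
`H²` of the half-plane `Re z > -1/2` with `A(n) = a_n` for all `n = 0, 1, 2, …`. -/
structure IsCarlsonInterpolation (A : ℂ → ℂ) (a : ℕ → ℂ) : Prop where
  hardy : IsHardyFunction A
  interpolates : ∀ n : ℕ, A n = a n

/-- The horizontal strip `|Im θ| < ξ`. -/
def strip (ξ : ℝ) : Set ℂ := {θ : ℂ | |θ.im| < ξ}

/-- The upper cuts `θ = 2kπ + iv`, `v ≥ ξ`, `k ∈ ℤ`. -/
def upperCuts (ξ : ℝ) : Set ℂ :=
  {θ : ℂ | ∃ (k : ℤ) (v : ℝ), ξ ≤ v ∧ θ = 2 * k * Real.pi + v * Complex.I}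

/-- The lower cuts `θ = 2kπ + iv`, `v ≤ -ξ`, `k ∈ ℤ`. -/
def lowerCuts (ξ : ℝ) : Set ℂ :=
  {θ : ℂ | ∃ (k : ℤ) (v : ℝ), v ≤ -ξ ∧ θ = 2 * k * Real.pi + v * Complex.I}

/-- The doubly cut domain: the `θ`-plane without the upper and the lower cuts. -/
def cutDomain (ξ : ℝ) : Set ℂ := (upperCuts ξ ∪ lowerCuts ξ)ᶜ

/-- `g` has limits at `z` from the open half-planes to the right and to the left of the vertical
line through `z`, and the discontinuity (right limit minus left limit) is `c`. -/
def HasJump (g : ℂ → ℂ) (z c : ℂ) : Prop :=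
  ∃ gr gl : ℂ,
    Tendsto g (𝓝[{θ : ℂ | z.re < θ.re}] z) (𝓝 gr) ∧
    Tendsto g (𝓝[{θ : ℂ | θ.re < z.re}] z) (𝓝 gl) ∧
    c = gr - gl

/-! Everything is read off one function F on (0, ∞) whose Laplace transform takes the values a_n at
n = 0, 1, 2, ….

Under x = e^{-v} the Hausdorff condition is a discretised bound for the functional x^k ↦ g_k on
polynomials in L²(0, 1): Cauchy–Schwarz gives |∑ c_k g_k|² ≤ M ‖∑ c_k x^k‖², and Riesz
representation supplies a square-integrable density (`HausdorffL2.exists_moment`). The sequence (n^p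
a_n) yields G and (a_n) yields H, both in L² with the weight e^{v/2}. Division of a Laplace
transform by z^p is a p-fold primitive, so Lerch's theorem at the integers identifies H with the
p-fold primitive F of G (`exists_iteratedPrimitive_laplaceTransform_eq`). Through G, F is C^{p-1}
and locally Hölder of exponent 1/2; through H, it is square integrable with the weight e^{v/2}.

By Plancherel the Laplace transform A of F is a Hardy function (`isHardyFunction_hardyLaplace`).
Since z^p A is the transform of G, again a Hardy function, A is integrable on vertical lines when p
≥ 1, and Fourier inversion bounds F. Uniqueness is Carlson's theorem in an elementary form: Hardy
functions are bounded for Re z ≥ 0, and a bounded function vanishing at 1, 2, 3, … is killed by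
Blaschke factors, because the harmonic series diverges.

The decay of a_n forces F = 0 up to ξ₀, by Phragmén's kernel exp(-e^{n(ξ-v)})
(`setIntegral_Ioc_eq_zero_of_laplace_decay`). A geometric series under the integral then gives
∑_{n≥1} a_n e^{nz} = ∫ F(v)/(e^{v-z} - 1) dv = Φ(z), and f(θ) = (a_0 + Φ(iθ) + Φ(-iθ))/2π. In the
variable e^z, Φ is a Cauchy integral over the ray [e^{ξ₀}, ∞): it is holomorphic off the cuts, and
the Sokhotski–Plemelj formula, available because F is Hölder, gives the jump. -/

/-! ### Hausdorff's moment theorem in L² -/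

/-- The bound makes x_k ↦ g_k a well-defined bounded functional on the span of the x_k; Hahn–Banach
extends it and Riesz represents it. -/
theorem exists_inner_eq_of_norm_sum_le {H : Type*} [NormedAddCommGroup H] [InnerProductSpace ℂ H]
    [CompleteSpace H] {ι : Type*} (x : ι → H) (g : ι → ℂ) (K : ℝ)
    (h : ∀ c : ι →₀ ℂ, ‖Finsupp.linearCombination ℂ g c‖ ≤
      K * ‖Finsupp.linearCombination ℂ x c‖) :
    ∃ φ : H, ∀ k, inner ℂ φ (x k) = g k := by
  set T := Finsupp.linearCombination ℂ x
  set G := Finsupp.linearCombination ℂ g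
  obtain ⟨s, hs⟩ := T.rangeRestrict.exists_rightInverse_of_surjective T.range_rangeRestrict
  have hs' : ∀ y : LinearMap.range T, T (s y) = y := fun y =>
    congrArg Subtype.val (LinearMap.congr_fun hs y)
  let ℓ : StrongDual ℂ (LinearMap.range T) := (G ∘ₗ s).mkContinuous K fun y => by
    have := h (s y)
    rwa [hs'] at this
  obtain ⟨ℓ', hℓ', -⟩ := exists_extension_norm_eq _ ℓ
  refine ⟨(InnerProductSpace.toDual ℂ H).symm ℓ', fun k => ?_⟩
  rw [InnerProductSpace.toDual_symm_apply]
  have hk : x k = T (Finsupp.single k 1) := by simp [T]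
  have h1 : ℓ' (x k) = G (s ⟨x k, hk ▸ LinearMap.mem_range_self T _⟩) :=
    hℓ' ⟨x k, hk ▸ LinearMap.mem_range_self T _⟩
  -- The section s need not send x_k to the k-th basis vector, but the two differ by an element of
  -- ker T, on which the bound forces G to vanish.
  have h2 := h (s ⟨x k, hk ▸ LinearMap.mem_range_self T _⟩ - Finsupp.single k 1)
  rw [map_sub, map_sub, hs', Subtype.coe_mk, sub_eq_zero.2 hk, norm_zero, mul_zero,
    norm_le_zero_iff] at h2
  rw [h1, sub_eq_zero.1 h2]
  simp [G]

open fwdDiff_aux in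
-- With S the shift, 1 = (S - Δ)^N, expanded by the binomial theorem for the commuting operators S
-- and -Δ.
theorem sum_choose_mul_fwdDiff (g : ℕ → ℂ) (N k : ℕ) :
    ∑ i ∈ Finset.range (N + 1), (N.choose i : ℂ) *
      ((-1) ^ i * (fwdDiff (1 : ℕ))^[i] g (k + (N - i))) = g k := by
  have hS : shiftₗ ℕ ℂ 1 = fwdDiffₗ ℕ ℂ 1 + 1 := rfl
  have hc : Commute (-fwdDiffₗ ℕ ℂ 1) (shiftₗ ℕ ℂ 1) := by
    rw [hS]
    exact ((Commute.refl _).neg_left).add_right (Commute.one_right _)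
  have h1 := hc.add_pow N
  rw [hS, neg_add_cancel_left, one_pow] at h1
  have h2 := congr_fun (LinearMap.congr_fun h1 g) k
  rw [Module.End.one_apply] at h2
  rw [h2, LinearMap.sum_apply, Finset.sum_apply]
  refine Finset.sum_congr rfl fun i _ => ?_
  rw [← hS, hc.pow_pow i (N - i)]
  rw [show (N.choose i : Module.End ℤ (ℕ → ℂ)) = ((N.choose i : ℤ) : Module.End ℤ (ℕ → ℂ)) by
    norm_cast, ← (Int.cast_commute (N.choose i : ℤ) _).eq, Module.End.mul_apply,
    Module.End.intCast_apply, Pi.smul_apply, Module.End.mul_apply, shiftₗ_pow_apply, ← coe_fwdDiffₗ_pow]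
  rcases Nat.even_or_odd i with hi | hi <;> simp [hi.neg_pow]

theorem choose_mul_choose_sub (n k i : ℕ) (hk : k ≤ n) (hi : i ≤ n) :
    n.choose i * (n - i).choose k = n.choose k * (n - k).choose i := by
  rcases le_or_gt (i + k) n with h | h
  · have h1 := Nat.choose_mul (n := n) (k := i + k) (s := i) (by omega)
    have h2 := Nat.choose_mul (n := n) (k := i + k) (s := k) (by omega)
    rw [Nat.add_sub_cancel_left] at h1
    rw [Nat.add_sub_cancel] at h2
    have h3 : (i + k).choose i = (i + k).choose k := Nat.choose_symm_of_eq_add rfl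
    rw [← h1, ← h2, h3]
  · rw [Nat.choose_eq_zero_of_lt (by omega : n - i < k),
      Nat.choose_eq_zero_of_lt (by omega : n - k < i)]
    simp

/-- The numbers C(n,i)(-1)^i Δ^i g_{n-i} act as masses at the points (n-i)/n, and C(n-i,k)/C(n,k) is
the discrete substitute for x^k there that makes the moment formula exact for every n ≥ k. -/
theorem eq_sum_choose_div_choose_mul_fwdDiff (g : ℕ → ℂ) {n k : ℕ} (hk : k ≤ n) :
    g k = ∑ i ∈ Finset.range (n + 1), (((n - i).choose k / n.choose k : ℝ) : ℂ) *
      ((n.choose i : ℂ) * ((-1) ^ i * (fwdDiff (1 : ℕ))^[i] g (n - i))) := by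
  rw [← sum_choose_mul_fwdDiff g (n - k) k]
  have hsub : Finset.range (n - k + 1) ⊆ Finset.range (n + 1) :=
    Finset.range_mono (by omega)
  rw [← Finset.sum_subset hsub]
  · refine Finset.sum_congr rfl fun i hi => ?_
    have hi' := Finset.mem_range.1 hi
    rw [show k + (n - k - i) = n - i by omega, ← mul_assoc _ (n.choose i : ℂ)]
    congr 1
    have h1 : (n.choose k : ℂ) ≠ 0 := by exact_mod_cast (Nat.choose_pos hk).ne'
    have := choose_mul_choose_sub n k i hk (by omega)
    have h2 : (n.choose i * (n - i).choose k : ℂ) = n.choose k * (n - k).choose i := by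
      exact_mod_cast this
    push_cast
    field_simp
    rw [mul_comm, ← h2]; ring
  · intro i hi hi'
    have h1 := Finset.mem_range.1 hi
    rw [Finset.mem_range] at hi'
    rw [Nat.choose_eq_zero_of_lt (by omega : n - i < k)]
    simp

/-- Turns an average into the integral of a step function, so that dominated convergence applies. -/
theorem intervalIntegral_floor_mul (h : ℕ → ℝ) (n : ℕ) :
    ∫ x in (0 : ℝ)..1, h ⌊((n : ℝ) + 1) * x⌋₊ =
      ((n : ℝ) + 1)⁻¹ * ∑ j ∈ Finset.range (n + 1), h j := by
  have hn : (n : ℝ) + 1 ≠ 0 := by positivity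
  rw [intervalIntegral.integral_comp_mul_left (fun y => h ⌊y⌋₊) hn, smul_eq_mul]
  congr 1
  have key : ∀ j : ℕ, EqOn (fun y => h ⌊y⌋₊) (fun _ => h j) (Ioo (j : ℝ) (j + 1 : ℕ)) := by
    intro j y hy
    have : ⌊y⌋₊ = j := by
      rw [Nat.floor_eq_iff (le_trans (Nat.cast_nonneg j) hy.1.le)]
      exact ⟨hy.1.le, by have := hy.2; push_cast at this; exact this⟩
    simp only [this]
  have h1 := intervalIntegral.sum_integral_adjacent_intervals (f := fun y : ℝ => h ⌊y⌋₊)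
    (μ := volume) (a := fun j : ℕ => (j : ℝ)) (n := n + 1) (fun j _ => by
      rw [intervalIntegrable_iff_integrableOn_Ioo_of_le (by simp)]
      exact (integrableOn_const (by simp) (by simp) : IntegrableOn (fun _ => h j) _ _).congr_fun
        (key j).symm measurableSet_Ioo)
  simp only [mul_zero, mul_one]
  rw [show ((n : ℝ) + 1) = ((n + 1 : ℕ) : ℝ) by push_cast; ring,
    show (0 : ℝ) = ((0 : ℕ) : ℝ) by simp, ← h1]
  refine Finset.sum_congr rfl fun j _ => ?_
  rw [intervalIntegral.integral_of_le (by simp), integral_Ioc_eq_integral_Ioo,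
    setIntegral_congr_fun measurableSet_Ioo (key j)]
  simp

/-- C(j,k)/C(n,k) tends to x^k when j/n tends to x, and it lies in [0, 1]; hence the limit is ∫₀¹
x^{k+l} dx. These are the entries of the Gram matrix computed in `inner_exp_neg_Ioi`. -/
theorem tendsto_average_choose_div_choose (k l : ℕ) :
    Tendsto (fun n : ℕ => ((n : ℝ) + 1)⁻¹ * ∑ j ∈ Finset.range (n + 1),
      (j.choose k / n.choose k : ℝ) * (j.choose l / n.choose l)) atTop
      (𝓝 (1 / ((k : ℝ) + l + 1))) := by
  have hlim : ∀ k : ℕ, ∀ x ∈ Ioo (0 : ℝ) 1, Tendsto (fun n : ℕ =>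
      ((⌊((n : ℝ) + 1) * x⌋₊.choose k : ℝ) / n.choose k)) atTop (𝓝 (x ^ k)) := by
    intro k x hx
    have e1 := isEquivalent_choose k
    have hf : Tendsto (fun n : ℕ => ⌊((n : ℝ) + 1) * x⌋₊) atTop atTop := by
      refine tendsto_nat_floor_atTop.comp (Tendsto.atTop_mul_const hx.1 ?_)
      exact tendsto_atTop_add_const_right _ _ tendsto_natCast_atTop_atTop
    have e2 := (e1.comp_tendsto hf).div e1
    refine (e2.symm.tendsto_nhds ?_).congr fun n => by simp
    have h3 : Tendsto (fun n : ℕ => ((⌊((n : ℝ) + 1) * x⌋₊ : ℝ) / n)) atTop (𝓝 x) := by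
      have h4 : Tendsto (fun n : ℕ => (⌊x * ((n : ℝ) + 1)⌋₊ : ℝ) / ((n : ℝ) + 1)) atTop (𝓝 x) :=
        (tendsto_nat_floor_mul_div_atTop hx.1.le).comp
          (tendsto_atTop_add_const_right _ _ tendsto_natCast_atTop_atTop)
      have h5 : Tendsto (fun n : ℕ => ((n : ℝ) + 1) / n) atTop (𝓝 1) := by
        have := (tendsto_natCast_div_add_atTop (1 : ℝ)).inv₀ one_ne_zero
        simpa using this
      have := h4.mul h5
      rw [mul_one] at this
      refine this.congr' ?_
      filter_upwards [eventually_gt_atTop 0] with n hn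
      have : (n : ℝ) ≠ 0 := by positivity
      have : (n : ℝ) + 1 ≠ 0 := by positivity
      rw [mul_comm x]
      field_simp
    refine (h3.pow k).congr fun n => ?_
    have : ((k.factorial : ℕ) : ℝ) ≠ 0 := by positivity
    simp only [Pi.div_apply, Function.comp]
    rw [div_pow]
    field_simp
  have hb : ∀ (k n : ℕ) (x : ℝ), x ∈ Ioo (0 : ℝ) 1 →
      0 ≤ ((⌊((n : ℝ) + 1) * x⌋₊.choose k : ℝ) / n.choose k) ∧
      ((⌊((n : ℝ) + 1) * x⌋₊.choose k : ℝ) / n.choose k) ≤ 1 := by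
    intro k n x hx
    refine ⟨by positivity, div_le_one_of_le₀ ?_ (by positivity)⟩
    have : ⌊((n : ℝ) + 1) * x⌋₊ ≤ n := by
      rw [← Nat.lt_succ_iff, Nat.floor_lt (by have := hx.1; positivity)]
      have := hx.2
      push_cast
      nlinarith
    exact_mod_cast Nat.choose_le_choose k this
  have hI : ∫ x in (0 : ℝ)..1, x ^ k * x ^ l = 1 / ((k : ℝ) + l + 1) := by
    simp only [← pow_add, integral_pow]
    push_cast
    simp
  rw [← hI]
  simp only [← intervalIntegral_floor_mul]
  simp only [intervalIntegral.integral_of_le zero_le_one, integral_Ioc_eq_integral_Ioo]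
  refine tendsto_integral_of_dominated_convergence (fun _ => (1 : ℝ)) ?_ ?_ ?_ ?_
  · intro n
    refine Measurable.aestronglyMeasurable ?_
    have hm : Measurable fun x : ℝ => ⌊((n : ℝ) + 1) * x⌋₊ :=
      Nat.measurable_floor.comp (measurable_const_mul _)
    exact (Measurable.comp (g := fun j : ℕ => (j.choose k / n.choose k : ℝ) *
      (j.choose l / n.choose l)) measurable_from_top hm)
  · simp
  · intro n
    filter_upwards [ae_restrict_mem measurableSet_Ioo] with x hx
    obtain ⟨h1, h2⟩ := hb k n x hx
    obtain ⟨h3, h4⟩ := hb l n x hx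
    rw [Real.norm_of_nonneg (mul_nonneg h1 h3)]
    exact mul_le_one₀ h2 h3 h4
  · filter_upwards [ae_restrict_mem measurableSet_Ioo] with x hx
    exact (hlim k x hx).mul (hlim l x hx)

/-- The functions `v ↦ e^{-(k + 1/2) v}` of `L²(0, ∞)`, in which moment problems on `[0, 1]` turn
into interpolation problems for Laplace transforms. -/
theorem memLp_exp_neg_Ioi (k : ℕ) :
    MemLp (fun v : ℝ => ((Real.exp (-(((k : ℝ) + 1 / 2) * v)) : ℝ) : ℂ)) 2
      (volume.restrict (Ioi 0)) := by
  rw [memLp_two_iff_integrable_sq_norm (by fun_prop)]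
  have := integrableOn_exp_mul_Ioi (a := -(2 * (k : ℝ) + 1)) (by linarith [k.cast_nonneg (α := ℝ)]) 0
  refine this.congr_fun (fun v _ => ?_) measurableSet_Ioi
  simp only [Complex.norm_real, Real.norm_eq_abs, Real.abs_exp, ← Real.exp_nat_mul]
  congr 1
  push_cast
  ring

theorem inner_exp_neg_Ioi (k l : ℕ) :
    inner ℂ ((memLp_exp_neg_Ioi k).toLp _) ((memLp_exp_neg_Ioi l).toLp _) =
      ((1 / ((k : ℝ) + l + 1) : ℝ) : ℂ) := by
  rw [L2.inner_def]
  have h1 : ∫ v in Ioi (0 : ℝ), Real.exp (-((k : ℝ) + l + 1) * v) = 1 / ((k : ℝ) + l + 1) := by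
    rw [integral_exp_mul_Ioi (by linarith [k.cast_nonneg (α := ℝ), l.cast_nonneg (α := ℝ)])]
    rw [mul_zero, Real.exp_zero, neg_div_neg_eq]
  rw [← h1, ← integral_complex_ofReal]
  refine integral_congr_ae ?_
  filter_upwards [(memLp_exp_neg_Ioi k).coeFn_toLp, (memLp_exp_neg_Ioi l).coeFn_toLp] with v h2 h3
  rw [h2, h3]
  simp only [RCLike.inner_apply, Complex.conj_ofReal, ← Complex.ofReal_mul, ← Real.exp_add]
  congr 2
  ring

/-- Hausdorff's theorem: a sequence satisfying the square-summability condition is the sequence of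
moments of a square-integrable function. -/
theorem HausdorffL2.exists_moment {g : ℕ → ℂ} (hg : HausdorffL2 g) :
    ∃ ψ : ℝ → ℂ, MemLp ψ 2 (volume.restrict (Ioi 0)) ∧
      ∀ n : ℕ, g n = ∫ v in Ioi (0 : ℝ), ψ v * Real.exp (-(((n : ℝ) + 1 / 2) * v)) := by
  obtain ⟨M, hM, hg⟩ := hg
  obtain ⟨φ, hφ⟩ := exists_inner_eq_of_norm_sum_le
    (fun k => (memLp_exp_neg_Ioi k).toLp _) g (Real.sqrt M) (by
      intro c
      set X := Finsupp.linearCombination ℂ (fun k => (memLp_exp_neg_Ioi k).toLp _) c with hX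
      -- P n j is the discrete counterpart of the polynomial ∑ c_k x^k at x = j/n; its mean square
      -- over j tends to the squared norm of X.
      set P : ℕ → ℕ → ℂ := fun n j => ∑ k ∈ c.support, c k * ((j.choose k / n.choose k : ℝ) : ℂ)
        with hP
      have hlim : Tendsto (fun n : ℕ => ((n : ℝ) + 1)⁻¹ * ∑ j ∈ Finset.range (n + 1), ‖P n j‖ ^ 2)
          atTop (𝓝 (‖X‖ ^ 2)) := by
        rw [← Filter.tendsto_ofReal_iff]
        have hXX : ((‖X‖ ^ 2 : ℝ) : ℂ) = ∑ k ∈ c.support, ∑ l ∈ c.support,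
            (starRingEnd ℂ (c k) * c l) * ((1 / ((k : ℝ) + l + 1) : ℝ) : ℂ) := by
          rw [show ((‖X‖ ^ 2 : ℝ) : ℂ) = inner ℂ X X by rw [inner_self_eq_norm_sq_to_K]; simp, hX, Finsupp.linearCombination_apply, Finsupp.sum,
            sum_inner]
          refine Finset.sum_congr rfl fun k _ => ?_
          rw [inner_sum]
          refine Finset.sum_congr rfl fun l _ => ?_
          rw [inner_smul_left, inner_smul_right, inner_exp_neg_Ioi]
          push_cast
          ring
        rw [hXX]
        have h1 := tendsto_finsetSum c.support fun k _ => tendsto_finsetSum c.support fun l _ =>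
          (Filter.tendsto_ofReal_iff.2 (tendsto_average_choose_div_choose k l)).const_mul
            (starRingEnd ℂ (c k) * c l)
        refine h1.congr fun n => ?_
        have h2 : ∀ j, ((‖P n j‖ ^ 2 : ℝ) : ℂ) = ∑ k ∈ c.support, ∑ l ∈ c.support,
            (starRingEnd ℂ (c k) * c l) * (((j.choose k / n.choose k : ℝ) : ℂ) *
              ((j.choose l / n.choose l : ℝ) : ℂ)) := by
          intro j
          push_cast
          rw [← Complex.conj_mul', hP]
          simp only [map_sum, Finset.sum_mul_sum, map_mul, Complex.conj_ofReal]
          refine Finset.sum_congr rfl fun k _ => Finset.sum_congr rfl fun l _ => ?_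
          push_cast
          ring
        rw [Complex.ofReal_mul, Complex.ofReal_sum]
        simp only [h2]
        rw [Finset.sum_comm (s := Finset.range (n + 1))]
        simp only [Finset.sum_comm (s := Finset.range (n + 1)), Finset.mul_sum]
        refine Finset.sum_congr rfl fun k _ => Finset.sum_congr rfl fun l _ => ?_
        rw [Complex.ofReal_sum, Finset.mul_sum]
        refine Finset.sum_congr rfl fun j _ => ?_
        push_cast
        ring
      have hle : ‖Finsupp.linearCombination ℂ g c‖ ^ 2 ≤ M * ‖X‖ ^ 2 := by
        refine ge_of_tendsto (hlim.const_mul M) ?_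
        -- The exact moment formula needs n ≥ k for every k in the support of c.
        filter_upwards [eventually_ge_atTop (c.support.sup id)] with n hn
        set lam : ℕ → ℂ := fun i => (n.choose i : ℂ) * ((-1) ^ i * (fwdDiff (1 : ℕ))^[i] g (n - i))
        have h1 : Finsupp.linearCombination ℂ g c =
            ∑ i ∈ Finset.range (n + 1), lam i * P n (n - i) := by
          rw [Finsupp.linearCombination_apply, Finsupp.sum]
          simp only [hP, Finset.mul_sum]
          rw [Finset.sum_comm]
          refine Finset.sum_congr rfl fun k hk => ?_
          rw [eq_sum_choose_div_choose_mul_fwdDiff g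
            (show k ≤ n from (Finset.le_sup (f := id) hk).trans hn), smul_eq_mul, Finset.mul_sum]
          refine Finset.sum_congr rfl fun i _ => ?_
          ring
        have h2 : ‖Finsupp.linearCombination ℂ g c‖ ≤
            ∑ i ∈ Finset.range (n + 1), ‖lam i‖ * ‖P n (n - i)‖ := by
          rw [h1]
          exact (norm_sum_le _ _).trans_eq (Finset.sum_congr rfl fun i _ => norm_mul _ _)
        have h3 : ∑ i ∈ Finset.range (n + 1), ‖lam i‖ ^ 2 ≤ M * ((n : ℝ) + 1)⁻¹ := by
          rw [← div_eq_mul_inv, le_div_iff₀' (by positivity)]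
          refine (le_of_eq ?_).trans (hg n).le
          congr 1
          refine Finset.sum_congr rfl fun i _ => ?_
          simp [lam, mul_pow]
        have h4 : ∑ i ∈ Finset.range (n + 1), ‖P n (n - i)‖ ^ 2 =
            ∑ i ∈ Finset.range (n + 1), ‖P n i‖ ^ 2 := by
          rw [← Finset.sum_range_reflect (fun i => ‖P n i‖ ^ 2)]
          simp
        calc _ ≤ (∑ i ∈ Finset.range (n + 1), ‖lam i‖ * ‖P n (n - i)‖) ^ 2 := by gcongr
          _ ≤ _ := Finset.sum_mul_sq_le_sq_mul_sq _ _ _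
          _ ≤ M * ((n : ℝ) + 1)⁻¹ * ∑ i ∈ Finset.range (n + 1), ‖P n i‖ ^ 2 := by
            rw [h4]; gcongr
          _ = _ := by ring
      rw [← Real.sqrt_sq (norm_nonneg (Finsupp.linearCombination ℂ g c)),
        ← Real.sqrt_sq (norm_nonneg X), ← Real.sqrt_mul hM.le]
      exact Real.sqrt_le_sqrt hle)
  -- The inner product is conjugate-linear in its first argument, hence the conjugate of φ.
  refine ⟨fun v => starRingEnd ℂ (φ v), (Lp.memLp φ).star, fun n => ?_⟩
  rw [← hφ n, L2.inner_def]
  refine integral_congr_ae ?_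
  filter_upwards [(memLp_exp_neg_Ioi n).coeFn_toLp] with v hv
  rw [hv, RCLike.inner_apply]
  ring

/-! ### Decay of Laplace values at the integers, and Lerch's theorem -/

/-- Phragmén's argument. The kernel exp(-e^{n(ξ-v)}) tends to the indicator of v > ξ. Expanded in
powers, it samples the transform only at the integers kn, and the decay makes all terms with k ≥ 1
negligible in the limit. Hence the integrals of F over (ξ, ∞) and over (0, ∞) agree. -/
theorem setIntegral_Ioc_eq_zero_of_laplace_decay {F : ℝ → ℂ} {ξ₀ C : ℝ} {N : ℕ}
    (hF : IntegrableOn F (Ioi 0))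
    (h : ∀ n : ℕ, N ≤ n → ‖∫ v in Ioi (0 : ℝ), F v * Real.exp (-(n * v))‖ ≤
      C * Real.exp (-(n * ξ₀))) {ξ : ℝ} (hξ0 : 0 ≤ ξ) (hξ : ξ < ξ₀) :
    ∫ v in Ioc 0 ξ, F v = 0 := by
  set H : ℕ → ℝ → ℂ := fun n v => F v * Real.exp (-Real.exp (n * (ξ - v))) with hH
  have hlim : Tendsto (fun n => ∫ v in Ioi (0 : ℝ), H n v) atTop
      (𝓝 (∫ v in Ioi (0 : ℝ), (Ioi ξ).indicator F v)) := by
    refine tendsto_integral_of_dominated_convergence (fun v => ‖F v‖) ?_ hF.norm ?_ ?_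
    · intro n
      exact hF.aestronglyMeasurable.mul (by fun_prop)
    · intro n
      filter_upwards with v
      simp only [hH, norm_mul, Complex.norm_real, Real.norm_eq_abs, Real.abs_exp]
      refine mul_le_of_le_one_right (norm_nonneg _) ?_
      rw [Real.exp_le_one_iff]
      linarith [Real.exp_pos (n * (ξ - v))]
    · have h0 : ∀ᵐ v ∂(volume.restrict (Ioi (0 : ℝ))), v ≠ ξ :=
        ae_restrict_of_ae (by simp [ae_iff])
      filter_upwards [h0] with v hv
      rcases lt_or_gt_of_ne hv with hv | hv
      · rw [indicator_of_notMem (by simpa using hv.le)]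
        have h1 : Tendsto (fun n : ℕ => (n : ℝ) * (ξ - v)) atTop atTop :=
          Tendsto.atTop_mul_const (sub_pos.2 hv) tendsto_natCast_atTop_atTop
        have h2 := Real.tendsto_exp_neg_atTop_nhds_zero.comp (Real.tendsto_exp_atTop.comp h1)
        have h3 := ((Complex.continuous_ofReal.tendsto _).comp h2).const_mul (F v)
        simpa [hH] using h3
      · rw [indicator_of_mem (by simpa using hv)]
        have h1 : Tendsto (fun n : ℕ => (n : ℝ) * (ξ - v)) atTop atBot :=
          Tendsto.atTop_mul_const_of_neg (sub_neg.2 hv) tendsto_natCast_atTop_atTop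
        have h2 := (Real.continuous_exp.tendsto _).comp (Real.tendsto_exp_atBot.comp h1).neg
        have h3 := ((Complex.continuous_ofReal.tendsto _).comp h2).const_mul (F v)
        simpa [hH] using h3
  have hlim' : Tendsto (fun n => ∫ v in Ioi (0 : ℝ), H n v) atTop
      (𝓝 (∫ v in Ioi (0 : ℝ), F v)) := by
    rw [tendsto_iff_norm_sub_tendsto_zero]
    -- The k-th term is at most C e^{-kn(ξ₀-ξ)}/k!; summed over k ≥ 1 this is the exponential series
    -- without its constant term.
    have hq : Tendsto (fun n : ℕ => C * (Real.exp (Real.exp (-(n * (ξ₀ - ξ)))) - 1)) atTop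
        (𝓝 0) := by
      have h1 : Tendsto (fun n : ℕ => (n : ℝ) * (ξ₀ - ξ)) atTop atTop :=
        Tendsto.atTop_mul_const (sub_pos.2 hξ) tendsto_natCast_atTop_atTop
      have h2 := (Real.continuous_exp.tendsto _).comp
        (Real.tendsto_exp_neg_atTop_nhds_zero.comp h1)
      simpa using (h2.sub_const 1).const_mul C
    refine squeeze_zero' (Eventually.of_forall fun n => norm_nonneg _) ?_ hq
    filter_upwards [eventually_ge_atTop (max N 1)] with n hn
    set T : ℕ → ℝ → ℂ := fun k v =>
      F v * (((-1) ^ k / k.factorial * Real.exp (k * (n * (ξ - v))) : ℝ) : ℂ) with hT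
    have hTint : ∀ k, Integrable (T k) (volume.restrict (Ioi 0)) := by
      intro k
      refine Integrable.mul_bdd (c := Real.exp (k * (n * ξ))) hF (by fun_prop) ?_
      filter_upwards [ae_restrict_mem measurableSet_Ioi] with v hv
      rw [Complex.norm_real, norm_mul, norm_div, norm_pow, norm_neg, norm_one, one_pow,
        Real.norm_eq_abs (Real.exp _), Real.abs_exp]
      have hv' : (0 : ℝ) < v := hv
      have h1 : 1 / ‖(k.factorial : ℝ)‖ ≤ 1 := by
        rw [Real.norm_of_nonneg (by positivity)]
        exact div_le_one_of_le₀ (by exact_mod_cast Nat.one_le_iff_ne_zero.2 k.factorial_ne_zero)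
          (by positivity)
      calc _ ≤ 1 * Real.exp (k * (n * ξ)) := by
            gcongr
            linarith
        _ = _ := one_mul _
    have hTnorm : ∀ k, ∫ v in Ioi (0 : ℝ), ‖T k v‖ ≤
        (Real.exp (n * ξ)) ^ k / k.factorial * ∫ v in Ioi (0 : ℝ), ‖F v‖ := by
      intro k
      rw [← integral_const_mul]
      refine setIntegral_mono_on (hTint k).norm (hF.norm.const_mul _) measurableSet_Ioi
        fun v hv => ?_
      have hv' : (0 : ℝ) < v := hv
      simp only [hT]
      rw [norm_mul, Complex.norm_real, norm_mul, norm_div, norm_pow, norm_neg, norm_one, one_pow,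
        Real.norm_eq_abs (Real.exp _), Real.abs_exp, Real.norm_of_nonneg (by positivity), mul_comm,
        ← Real.exp_nat_mul, one_div_mul_eq_div]
      gcongr
      linarith
    have hsum := hasSum_integral_of_summable_integral_norm hTint
      (Summable.of_nonneg_of_le (fun k => integral_nonneg fun v => norm_nonneg _) hTnorm
        ((Real.summable_pow_div_factorial _).mul_right _))
    have hTH : ∀ v, ∑' k, T k v = H n v := by
      intro v
      simp only [hT, hH]
      rw [tsum_mul_left]
      congr 1
      rw [← Complex.ofReal_tsum]
      congr 1
      have h1 := NormedSpace.expSeries_div_hasSum_exp (𝔸 := ℝ) (-Real.exp (n * (ξ - v)))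
      rw [← Real.exp_eq_exp_ℝ] at h1
      rw [← h1.tsum_eq]
      refine tsum_congr fun k => ?_
      rw [neg_pow (Real.exp _), ← Real.exp_nat_mul]
      ring
    simp only [hTH] at hsum
    have hsum' := (hasSum_nat_add_iff' 1).2 hsum
    simp only [Finset.range_one, Finset.sum_singleton] at hsum'
    have hT0 : ∫ v in Ioi (0 : ℝ), T 0 v = ∫ v in Ioi (0 : ℝ), F v := by simp [hT]
    rw [hT0] at hsum'
    have hE : HasSum (fun k : ℕ => C * (Real.exp (-(n * (ξ₀ - ξ))) ^ (k + 1) / (k + 1).factorial))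
        (C * (Real.exp (Real.exp (-(n * (ξ₀ - ξ)))) - 1)) := by
      have := NormedSpace.expSeries_div_hasSum_exp (𝔸 := ℝ) (Real.exp (-(n * (ξ₀ - ξ))))
      rw [← Real.exp_eq_exp_ℝ] at this
      simpa using ((hasSum_nat_add_iff' 1).2 this).mul_left C
    refine hsum'.norm_le_of_bounded hE fun k => ?_
    have hk : N ≤ (k + 1) * n := by
      have : n ≤ (k + 1) * n := Nat.le_mul_of_pos_left _ (by omega)
      omega
    have h1 : ∫ v in Ioi (0 : ℝ), T (k + 1) v =
        (((-1) ^ (k + 1) / (k + 1).factorial * Real.exp (((k + 1 : ℕ) : ℝ) * (n * ξ)) : ℝ) : ℂ) *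
          ∫ v in Ioi (0 : ℝ), F v * Real.exp (-(((k + 1) * n : ℕ) * v)) := by
      rw [← integral_const_mul]
      congr 1
      ext v
      simp only [hT]
      rw [mul_left_comm (Complex.ofReal _), ← Complex.ofReal_mul, mul_assoc, ← Real.exp_add]
      congr 4
      push_cast
      ring
    rw [h1, norm_mul, Complex.norm_real, norm_mul, norm_div, norm_pow, norm_neg, norm_one, one_pow,
      Real.norm_eq_abs (Real.exp _), Real.abs_exp, Real.norm_of_nonneg (by positivity)]
    calc _ ≤ 1 / ((k + 1).factorial : ℝ) * Real.exp (((k + 1 : ℕ) : ℝ) * (n * ξ)) *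
          (C * Real.exp (-(((k + 1) * n : ℕ) * ξ₀))) := by
          gcongr
          exact h _ hk
      _ = C / ((k + 1).factorial : ℝ) * (Real.exp (((k + 1 : ℕ) : ℝ) * (n * ξ)) *
          Real.exp (-(((k + 1) * n : ℕ) * ξ₀))) := by ring
      _ = C / ((k + 1).factorial : ℝ) * (Real.exp (-(n * (ξ₀ - ξ))) ^ (k + 1)) := by
          rw [← Real.exp_add, ← Real.exp_nat_mul]
          congr 2
          push_cast
          ring
      _ = _ := by ring
  have heq := tendsto_nhds_unique hlim hlim'
  rw [integral_indicator measurableSet_Ioi, Measure.restrict_restrict measurableSet_Ioi,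
    Ioi_inter_Ioi, sup_eq_left.2 hξ0, ← Ioc_union_Ioi_eq_Ioi hξ0,
    setIntegral_union (Ioc_disjoint_Ioi le_rfl) measurableSet_Ioi
      (hF.mono_set Ioc_subset_Ioi_self) (hF.mono_set (Ioi_subset_Ioi hξ0))] at heq
  simpa using heq.symm

/-- The primitive of F vanishes on (0, ξ₀), and F is its derivative at almost every point. -/
theorem ae_eq_zero_of_laplace_decay {F : ℝ → ℂ} {ξ₀ C : ℝ} {N : ℕ}
    (hF : IntegrableOn F (Ioi 0))
    (h : ∀ n : ℕ, N ≤ n → ‖∫ v in Ioi (0 : ℝ), F v * Real.exp (-(n * v))‖ ≤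
      C * Real.exp (-(n * ξ₀))) : ∀ᵐ v : ℝ, v ∈ Ioo 0 ξ₀ → F v = 0 := by
  have hloc : LocallyIntegrable ((Ioi (0 : ℝ)).indicator F) volume :=
    (hF.integrable_indicator measurableSet_Ioi).locallyIntegrable
  filter_upwards [LocallyIntegrable.ae_hasDerivAt_integral hloc] with v hv hv'
  have h1 := hv 0
  have h2 : (fun x => ∫ t in (0 : ℝ)..x, (Ioi (0 : ℝ)).indicator F t) =ᶠ[𝓝 v] fun _ => 0 := by
    filter_upwards [isOpen_Ioo.mem_nhds hv'] with x hx
    rw [intervalIntegral.integral_of_le hx.1.le,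
      setIntegral_congr_fun measurableSet_Ioc (g := F)
        (fun t ht => indicator_of_mem (show t ∈ Ioi (0 : ℝ) from ht.1) F)]
    exact setIntegral_Ioc_eq_zero_of_laplace_decay hF h hx.1.le hx.2
  have h3 := (hasDerivAt_const v (0 : ℂ)).congr_of_eventuallyEq h2
  simpa [indicator_of_mem (show v ∈ Ioi (0 : ℝ) from hv'.1)] using h1.unique h3

/-- Lerch's theorem for integer arguments. -/
theorem ae_eq_zero_of_laplace_eq_zero {F : ℝ → ℂ} {N : ℕ} (hF : IntegrableOn F (Ioi 0))
    (h : ∀ n : ℕ, N ≤ n → ∫ v in Ioi (0 : ℝ), F v * Real.exp (-(n * v)) = 0) :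
    ∀ᵐ v : ℝ, 0 < v → F v = 0 := by
  have h1 : ∀ k : ℕ, ∀ᵐ v : ℝ, v ∈ Ioo (0 : ℝ) k → F v = 0 := fun k =>
    -- With C = 0 the decay hypothesis holds at every rate, so ξ₀ may be any integer k.
    ae_eq_zero_of_laplace_decay (C := 0) (N := N) hF fun n hn => by
      rw [h n hn]; simp
  filter_upwards [ae_all_iff.2 h1] with v hv hv0
  obtain ⟨k, hk⟩ := exists_nat_gt v
  exact hv k ⟨hv0, hk⟩

/-! ### Laplace transforms and primitives -/

/-- The Laplace transform of a function on the half-line `(0, ∞)`. -/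
noncomputable def laplaceTransform (F : ℝ → ℂ) (z : ℂ) : ℂ :=
  ∫ v in Ioi (0 : ℝ), F v * Complex.exp (-(z * v))

theorem norm_mul_cexp_neg (w z : ℂ) (v : ℝ) :
    ‖w * Complex.exp (-(z * v))‖ = ‖w‖ * Real.exp (-(z.re * v)) := by
  rw [norm_mul, Complex.norm_exp]
  simp

theorem integrableOn_mul_cexp_neg {F : ℝ → ℂ} {σ : ℝ}
    (hF : IntegrableOn (fun v => F v * Real.exp (-(σ * v))) (Ioi 0)) {z : ℂ} (hz : σ ≤ z.re) :
    IntegrableOn (fun v : ℝ => F v * Complex.exp (-(z * v))) (Ioi 0) := by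
  have h1 : IntegrableOn (fun v : ℝ => (F v * Real.exp (-(σ * v))) *
      Complex.exp (-((z - σ) * v))) (Ioi 0) := by
    refine Integrable.mul_bdd (c := 1) hF (by fun_prop) ?_
    filter_upwards [ae_restrict_mem measurableSet_Ioi] with v hv
    have hv' : (0 : ℝ) < v := hv
    rw [Complex.norm_exp, Real.exp_le_one_iff]
    simp only [Complex.neg_re, Complex.mul_re, Complex.sub_re, Complex.ofReal_re, Complex.sub_im,
      Complex.ofReal_im, mul_zero, sub_zero]
    nlinarith
  refine h1.congr_fun (fun v _ => ?_) measurableSet_Ioi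
  simp only
  rw [mul_assoc, Complex.ofReal_exp, ← Complex.exp_add]
  congr 2
  push_cast
  ring

theorem integrableOn_mul_exp_neg_mono {F : ℝ → ℂ} {σ τ : ℝ}
    (hF : IntegrableOn (fun v => F v * Real.exp (-(σ * v))) (Ioi 0)) (h : σ ≤ τ) :
    IntegrableOn (fun v : ℝ => F v * Real.exp (-(τ * v))) (Ioi 0) := by
  simpa using integrableOn_mul_cexp_neg hF (z := (τ : ℂ)) (by simpa using h)

theorem differentiableOn_laplaceTransform {F : ℝ → ℂ} {σ₀ : ℝ}
    (hF : ∀ σ : ℝ, σ₀ < σ → IntegrableOn (fun v => F v * Real.exp (-(σ * v))) (Ioi 0)) :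
    DifferentiableOn ℂ (laplaceTransform F) {z : ℂ | σ₀ < z.re} := by
  intro z hz
  have hz' : σ₀ < z.re := hz
  obtain ⟨σ, hσ, hσz⟩ := exists_between hz'
  obtain ⟨τ, hτ, hτz⟩ := exists_between hσz
  have hU : {w : ℂ | τ < w.re} ∈ 𝓝 z :=
    (isOpen_lt continuous_const Complex.continuous_re).mem_nhds hτz
  have hFs : ∀ {w : ℂ}, σ ≤ w.re → IntegrableOn (fun v : ℝ => F v * Complex.exp (-(w * v))) (Ioi 0) :=
    fun hw => integrableOn_mul_cexp_neg (hF σ hσ) hw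
  have key := hasDerivAt_integral_of_dominated_loc_of_deriv_le (𝕜 := ℂ)
    (μ := volume.restrict (Ioi (0 : ℝ)))
    (F := fun z v => F v * Complex.exp (-(z * v)))
    (F' := fun z v => F v * (Complex.exp (-(z * v)) * (-v)))
    -- The factor v produced by differentiation is absorbed by the gap between σ and τ: (τ-σ)v ≤
    -- e^{(τ-σ)v}.
    (bound := fun v => (τ - σ)⁻¹ * ‖F v * Real.exp (-(σ * v))‖) (x₀ := z) hU
    (by
      filter_upwards [hU] with w hw
      exact (hFs (w := w) (by have : τ < w.re := hw; linarith)).aestronglyMeasurable)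
    (hFs hσz.le)
    (by
      have := (hFs hσz.le).aestronglyMeasurable.mul
        (f := fun v : ℝ => (F v * Complex.exp (-(z * v)))) (g := fun v : ℝ => (-v : ℂ)) (by fun_prop)
      refine this.congr (Eventually.of_forall fun v => ?_)
      simp only [Pi.mul_apply]
      ring)
    (by
      filter_upwards [ae_restrict_mem measurableSet_Ioi] with v hv w hw
      have hv' : (0 : ℝ) < v := hv
      have hw' : τ < w.re := hw
      rw [← mul_assoc, norm_mul, norm_mul_cexp_neg, norm_neg, Complex.norm_real, norm_mul,
        Complex.norm_real, Real.norm_of_nonneg hv'.le, Real.norm_eq_abs, Real.abs_exp, mul_assoc,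
        le_inv_mul_iff₀ (by linarith), mul_left_comm]
      refine mul_le_mul_of_nonneg_left ?_ (norm_nonneg _)
      have h1 : (τ - σ) * v ≤ Real.exp ((τ - σ) * v) := by
        linarith [Real.add_one_le_exp ((τ - σ) * v)]
      calc (τ - σ) * (Real.exp (-(w.re * v)) * v) = Real.exp (-(w.re * v)) * ((τ - σ) * v) := by ring
        _ ≤ Real.exp (-(w.re * v)) * Real.exp ((τ - σ) * v) := by gcongr
        _ = Real.exp (-((w.re - τ + σ) * v)) := by rw [← Real.exp_add]; congr 1; ring
        _ ≤ _ := by gcongr; linarith)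
    ((hF σ hσ).norm.const_mul _)
    (by
      filter_upwards with v w _
      have h1 : HasDerivAt (fun w : ℂ => -(w * v)) (-(v : ℂ)) w := by
        simpa using ((hasDerivAt_id' w).mul_const (v : ℂ)).fun_neg
      exact (h1.cexp).const_mul (F v))
  exact key.2.differentiableAt.differentiableWithinAt

/-- Half of the exponent is spent on the primitive, which is at most K e^{σv/2}; the other half
remains for integrability. -/
theorem integrableOn_primitive_mul_exp_neg {h : ℝ → ℂ}
    (hh : ∀ σ : ℝ, 0 < σ → IntegrableOn (fun v => h v * Real.exp (-(σ * v))) (Ioi 0))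
    (hc : Continuous fun v => ∫ t in (0 : ℝ)..v, h t) {σ : ℝ} (hσ : 0 < σ) :
    IntegrableOn (fun v => (∫ t in (0 : ℝ)..v, h t) * Real.exp (-(σ * v))) (Ioi 0) := by
  set K := ∫ t in Ioi (0 : ℝ), ‖h t * Real.exp (-(σ / 2 * t))‖
  have hI : IntegrableOn (fun v : ℝ => K * Real.exp (-(σ / 2) * v)) (Ioi 0) :=
    (integrableOn_exp_mul_Ioi (by linarith) 0).const_mul K
  refine Integrable.mono' hI ?_ ?_
  · exact (hc.mul (by fun_prop)).aestronglyMeasurable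
  · filter_upwards [ae_restrict_mem measurableSet_Ioi] with v hv
    have hv' : (0 : ℝ) < v := hv
    have h1 : ‖∫ t in (0 : ℝ)..v, h t‖ ≤ K * Real.exp (σ / 2 * v) := by
      rw [intervalIntegral.integral_of_le hv'.le]
      have hi := hh (σ / 2) (by linarith)
      calc ‖∫ t in Ioc 0 v, h t‖ ≤ ∫ t in Ioc 0 v, ‖h t * Real.exp (-(σ / 2 * t))‖ *
            Real.exp (σ / 2 * v) := by
            refine norm_integral_le_of_norm_le
              ((hi.mono_set Ioc_subset_Ioi_self).norm.mul_const _) ?_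
            filter_upwards [ae_restrict_mem measurableSet_Ioc] with t ht
            rw [norm_mul, Complex.norm_real, Real.norm_eq_abs, Real.abs_exp, mul_assoc,
              ← Real.exp_add]
            refine le_mul_of_one_le_right (norm_nonneg _) (Real.one_le_exp ?_)
            nlinarith [ht.2]
        _ ≤ _ := by
            rw [integral_mul_const]
            gcongr
            exact setIntegral_mono_set hi.norm (ae_of_all _ fun t => norm_nonneg _)
              (LE.le.eventuallyLE Ioc_subset_Ioi_self)
    rw [norm_mul, Complex.norm_real, Real.norm_eq_abs, Real.abs_exp]
    calc _ ≤ K * Real.exp (σ / 2 * v) * Real.exp (-(σ * v)) := by gcongr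
      _ = _ := by rw [mul_assoc, ← Real.exp_add]; congr 2; ring

/-- Fubini on the triangle 0 < t < v; the inner integral of e^{-zv} over v > t supplies the factor
1/z. -/
theorem mul_laplaceTransform_primitive {h : ℝ → ℂ}
    (hh : ∀ σ : ℝ, 0 < σ → IntegrableOn (fun v => h v * Real.exp (-(σ * v))) (Ioi 0))
    {z : ℂ} (hz : 0 < z.re) :
    z * laplaceTransform (fun v => ∫ t in (0 : ℝ)..v, h t) z = laplaceTransform h z := by
  have hz0 : z ≠ 0 := by rintro rfl; simp at hz
  have hm : AEStronglyMeasurable h (volume.restrict (Ioi 0)) := by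
    have := (hh 1 one_pos).aestronglyMeasurable.mul
      (g := fun v : ℝ => ((Real.exp (1 * v) : ℝ) : ℂ)) (by fun_prop)
    refine this.congr (Eventually.of_forall fun v => ?_)
    simp only [Pi.mul_apply]
    rw [mul_assoc, ← Complex.ofReal_mul, ← Real.exp_add]
    simp
  set k : ℝ → ℝ → ℂ := fun v t => (Iio v).indicator h t * Complex.exp (-(z * v)) with hk
  have hki : Integrable (Function.uncurry k)
      ((volume.restrict (Ioi (0 : ℝ))).prod (volume.restrict (Ioi (0 : ℝ)))) := by
    have h1 : IntegrableOn (fun v : ℝ => Real.exp (-(z.re / 2) * v)) (Ioi 0) :=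
      integrableOn_exp_mul_Ioi (by linarith) 0
    -- On t < v the exponent splits: e^{-Re z · v} ≤ e^{-Re z · v/2} e^{-Re z · t/2}, a product of
    -- integrable weights.
    refine Integrable.mono' (h1.mul_prod (hh (z.re / 2) (by linarith)).norm) ?_ ?_
    · have h2 : Function.uncurry k = fun p : ℝ × ℝ =>
          {p : ℝ × ℝ | p.2 < p.1}.indicator (fun p => h p.2) p * Complex.exp (-(z * p.1)) := by
        ext ⟨v, t⟩
        simp [hk, indicator]
      rw [h2]
      refine AEStronglyMeasurable.mul ?_ (by fun_prop)
      exact hm.comp_snd.indicator (measurableSet_lt measurable_snd measurable_fst)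
    · have h3 : ∀ᵐ p : ℝ × ℝ ∂((volume.restrict (Ioi (0 : ℝ))).prod
          (volume.restrict (Ioi (0 : ℝ)))), p ∈ Ioi (0 : ℝ) ×ˢ Ioi (0 : ℝ) := by
        rw [Measure.prod_restrict]
        exact ae_restrict_mem (measurableSet_Ioi.prod measurableSet_Ioi)
      filter_upwards [h3] with p hp
      have hp1 : 0 < p.1 := hp.1
      have hp2 : 0 < p.2 := hp.2
      simp only [Function.uncurry, hk]
      by_cases hlt : p.2 < p.1
      · rw [indicator_of_mem (show p.2 ∈ Iio p.1 from hlt), norm_mul_cexp_neg, norm_mul,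
          Complex.norm_real, Real.norm_eq_abs, Real.abs_exp, mul_left_comm, ← Real.exp_add]
        gcongr
        nlinarith
      · rw [indicator_of_notMem (show p.2 ∉ Iio p.1 from hlt), zero_mul, norm_zero]
        positivity
  have e1 : ∀ v ∈ Ioi (0 : ℝ), ∫ t in Ioi (0 : ℝ), k v t =
      (∫ t in (0 : ℝ)..v, h t) * Complex.exp (-(z * v)) := by
    intro v hv
    have hv' : (0 : ℝ) < v := hv
    simp only [hk]
    rw [integral_mul_const, integral_indicator measurableSet_Iio,
      Measure.restrict_restrict measurableSet_Iio, Iio_inter_Ioi,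
      intervalIntegral.integral_of_le hv'.le, integral_Ioc_eq_integral_Ioo]
  have e2 : ∀ t ∈ Ioi (0 : ℝ), ∫ v in Ioi (0 : ℝ), k v t = h t * Complex.exp (-(z * t)) / z := by
    intro t ht
    have ht' : (0 : ℝ) < t := ht
    have h1 : ∀ v, k v t = (Ioi t).indicator (fun v : ℝ => h t * Complex.exp (-z * v)) v := by
      intro v
      simp only [hk, indicator, mem_Iio, mem_Ioi]
      split_ifs <;> simp
    simp only [h1]
    rw [integral_indicator measurableSet_Ioi, Measure.restrict_restrict measurableSet_Ioi,
      Ioi_inter_Ioi, sup_eq_left.2 ht'.le, integral_const_mul,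
      integral_exp_mul_complex_Ioi (by simpa using hz)]
    rw [neg_div_neg_eq, neg_mul]
    ring
  have e3 := integral_integral_swap hki
  rw [setIntegral_congr_fun measurableSet_Ioi e1, setIntegral_congr_fun measurableSet_Ioi e2,
    integral_div] at e3
  rw [laplaceTransform, laplaceTransform, e3]
  field_simp

/-! ### Regularity of iterated primitives -/

/-- A crude form of Cauchy–Schwarz. It provides the Hölder exponent 1/2 used at the cuts and at
their tips; for p = 1, where F is a single primitive of an L² function, no better regularity is at
hand. -/
theorem exists_norm_integral_le_sqrt {J : ℝ → ℂ} {R : ℝ}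
    (hJ : MemLp J 2 (volume.restrict (Icc (-R) R))) :
    ∃ L : ℝ, 0 ≤ L ∧ ∀ u ∈ Icc (-R) R, ∀ v ∈ Icc (-R) R,
      ‖∫ t in u..v, J t‖ ≤ L * Real.sqrt |v - u| := by
  have hJ2 := (memLp_two_iff_integrable_sq_norm hJ.1).1 hJ
  set E := ∫ t in Icc (-R) R, ‖J t‖ ^ 2 with hE
  have hE0 : 0 ≤ E := integral_nonneg fun t => by positivity
  refine ⟨1 + E, by linarith, ?_⟩
  have key : ∀ u ∈ Icc (-R) R, ∀ v ∈ Icc (-R) R, u < v →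
      ‖∫ t in u..v, J t‖ ≤ (1 + E) * Real.sqrt |v - u| := by
    intro u hu v hv huv
    have hsub : Ioc u v ⊆ Icc (-R) R := fun t ht => ⟨hu.1.trans ht.1.le, ht.2.trans hv.2⟩
    set s := Real.sqrt |v - u| with hs
    have hs0 : 0 < s := Real.sqrt_pos.2 (abs_pos.2 (sub_ne_zero.2 huv.ne'))
    have hss : s * s = v - u := by
      rw [hs, Real.mul_self_sqrt (abs_nonneg _), abs_of_pos (sub_pos.2 huv)]
    rw [intervalIntegral.integral_of_le huv.le]
    have hJu : IntegrableOn (fun t => ‖J t‖ ^ 2) (Ioc u v) := IntegrableOn.mono_set hJ2 hsub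
    -- Pointwise, |J| ≤ s⁻¹ + s|J|² with s = √(v-u); the interval has length s², so s⁻¹ integrates
    -- to s.
    calc ‖∫ t in Ioc u v, J t‖ ≤ ∫ t in Ioc u v, (s⁻¹ + s * ‖J t‖ ^ 2) := by
          refine norm_integral_le_of_norm_le
            ((integrableOn_const (by simp)).add (hJu.const_mul s)) ?_
          filter_upwards with t
          have h1 : 0 ≤ s⁻¹ * (1 - s * ‖J t‖) ^ 2 + ‖J t‖ := by positivity
          have h2 : s⁻¹ * (1 - s * ‖J t‖) ^ 2 = s⁻¹ - 2 * ‖J t‖ + s * ‖J t‖ ^ 2 := by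
            field_simp
            ring
          linarith
      _ = s + s * ∫ t in Ioc u v, ‖J t‖ ^ 2 := by
          have hc : IntegrableOn (fun _ : ℝ => s⁻¹) (Ioc u v) := integrableOn_const (by simp)
          rw [integral_add hc (hJu.const_mul s), integral_const_mul]
          congr 1
          simp only [integral_const, MeasurableSet.univ, measureReal_restrict_apply, univ_inter,
            Real.volume_real_Ioc_of_le huv.le, smul_eq_mul]
          rw [← hss]
          field_simp
      _ ≤ s + s * E := by
          gcongr
          exact setIntegral_mono_set hJ2 (ae_of_all _ fun t => by positivity)
            (LE.le.eventuallyLE hsub)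
      _ = _ := by ring
  intro u hu v hv
  rcases lt_trichotomy u v with h | h | h
  · exact key u hu v hv h
  · simp [h]
  · rw [intervalIntegral.integral_symm, norm_neg, abs_sub_comm]
    exact key v hv u hu h

/-- The iterated primitive, vanishing at `0`. -/
noncomputable def iteratedPrimitive (h : ℝ → ℂ) : ℕ → ℝ → ℂ
  | 0 => h
  | k + 1 => fun v => ∫ t in (0 : ℝ)..v, iteratedPrimitive h k t

theorem locallyIntegrable_iteratedPrimitive {h : ℝ → ℂ} (hh : LocallyIntegrable h volume) :
    ∀ k, LocallyIntegrable (iteratedPrimitive h k) volume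
  | 0 => hh
  | k + 1 => (intervalIntegral.continuous_primitive (fun _ _ =>
      ((locallyIntegrable_iteratedPrimitive hh k).integrableOn_isCompact
        isCompact_uIcc).intervalIntegrable) 0).locallyIntegrable

theorem continuous_iteratedPrimitive_succ {h : ℝ → ℂ} (hh : LocallyIntegrable h volume) (k : ℕ) :
    Continuous (iteratedPrimitive h (k + 1)) :=
  intervalIntegral.continuous_primitive (fun _ _ =>
      ((locallyIntegrable_iteratedPrimitive hh k).integrableOn_isCompact
        isCompact_uIcc).intervalIntegrable) 0

/-- The first primitive is only continuous; each further one gains a derivative. This is why p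
primitives give class C^{p-1}. -/
theorem contDiff_iteratedPrimitive_succ {h : ℝ → ℂ} (hh : LocallyIntegrable h volume) (k : ℕ) :
    ContDiff ℝ (k : WithTop ℕ∞) (iteratedPrimitive h (k + 1)) := by
  induction k with
  | zero => exact contDiff_zero.2 (continuous_iteratedPrimitive_succ hh 0)
  | succ k ih =>
    have hd : ∀ v, HasDerivAt (iteratedPrimitive h (k + 2)) (iteratedPrimitive h (k + 1) v) v :=
      fun v => intervalIntegral.integral_hasDerivAt_right
        ((continuous_iteratedPrimitive_succ hh k).intervalIntegrable _ _)
        ((continuous_iteratedPrimitive_succ hh k).stronglyMeasurableAtFilter _ _)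
        (continuous_iteratedPrimitive_succ hh k).continuousAt
    have := contDiff_succ_iff_deriv (𝕜 := ℝ) (n := (k : WithTop ℕ∞))
      (f := iteratedPrimitive h (k + 1 + 1))
    push_cast
    rw [this]
    refine ⟨fun v => (hd v).differentiableAt, by simp, ?_⟩
    rwa [funext fun v => (hd v).deriv]

theorem iteratedPrimitive_eq_zero {h : ℝ → ℂ} (hh : ∀ v ≤ 0, h v = 0) :
    ∀ k, ∀ v ≤ 0, iteratedPrimitive h k v = 0
  | 0 => hh
  | k + 1 => fun v hv => by
    simp only [iteratedPrimitive]
    rw [intervalIntegral.integral_symm, intervalIntegral.integral_of_le hv,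
      setIntegral_eq_zero_of_forall_eq_zero fun t ht => iteratedPrimitive_eq_zero hh k t ht.2,
      neg_zero]

theorem integrableOn_iteratedPrimitive {h : ℝ → ℂ} (hh : LocallyIntegrable h volume)
    (hi : ∀ σ : ℝ, 0 < σ → IntegrableOn (fun v => h v * Real.exp (-(σ * v))) (Ioi 0)) :
    ∀ (k : ℕ) (σ : ℝ), 0 < σ →
      IntegrableOn (fun v => iteratedPrimitive h k v * Real.exp (-(σ * v))) (Ioi 0)
  | 0 => hi
  | k + 1 => fun _ hσ => integrableOn_primitive_mul_exp_neg
      (integrableOn_iteratedPrimitive hh hi k) (continuous_iteratedPrimitive_succ hh k) hσ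

theorem pow_mul_laplaceTransform_iteratedPrimitive {h : ℝ → ℂ} (hh : LocallyIntegrable h volume)
    (hi : ∀ σ : ℝ, 0 < σ → IntegrableOn (fun v => h v * Real.exp (-(σ * v))) (Ioi 0))
    {z : ℂ} (hz : 0 < z.re) (k : ℕ) :
    z ^ k * laplaceTransform (iteratedPrimitive h k) z = laplaceTransform h z := by
  induction k with
  | zero => simp [iteratedPrimitive]
  | succ k ih =>
    rw [pow_succ, mul_assoc, ← ih]
    congr 1
    exact mul_laplaceTransform_primitive (integrableOn_iteratedPrimitive hh hi k) hz

theorem memLp_iteratedPrimitive {h : ℝ → ℂ} (hh : MemLp h 2) (k : ℕ) (R : ℝ) :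
    MemLp (iteratedPrimitive h k) 2 (volume.restrict (Icc (-R) R)) := by
  cases k with
  | zero => exact hh.restrict _
  | succ k =>
    have := (continuous_iteratedPrimitive_succ (hh.locallyIntegrable (by norm_num)) k)
    rw [memLp_two_iff_integrable_sq_norm this.aestronglyMeasurable]
    exact (this.norm.pow 2).integrableOn_Icc

/-! ### The Fourier transform on L¹ ∩ L² -/

open FourierTransform in
theorem integral_fourier_mul_eq_integral_mul_fourier {f g : ℝ → ℂ} (hf : Integrable f)
    (hg : Integrable g) : ∫ w, 𝓕 f w * g w = ∫ v, f v * 𝓕 g v := by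
  simpa using! VectorFourier.integral_fourierIntegral_smul_eq_flip (L := innerₗ ℝ)
    Real.continuous_fourierChar continuous_inner hf hg

open FourierTransform in
theorem integral_fourierInv_mul_eq_integral_mul_fourierInv {f g : ℝ → ℂ} (hf : Integrable f)
    (hg : Integrable g) : ∫ w, 𝓕⁻ f w * g w = ∫ v, f v * 𝓕⁻ g v := by
  have h := integral_fourier_mul_eq_integral_mul_fourier hf hg.comp_neg
  rw [← integral_neg_eq_self] at h
  rw [Real.fourierInv_eq_fourier_comp_neg g, ← h]
  simp [Real.fourierInv_eq_fourier_neg]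

open FourierTransform in
theorem continuous_fourier_of_integrable {f : ℝ → ℂ} (hf : Integrable f) : Continuous (𝓕 f) :=
  VectorFourier.fourierIntegral_continuous Real.continuous_fourierChar
    (by exact continuous_inner) hf

open FourierTransform in
theorem continuous_fourierInv_of_integrable {f : ℝ → ℂ} (hf : Integrable f) :
    Continuous (𝓕⁻ f) := by
  rw [Real.fourierInv_eq_fourier_comp_neg]
  exact continuous_fourier_of_integrable hf.comp_neg

open FourierTransform in
/-- On `L¹ ∩ L²`, the Fourier transform of `L²` is given by the Fourier integral. -/
theorem MeasureTheory.MemLp.fourier_toLp_ae_eq {f : ℝ → ℂ} (h2 : MemLp f 2) (h1 : Integrable f) :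
    ((𝓕 (h2.toLp f) : Lp ℂ 2 (volume : Measure ℝ)) : ℝ → ℂ) =ᵐ[volume] 𝓕 f := by
  refine ae_eq_of_integral_contDiff_smul_eq
    ((Lp.memLp _).locallyIntegrable (by norm_num))
    (continuous_fourier_of_integrable h1).locallyIntegrable fun g hg hgc => ?_
  have hgc' : HasCompactSupport fun x => (g x : ℂ) := hgc.comp_left Complex.ofReal_zero
  set φ : SchwartzMap ℝ ℂ := hgc'.toSchwartzMap (Complex.ofRealCLM.contDiff.comp hg) with hφ
  have hφg : ∀ x, φ x = g x := fun x => rfl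
  -- The L² transform is compared with the Fourier integral by testing on φ: on the L² side φ's
  -- transform appears by duality of tempered distributions, on the L¹ side by Fubini.
  have e1 := congrArg (fun T => T φ) (Lp.fourier_toTemperedDistribution_eq (h2.toLp f))
  simp only [TemperedDistribution.fourier_apply, Lp.toTemperedDistribution_apply,
    SchwartzMap.fourier_coe, smul_eq_mul] at e1
  simp only [Complex.real_smul, ← hφg]
  rw [← e1]
  have e2 := integral_fourier_mul_eq_integral_mul_fourier φ.integrable h1
  rw [← e2]
  refine integral_congr_ae ?_
  filter_upwards [h2.coeFn_toLp] with x hx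
  rw [hx]

open FourierTransform in
/-- On `L¹ ∩ L²`, the inverse Fourier transform of `L²` is given by the Fourier integral. -/
theorem MeasureTheory.MemLp.fourierInv_toLp_ae_eq {f : ℝ → ℂ} (h2 : MemLp f 2)
    (h1 : Integrable f) : ((𝓕⁻ (h2.toLp f) : Lp ℂ 2 (volume : Measure ℝ)) : ℝ → ℂ) =ᵐ[volume] 𝓕⁻ f := by
  refine ae_eq_of_integral_contDiff_smul_eq
    ((Lp.memLp _).locallyIntegrable (by norm_num))
    (continuous_fourierInv_of_integrable h1).locallyIntegrable fun g hg hgc => ?_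
  have hgc' : HasCompactSupport fun x => (g x : ℂ) := hgc.comp_left Complex.ofReal_zero
  set φ : SchwartzMap ℝ ℂ := hgc'.toSchwartzMap (Complex.ofRealCLM.contDiff.comp hg) with hφ
  have hφg : ∀ x, φ x = g x := fun x => rfl
  have e1 := congrArg (fun T => T φ) (Lp.fourierInv_toTemperedDistribution_eq (h2.toLp f))
  simp only [TemperedDistribution.fourierInv_apply, Lp.toTemperedDistribution_apply,
    SchwartzMap.fourierInv_coe, smul_eq_mul] at e1
  simp only [Complex.real_smul, ← hφg]
  rw [← e1]
  have e2 := integral_fourierInv_mul_eq_integral_mul_fourierInv φ.integrable h1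
  rw [← e2]
  refine integral_congr_ae ?_
  filter_upwards [h2.coeFn_toLp] with x hx
  rw [hx]

/-! ### Laplace transforms as Hardy functions, and Plancherel -/

theorem eLpNorm_comp_div {g : ℝ → ℂ} (hg : AEStronglyMeasurable g) {c : ℝ} (hc : 0 < c) :
    eLpNorm (fun x => g (x / c)) 2 volume =
      ENNReal.ofReal c ^ (1 / (2 : ENNReal)).toReal * eLpNorm g 2 volume := by
  have h1 := Real.map_volume_mul_left (inv_ne_zero hc.ne')
  rw [inv_inv, abs_of_pos hc] at h1
  have h2 : (fun x => g (x / c)) = g ∘ fun x => c⁻¹ * x := by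
    ext x; simp [div_eq_inv_mul]
  rw [h2, ← eLpNorm_map_measure (by rw [h1]; exact hg.smul_measure _) (by fun_prop), h1,
    eLpNorm_smul_measure_of_ne_top (by simp)]
  rfl

theorem quasiMeasurePreserving_div {c : ℝ} (hc : 0 < c) :
    Measure.QuasiMeasurePreserving (fun x : ℝ => x / c) volume volume := by
  refine ⟨by fun_prop, ?_⟩
  have h1 := Real.map_volume_mul_left (inv_ne_zero hc.ne')
  have h2 : (fun x : ℝ => x / c) = fun x => c⁻¹ * x := by
    ext x; simp [div_eq_inv_mul]
  rw [h2, h1]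
  exact Measure.smul_absolutelyContinuous

/-- The function `v ↦ F(v) e^{-σ v}` on `(0, ∞)`, extended by zero. -/
noncomputable def expWeight (F : ℝ → ℂ) (σ : ℝ) : ℝ → ℂ :=
  (Ioi (0 : ℝ)).indicator fun v => F v * Real.exp (-(σ * v))

theorem expWeight_norm_le (F : ℝ → ℂ) {σ τ : ℝ} (h : σ ≤ τ) (v : ℝ) :
    ‖expWeight F τ v‖ ≤ ‖expWeight F σ v‖ := by
  by_cases hv : v ∈ Ioi (0 : ℝ)
  · have hv' : (0 : ℝ) < v := hv
    simp only [expWeight, indicator_of_mem hv, norm_mul, Complex.norm_real, Real.norm_eq_abs,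
      Real.abs_exp]
    gcongr
  · simp [expWeight, indicator_of_notMem hv]

theorem aestronglyMeasurable_expWeight {F : ℝ → ℂ}
    {σ : ℝ} (hF : AEStronglyMeasurable (expWeight F σ)) (τ : ℝ) :
    AEStronglyMeasurable (expWeight F τ) := by
  have h := hF.mul (g := fun v : ℝ => ((Real.exp ((σ - τ) * v) : ℝ) : ℂ)) (by fun_prop)
  refine h.congr (Eventually.of_forall fun v => ?_)
  by_cases hv : v ∈ Ioi (0 : ℝ)
  · simp only [Pi.mul_apply, expWeight, indicator_of_mem hv]
    rw [mul_assoc, ← Complex.ofReal_mul, ← Real.exp_add]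
    congr 3
    ring
  · simp [expWeight, indicator_of_notMem hv]

theorem memLp_expWeight {F : ℝ → ℂ} {σ : ℝ} (hF : MemLp (expWeight F σ) 2) {τ : ℝ} (h : σ ≤ τ) :
    MemLp (expWeight F τ) 2 :=
  hF.mono (aestronglyMeasurable_expWeight hF.1 τ) (ae_of_all _ (expWeight_norm_le F h))

/-- Cauchy–Schwarz against e^{-(τ-σ)v}: raising the exponent turns square integrability into
integrability. -/
theorem integrableOn_of_memLp_expWeight {F : ℝ → ℂ} {σ : ℝ} (hF : MemLp (expWeight F σ) 2) {τ : ℝ}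
    (h : σ < τ) : IntegrableOn (fun v => F v * Real.exp (-(τ * v))) (Ioi 0) := by
  have h1 : MemLp ((Ioi (0 : ℝ)).indicator fun v => ((Real.exp (-((τ - σ) * v)) : ℝ) : ℂ)) 2 := by
    rw [memLp_indicator_iff_restrict measurableSet_Ioi,
      memLp_two_iff_integrable_sq_norm (by fun_prop)]
    have := integrableOn_exp_mul_Ioi (a := -(2 * (τ - σ))) (by linarith) 0
    refine this.congr_fun (fun v _ => ?_) measurableSet_Ioi
    simp only [Complex.norm_real, Real.norm_eq_abs, Real.abs_exp, ← Real.exp_nat_mul]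
    congr 1
    push_cast
    ring
  have h2 := hF.integrable_mul h1
  refine (h2.integrableOn (s := Ioi 0)).congr_fun (fun v hv => ?_) measurableSet_Ioi
  simp only [Pi.mul_apply, expWeight, indicator_of_mem hv]
  rw [mul_assoc, ← Complex.ofReal_mul, ← Real.exp_add]
  congr 3
  ring

theorem integrable_expWeight {F : ℝ → ℂ} {σ : ℝ}
    (hF : IntegrableOn (fun v => F v * Real.exp (-(σ * v))) (Ioi 0)) :
    Integrable (expWeight F σ) :=
  hF.integrable_indicator measurableSet_Ioi

open FourierTransform in
theorem laplaceTransform_eq_fourier (F : ℝ → ℂ) (σ ν : ℝ) :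
    laplaceTransform F (σ + ν * Complex.I) = 𝓕 (expWeight F σ) (ν / (2 * Real.pi)) := by
  rw [Real.fourier_real_eq_integral_exp_smul, laplaceTransform, ← integral_indicator measurableSet_Ioi]
  congr 1
  ext v
  by_cases hv : v ∈ Ioi (0 : ℝ)
  · simp only [expWeight, indicator_of_mem hv, smul_eq_mul]
    rw [mul_left_comm, Complex.ofReal_exp, ← Complex.exp_add]
    congr 2
    push_cast
    field_simp
    ring
  · simp [expWeight, indicator_of_notMem hv]

open FourierTransform in
/-- The Laplace transform in `Re z > -1/2`, extended to the line `Re z = -1/2` by the Fourier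
transform of `L²`. -/
noncomputable def hardyLaplace (F : ℝ → ℂ) (hF : MemLp (expWeight F (-(1 / 2))) 2) (z : ℂ) : ℂ :=
  if -(1 / 2 : ℝ) < z.re then laplaceTransform F z
  -- This branch also assigns irrelevant values for Re z < -1/2. On the line itself a representative
  -- of an L² class is chosen.
  else (𝓕 (hF.toLp _) : Lp ℂ 2 (volume : Measure ℝ)) (z.im / (2 * Real.pi))

section HardyLaplace

variable {F : ℝ → ℂ} (hF : MemLp (expWeight F (-(1 / 2))) 2)

open FourierTransform in
theorem hardyLaplace_ae_eq {σ : ℝ} (hσ : -(1 / 2) ≤ σ) :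
    (fun ν : ℝ => hardyLaplace F hF (σ + ν * Complex.I)) =ᵐ[volume]
      fun ν => (𝓕 ((memLp_expWeight hF hσ).toLp _) : Lp ℂ 2 (volume : Measure ℝ)) (ν / (2 * Real.pi)) := by
  rcases hσ.lt_or_eq with h | rfl
  · have h1 := (memLp_expWeight hF hσ).fourier_toLp_ae_eq
      (integrable_expWeight (integrableOn_of_memLp_expWeight hF h))
    have h2 := (quasiMeasurePreserving_div Real.two_pi_pos).ae_eq h1
    filter_upwards [h2] with ν hν
    simp only [Function.comp] at hν
    rw [hν, ← laplaceTransform_eq_fourier, hardyLaplace, if_pos (by simpa using h)]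
  · refine Eventually.of_forall fun ν => ?_
    simp [hardyLaplace]

open FourierTransform in
-- Plancherel transfers each claim to the weighted functions F(v)e^{-σv}: their norms decrease in σ,
-- and they converge in L² as σ decreases to -1/2 by dominated convergence.
theorem isHardyFunction_hardyLaplace : IsHardyFunction (hardyLaplace F hF) := by
  set c := ENNReal.ofReal (2 * Real.pi) ^ (1 / (2 : ENNReal)).toReal with hc
  have hc_top : c ≠ ⊤ := by
    rw [hc]
    exact ENNReal.rpow_ne_top_of_nonneg (by simp) ENNReal.ofReal_ne_top
  have hmeas : ∀ G : Lp ℂ 2 (volume : Measure ℝ), AEStronglyMeasurable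
      (fun ν : ℝ => (G : ℝ → ℂ) (ν / (2 * Real.pi))) := fun G =>
    (Lp.aestronglyMeasurable G).comp_quasiMeasurePreserving
      (quasiMeasurePreserving_div Real.two_pi_pos)
  have hnorm : ∀ G : Lp ℂ 2 (volume : Measure ℝ), eLpNorm
      (fun ν : ℝ => ((𝓕 G : Lp ℂ 2 (volume : Measure ℝ)) : ℝ → ℂ) (ν / (2 * Real.pi))) 2 volume = c * ‖G‖ₑ := by
    intro G
    rw [eLpNorm_comp_div (Lp.aestronglyMeasurable _) Real.two_pi_pos, ← Lp.enorm_def]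
    congr 1
    exact (Lp.fourierTransformₗᵢ ℝ ℂ).enorm_map G
  have hline : ∀ σ : ℝ, -(1 / 2 : ℝ) ≤ σ →
      eLpNorm (fun ν : ℝ => hardyLaplace F hF (σ + ν * Complex.I)) 2 volume =
        c * eLpNorm (expWeight F σ) 2 volume := by
    intro σ hσ
    rw [eLpNorm_congr_ae (hardyLaplace_ae_eq hF hσ), hnorm, Lp.enorm_toLp]
  refine ⟨?_, ?_, ?_, ?_⟩
  · refine (differentiableOn_laplaceTransform
      fun σ hσ => integrableOn_of_memLp_expWeight hF hσ).congr fun z hz => ?_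
    exact if_pos hz
  · refine ⟨(c * eLpNorm (expWeight F (-(1 / 2))) 2 volume).toNNReal, fun σ hσ => ?_⟩
    rw [ENNReal.coe_toNNReal (ENNReal.mul_ne_top hc_top hF.2.ne), hline σ hσ.le]
    gcongr
    exact eLpNorm_mono (expWeight_norm_le F hσ.le)
  · refine ⟨(hmeas _).congr (hardyLaplace_ae_eq hF le_rfl).symm, ?_⟩
    rw [hline _ le_rfl]
    exact ENNReal.mul_lt_top hc_top.lt_top hF.2
  · have h1 : ∀ σ : ℝ, -(1 / 2 : ℝ) < σ → eLpNorm (fun ν : ℝ =>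
        hardyLaplace F hF (σ + ν * Complex.I) -
          hardyLaplace F hF (((-(1 / 2) : ℝ) : ℂ) + ν * Complex.I)) 2 volume =
        c * eLpNorm (expWeight F σ - expWeight F (-(1 / 2))) 2 volume := by
      intro σ hσ
      have h2 : (fun ν : ℝ => hardyLaplace F hF (σ + ν * Complex.I) -
          hardyLaplace F hF (((-(1 / 2) : ℝ) : ℂ) + ν * Complex.I)) =ᵐ[volume]
          fun ν => (𝓕 ((memLp_expWeight hF hσ.le).toLp _ - hF.toLp _ : Lp ℂ 2 (volume : Measure ℝ)) : Lp ℂ 2 (volume : Measure ℝ))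
            (ν / (2 * Real.pi)) := by
        have h3 : (𝓕 ((memLp_expWeight hF hσ.le).toLp _ - hF.toLp _ : Lp ℂ 2 (volume : Measure ℝ)) : Lp ℂ 2 (volume : Measure ℝ)) =
            𝓕 ((memLp_expWeight hF hσ.le).toLp _) - 𝓕 (hF.toLp _) :=
          (Lp.fourierTransformₗᵢ ℝ ℂ).map_sub _ _
        rw [h3]
        filter_upwards [hardyLaplace_ae_eq hF hσ.le, hardyLaplace_ae_eq hF le_rfl,
          (quasiMeasurePreserving_div Real.two_pi_pos).ae_eq (Lp.coeFn_sub
            (𝓕 ((memLp_expWeight hF hσ.le).toLp _) : Lp ℂ 2 (volume : Measure ℝ)) (𝓕 (hF.toLp _)))] with ν e1 e2 e3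
        rw [e1, e2]
        exact e3.symm
      rw [eLpNorm_congr_ae h2, hnorm, ← MemLp.toLp_sub, Lp.enorm_toLp]
    have h4 : Tendsto (fun σ : ℝ => eLpNorm (expWeight F σ - expWeight F (-(1 / 2))) 2 volume)
        (𝓝[>] (-(1 / 2 : ℝ))) (𝓝 0) := by
      have hsub : ∀ σ : ℝ, -(1 / 2 : ℝ) < σ →
          MemLp (expWeight F σ - expWeight F (-(1 / 2))) 2 := fun σ hσ =>
        (memLp_expWeight hF hσ.le).sub hF
      have h5 : Tendsto (fun σ : ℝ => ∫ v, ‖(expWeight F σ - expWeight F (-(1 / 2))) v‖ ^ 2)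
          (𝓝[>] (-(1 / 2 : ℝ))) (𝓝 (∫ _ : ℝ, (0 : ℝ))) := by
        refine tendsto_integral_filter_of_dominated_convergence
          (fun v => 4 * ‖expWeight F (-(1 / 2)) v‖ ^ 2) ?_ ?_ ?_ ?_
        · filter_upwards [self_mem_nhdsWithin] with σ hσ
          exact ((hsub σ hσ).1.norm.pow 2)
        · filter_upwards [self_mem_nhdsWithin] with σ hσ
          filter_upwards with v
          have e1 := expWeight_norm_le F (le_of_lt (show -(1 / 2) < σ from hσ)) v
          have e2 := norm_sub_le (expWeight F σ v) (expWeight F (-(1 / 2)) v)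
          rw [Real.norm_of_nonneg (by positivity), Pi.sub_apply]
          calc _ ≤ (2 * ‖expWeight F (-(1 / 2)) v‖) ^ 2 := by gcongr; linarith
            _ = _ := by ring
        · exact ((memLp_two_iff_integrable_sq_norm hF.1).1 hF).const_mul 4
        · filter_upwards with v
          have e1 : Continuous fun σ : ℝ =>
              ‖(expWeight F σ - expWeight F (-(1 / 2))) v‖ ^ 2 := by
            by_cases hv : v ∈ Ioi (0 : ℝ)
            · simp only [Pi.sub_apply, expWeight, indicator_of_mem hv]
              fun_prop
            · simp only [Pi.sub_apply, expWeight, indicator_of_notMem hv]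
              fun_prop
          have e2 := e1.tendsto (-(1 / 2))
          simp only [sub_self, Pi.zero_apply, norm_zero] at e2
          simpa using e2.mono_left nhdsWithin_le_nhds
      rw [integral_zero] at h5
      have h7 := (ENNReal.continuous_ofReal.tendsto _).comp
        ((Real.continuous_sqrt.tendsto _).comp h5)
      rw [Real.sqrt_zero, ENNReal.ofReal_zero] at h7
      refine h7.congr' ?_
      filter_upwards [self_mem_nhdsWithin] with σ hσ
      rw [(hsub σ hσ).eLpNorm_eq_integral_rpow_norm (by simp) (by simp)]
      simp [Real.sqrt_eq_rpow]
    have h6 := ENNReal.Tendsto.const_mul h4 (Or.inr hc_top)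
    rw [mul_zero] at h6
    refine h6.congr' ?_
    filter_upwards [self_mem_nhdsWithin] with σ hσ
    exact (h1 σ hσ).symm

end HardyLaplace

section HardyLaplace

variable {F : ℝ → ℂ} (hF : MemLp (expWeight F (-(1 / 2))) 2)

open FourierTransform in
/-- The values of `hardyLaplace F` on a line, rescaled, are the Fourier transform of the weighted
function. -/
theorem memLp_hardyLaplace_line {σ : ℝ} (hσ : -(1 / 2) ≤ σ) :
    ∃ h : MemLp (fun w : ℝ => hardyLaplace F hF (σ + (w * (2 * Real.pi) : ℝ) * Complex.I)) 2,
      h.toLp _ = (𝓕 ((memLp_expWeight hF hσ).toLp _) : Lp ℂ 2 (volume : Measure ℝ)) := by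
  have h1 := (quasiMeasurePreserving_div (inv_pos.2 Real.two_pi_pos)).ae_eq
    (hardyLaplace_ae_eq hF hσ)
  have h2 : (fun w : ℝ => hardyLaplace F hF (σ + (w * (2 * Real.pi) : ℝ) * Complex.I))
      =ᵐ[volume] (𝓕 ((memLp_expWeight hF hσ).toLp _) : Lp ℂ 2 (volume : Measure ℝ)) := by
    filter_upwards [h1] with w hw
    simp only [Function.comp, div_inv_eq_mul] at hw
    rw [hw]
    congr 1
    field_simp
  refine ⟨(memLp_congr_ae h2).2 (Lp.memLp _), ?_⟩
  exact Lp.ext ((MemLp.coeFn_toLp _).trans h2)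

/-- Unitarity of the Fourier transform; the factor 2π comes from the substitution ν = 2πw. -/
theorem hardyLaplace_plancherel {σ : ℝ} (hσ : -(1 / 2) ≤ σ) :
    Integrable (fun ν : ℝ => ‖hardyLaplace F hF (σ + ν * Complex.I)‖ ^ 2) ∧
    IntegrableOn (fun v : ℝ => ‖F v * (Real.exp (-(σ * v)) : ℂ)‖ ^ 2) (Ioi 0) ∧
    ∫ ν : ℝ, ‖hardyLaplace F hF (σ + ν * Complex.I)‖ ^ 2 =
      2 * Real.pi * ∫ v in Ioi (0 : ℝ), ‖F v * (Real.exp (-(σ * v)) : ℂ)‖ ^ 2 := by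
  obtain ⟨h, hh⟩ := memLp_hardyLaplace_line hF hσ
  have hW := memLp_expWeight hF hσ
  have hind : (fun v => ‖expWeight F σ v‖ ^ 2) =
      (Ioi (0 : ℝ)).indicator fun v => ‖F v * (Real.exp (-(σ * v)) : ℂ)‖ ^ 2 := by
    ext v
    by_cases hv : v ∈ Ioi (0 : ℝ)
    · simp only [expWeight, indicator_of_mem hv, Complex.ofReal_exp]
    · simp [expWeight, indicator_of_notMem hv]
  have hsq : ∀ {f : ℝ → ℂ} (hf : MemLp f 2), ‖hf.toLp f‖ ^ 2 = ∫ x, ‖f x‖ ^ 2 := by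
    intro f hf
    have := inner_self_eq_norm_sq_to_K (𝕜 := ℂ) (hf.toLp f)
    rw [L2.inner_def] at this
    have e : ∫ x, inner ℂ (hf.toLp f x) (hf.toLp f x) = ∫ x, ((‖f x‖ ^ 2 : ℝ) : ℂ) := by
      refine integral_congr_ae ?_
      filter_upwards [hf.coeFn_toLp] with x hx
      rw [hx, inner_self_eq_norm_sq_to_K]
      simp
    rw [e, integral_complex_ofReal] at this
    have h2 : (((∫ x, ‖f x‖ ^ 2 : ℝ)) : ℂ) = ((‖hf.toLp f‖ ^ 2 : ℝ) : ℂ) := by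
      rw [this]; simp
    exact_mod_cast h2.symm
  have hI := (memLp_two_iff_integrable_sq_norm h.1).1 h
  have hnorm : ‖h.toLp _‖ = ‖hW.toLp _‖ := by
    rw [hh]; exact Lp.norm_fourier_eq _
  have hpi : (2 * Real.pi)⁻¹ ≠ 0 := inv_ne_zero Real.two_pi_pos.ne'
  set g : ℝ → ℝ := fun ν => ‖hardyLaplace F hF (σ + ν * Complex.I)‖ ^ 2 with hg
  have hgI : ∀ w : ℝ, ‖hardyLaplace F hF (σ + (w * (2 * Real.pi) : ℝ) * Complex.I)‖ ^ 2 =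
      g (w / (2 * Real.pi)⁻¹) := by
    intro w
    rw [hg, div_inv_eq_mul]
  simp only [hgI] at hI
  refine ⟨(integrable_comp_div_iff g hpi).1 hI, ?_, ?_⟩
  · rw [← integrable_indicator_iff measurableSet_Ioi, ← hind]
    exact (memLp_two_iff_integrable_sq_norm hW.1).1 hW
  · have e1 := hsq h
    rw [hnorm, hsq hW, hind, integral_indicator measurableSet_Ioi] at e1
    simp only [hgI] at e1
    rw [Measure.integral_comp_div, abs_of_pos (inv_pos.2 Real.two_pi_pos), smul_eq_mul] at e1
    rw [e1, mul_inv_cancel_left₀ Real.two_pi_pos.ne']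

open FourierTransform in
-- Fourier inversion on the line: the L² inverse of integrable data is a continuous function, so it
-- agrees with F(v)e^{-σv} everywhere. The vanishing of F for v ≤ 0 keeps the weighted function
-- continuous at 0.
theorem norm_le_integral_hardyLaplace (hc : Continuous F) (h0 : ∀ v ≤ 0, F v = 0) {σ : ℝ}
    (hσ : -(1 / 2) ≤ σ) (hI : Integrable fun ν : ℝ => hardyLaplace F hF (σ + ν * Complex.I))
    (v : ℝ) :
    ‖F v‖ ≤ (1 / (2 * Real.pi) * ∫ ν : ℝ, ‖hardyLaplace F hF (σ + ν * Complex.I)‖) *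
      Real.exp (σ * v) := by
  obtain ⟨h, hh⟩ := memLp_hardyLaplace_line hF hσ
  set g : ℝ → ℂ := fun w => hardyLaplace F hF (σ + (w * (2 * Real.pi) : ℝ) * Complex.I) with hg
  have hpi : (2 * Real.pi)⁻¹ ≠ 0 := inv_ne_zero Real.two_pi_pos.ne'
  have hgI : Integrable g := by
    have := (integrable_comp_div_iff _ hpi).2 hI
    simpa only [div_inv_eq_mul] using this
  have h1 := h.fourierInv_toLp_ae_eq hgI
  rw [hh, FourierTransform.fourierInv_fourier_eq] at h1
  have hw : expWeight F σ = fun v => F v * Real.exp (-(σ * v)) := by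
    ext v
    by_cases hv : v ∈ Ioi (0 : ℝ)
    · simp only [expWeight, indicator_of_mem hv]
    · rw [expWeight, indicator_of_notMem hv, h0 v (not_lt.1 hv), zero_mul]
  have h2 := (memLp_expWeight hF hσ).coeFn_toLp.symm.trans h1
  rw [Continuous.ae_eq_iff_eq _ (by rw [hw]; fun_prop)
    (continuous_fourierInv_of_integrable hgI), hw] at h2
  have h3 : ‖F v * Real.exp (-(σ * v))‖ ≤ ∫ w, ‖g w‖ := by
    rw [show F v * Real.exp (-(σ * v)) = 𝓕⁻ g v from congr_fun h2 v,
      Real.fourierInv_eq_fourier_neg]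
    exact VectorFourier.norm_fourierIntegral_le_integral_norm _ _ _ _ _
  have h4 : ∫ w, ‖g w‖ =
      1 / (2 * Real.pi) * ∫ ν : ℝ, ‖hardyLaplace F hF (σ + ν * Complex.I)‖ := by
    have := Measure.integral_comp_div
      (fun ν : ℝ => ‖hardyLaplace F hF (σ + ν * Complex.I)‖) (2 * Real.pi)⁻¹
    rw [abs_of_pos (inv_pos.2 Real.two_pi_pos), smul_eq_mul] at this
    simp only [div_inv_eq_mul] at this
    rw [one_div, ← this]
  rw [h4, norm_mul, Complex.norm_real, Real.norm_eq_abs, Real.abs_exp] at h3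
  calc ‖F v‖ = ‖F v‖ * Real.exp (-(σ * v)) * Real.exp (σ * v) := by
        rw [mul_assoc, ← Real.exp_add]; simp
    _ ≤ _ := by gcongr

end HardyLaplace

/-! ### Hardy functions on vertical lines -/

namespace IsHardyFunction

variable {A B : ℂ → ℂ}

theorem continuous_line (hA : IsHardyFunction A) {σ : ℝ} (hσ : -(1 / 2 : ℝ) < σ) :
    Continuous fun ν : ℝ => A (σ + ν * Complex.I) :=
  hA.holomorphic.continuousOn.comp_continuous (by fun_prop) fun ν => by simpa using hσ

theorem memLp_line (hA : IsHardyFunction A) {σ : ℝ} (hσ : -(1 / 2 : ℝ) ≤ σ) :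
    MemLp (fun ν : ℝ => A (σ + ν * Complex.I)) 2 := by
  rcases hσ.lt_or_eq with h | rfl
  · obtain ⟨K, hK⟩ := hA.bounded
    exact ⟨(hA.continuous_line h).aestronglyMeasurable, (hK σ h).trans_lt ENNReal.coe_lt_top⟩
  · exact hA.boundary_memLp

theorem exists_seq_tendsto_boundary (hA : IsHardyFunction A) {s : ℕ → ℝ}
    (hs : ∀ n, -(1 / 2 : ℝ) < s n) (hlim : Tendsto s atTop (𝓝 (-(1 / 2 : ℝ)))) :
    ∃ ns : ℕ → ℕ, StrictMono ns ∧ ∀ᵐ ν : ℝ, Tendsto (fun i => A (s (ns i) + ν * Complex.I)) atTop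
      (𝓝 (A (((-(1 / 2) : ℝ) : ℂ) + ν * Complex.I))) := by
  have h1 : Tendsto s atTop (𝓝[>] (-(1 / 2 : ℝ))) :=
    tendsto_nhdsWithin_iff.2 ⟨hlim, Eventually.of_forall hs⟩
  exact (tendstoInMeasure_of_tendsto_eLpNorm (p := 2) (by simp)
    (fun n => (hA.continuous_line (hs n)).aestronglyMeasurable) hA.boundary_memLp.1
    (hA.boundary_tendsto.comp h1)).exists_seq_tendsto_ae

/-- L² convergence gives almost everywhere convergence along a subsequence; refining it a second
time serves A and B simultaneously. -/
theorem boundary_ae_eq_pow_mul (hA : IsHardyFunction A) (hB : IsHardyFunction B) {p : ℕ}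
    (h : ∀ z : ℂ, -(1 / 2 : ℝ) < z.re → z ^ p * A z = B z) :
    ∀ᵐ ν : ℝ, (((-(1 / 2) : ℝ) : ℂ) + ν * Complex.I) ^ p *
      A (((-(1 / 2) : ℝ) : ℂ) + ν * Complex.I) = B (((-(1 / 2) : ℝ) : ℂ) + ν * Complex.I) := by
  set s : ℕ → ℝ := fun n => -(1 / 2) + 1 / ((n : ℝ) + 1) with hs
  have hs0 : ∀ n, -(1 / 2 : ℝ) < s n := fun n => by
    have : (0 : ℝ) < 1 / ((n : ℝ) + 1) := by positivity
    simp only [hs]; linarith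
  have hslim : Tendsto s atTop (𝓝 (-(1 / 2 : ℝ))) := by
    simpa [hs] using (tendsto_one_div_add_atTop_nhds_zero_nat (𝕜 := ℝ)).const_add (-(1 / 2 : ℝ))
  obtain ⟨n1, hn1, h1⟩ := hA.exists_seq_tendsto_boundary hs0 hslim
  obtain ⟨n2, hn2, h2⟩ := hB.exists_seq_tendsto_boundary (s := s ∘ n1) (fun n => hs0 _)
    (hslim.comp hn1.tendsto_atTop)
  filter_upwards [h1, h2] with ν e1 e2
  have e3 : Tendsto (fun i => ((s (n1 (n2 i)) : ℂ) + ν * Complex.I) ^ p) atTop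
      (𝓝 ((((-(1 / 2) : ℝ) : ℂ) + ν * Complex.I) ^ p)) := by
    have : Continuous fun x : ℝ => ((x : ℂ) + ν * Complex.I) ^ p := by fun_prop
    exact (this.tendsto _).comp (hslim.comp (hn1.tendsto_atTop.comp hn2.tendsto_atTop))
  refine tendsto_nhds_unique ?_ e2
  refine (e3.mul (e1.comp hn2.tendsto_atTop)).congr fun i => ?_
  exact h _ (by simpa using hs0 _)

/-- Since |z|² ≤ 1 + |z|^{2p} for p ≥ 1, (1+ν²)|A|² is dominated by 2|A|² + |B|²; then |A| ≤
(1+ν²)⁻¹ + (1+ν²)|A|² is integrable. -/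
theorem integrable_line (hA : IsHardyFunction A) (hB : IsHardyFunction B) {p : ℕ} (hp : 1 ≤ p)
    (h : ∀ z : ℂ, -(1 / 2 : ℝ) < z.re → z ^ p * A z = B z) {σ : ℝ} (hσ : -(1 / 2 : ℝ) ≤ σ) :
    Integrable fun ν : ℝ => A (σ + ν * Complex.I) := by
  have hAB : ∀ᵐ ν : ℝ, ((σ : ℂ) + ν * Complex.I) ^ p * A (σ + ν * Complex.I) =
      B (σ + ν * Complex.I) := by
    rcases hσ.lt_or_eq with h' | rfl
    · exact Eventually.of_forall fun ν => h _ (by simpa using h')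
    · exact hA.boundary_ae_eq_pow_mul hB h
  have hA2 := hA.memLp_line hσ
  have hB2 := hB.memLp_line hσ
  have hA2' := (memLp_two_iff_integrable_sq_norm hA2.1).1 hA2
  have hB2' := (memLp_two_iff_integrable_sq_norm hB2.1).1 hB2
  refine Integrable.mono' ((integrable_inv_one_add_sq.add ((hA2'.const_mul 2).add hB2'))) hA2.1 ?_
  filter_upwards [hAB] with ν hν
  set x := ‖A (σ + ν * Complex.I)‖ with hx
  set l := ‖(σ : ℂ) + ν * Complex.I‖ with hl
  have hνl : ν ^ 2 ≤ l ^ 2 := by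
    rw [hl, Complex.sq_norm, Complex.normSq_add_mul_I]
    nlinarith [sq_nonneg σ]
  have hl0 : 0 ≤ l := norm_nonneg _
  have hlp : l ^ 2 ≤ 1 + (l ^ p) ^ 2 := by
    rcases le_total l 1 with h1 | h1
    · nlinarith [sq_nonneg (l ^ p)]
    · have : l ^ 1 ≤ l ^ p := pow_le_pow_right₀ h1 hp
      nlinarith
  simp only [Pi.add_apply]
  rw [← hν, norm_mul, norm_pow, ← hl, ← hx, mul_pow]
  have e1 : 0 < (1 + ν ^ 2)⁻¹ := by positivity
  have e2 : 0 ≤ (1 + ν ^ 2)⁻¹ * (1 - (1 + ν ^ 2) * x) ^ 2 := by positivity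
  have e3 : (1 + ν ^ 2)⁻¹ * (1 - (1 + ν ^ 2) * x) ^ 2 =
      (1 + ν ^ 2)⁻¹ - 2 * x + (1 + ν ^ 2) * x ^ 2 := by
    field_simp
    ring
  have hx0 : 0 ≤ x := norm_nonneg _
  nlinarith [mul_le_mul_of_nonneg_right (hνl.trans hlp) (sq_nonneg x)]

end IsHardyFunction

/-! ### Carlson's theorem and uniqueness of the interpolation -/

theorem isPreconnected_re_gt (c : ℝ) : IsPreconnected {z : ℂ | c < z.re} :=
  (convex_halfSpace_re_gt c).isPreconnected

theorem isOpen_re_gt (c : ℝ) : IsOpen {z : ℂ | c < z.re} :=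
  isOpen_lt continuous_const Complex.continuous_re

/-- Identity theorem; the rule for transforms of primitives is available only for Re z > 0, but the
relation is needed up to Re z = -1/2. -/
theorem pow_mul_eq_of_re_pos {A B : ℂ → ℂ} {c : ℝ} (hc : c < 0) {p : ℕ}
    (hA : DifferentiableOn ℂ A {z : ℂ | c < z.re}) (hB : DifferentiableOn ℂ B {z : ℂ | c < z.re})
    (h : ∀ z : ℂ, 0 < z.re → z ^ p * A z = B z) :
    ∀ z : ℂ, c < z.re → z ^ p * A z = B z := by
  have h1 : AnalyticOnNhd ℂ (fun z => z ^ p * A z) {z : ℂ | c < z.re} :=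
    ((differentiable_pow p).differentiableOn.mul hA).analyticOnNhd (isOpen_re_gt c)
  refine h1.eqOn_of_preconnected_of_eventuallyEq (hB.analyticOnNhd (isOpen_re_gt c))
    (isPreconnected_re_gt c) (z₀ := 1) (by simp; linarith) ?_
  filter_upwards [(isOpen_re_gt 0).mem_nhds (by simp : (1 : ℂ) ∈ {z : ℂ | 0 < z.re})] with z hz
  exact h z hz

/-- Mean value property of the holomorphic function f². -/
theorem enorm_sq_mul_le_lintegral_circle {f : ℂ → ℂ} {z : ℂ} {ρ : ℝ}
    (hf : DiffContOnCl ℂ f (Metric.ball z |ρ|)) :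
    ‖f z‖ₑ ^ 2 * ENNReal.ofReal (2 * Real.pi) ≤
      ∫⁻ θ in Ioo (-Real.pi) Real.pi, ‖f (circleMap z ρ θ)‖ₑ ^ 2 := by
  have hpow : DiffContOnCl ℂ (fun w => f w ^ 2) (Metric.ball z |ρ|) :=
    ⟨hf.1.pow 2, hf.2.pow 2⟩
  have h2 := hpow.circleAverage
  rw [Real.circleAverage] at h2
  have hper : Function.Periodic (fun θ => f (circleMap z ρ θ) ^ 2) (2 * Real.pi) := fun θ => by
    simp only [periodic_circleMap z ρ θ]
  have h3 := hper.intervalIntegral_add_eq 0 (-Real.pi)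
  rw [zero_add, show -Real.pi + 2 * Real.pi = Real.pi by ring] at h3
  rw [h3, intervalIntegral.integral_of_le (by linarith [Real.pi_pos]),
    integral_Ioc_eq_integral_Ioo, inv_smul_eq_iff₀ Real.two_pi_pos.ne'] at h2
  calc ‖f z‖ₑ ^ 2 * ENNReal.ofReal (2 * Real.pi) = ‖(2 * Real.pi) • f z ^ 2‖ₑ := by
        rw [enorm_smul, enorm_pow, mul_comm, Real.enorm_of_nonneg Real.two_pi_pos.le]
    _ ≤ ∫⁻ θ in Ioo (-Real.pi) Real.pi, ‖f (circleMap z ρ θ) ^ 2‖ₑ := by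
        rw [← h2]; exact enorm_integral_le_lintegral_enorm _
    _ = _ := by simp only [enorm_pow]

theorem lintegral_complex_eq_lintegral_lintegral {f : ℂ → ENNReal} (hf : Measurable f) :
    ∫⁻ w, f w = ∫⁻ x : ℝ, ∫⁻ y : ℝ, f (x + y * Complex.I) := by
  rw [← Complex.volume_preserving_equiv_real_prod.symm.lintegral_comp hf, Measure.volume_eq_prod,
    lintegral_prod (fun p => f (Complex.measurableEquivRealProd.symm p))
      (hf.comp (MeasurableEquiv.measurable _)).aemeasurable]
  refine lintegral_congr fun x => lintegral_congr fun y => ?_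
  rw [← Complex.mk_eq_add_mul_I]
  rfl

theorem enorm_sq_mul_le_lintegral_ball {A g : ℂ → ℂ} {z : ℂ} {r : ℝ} (hr : 0 < r)
    (hA : DifferentiableOn ℂ A (Metric.ball z r)) (hg : Measurable g)
    (hgA : EqOn g A (Metric.ball z r)) :
    ‖A z‖ₑ ^ 2 * (ENNReal.ofReal (r / 2) * ENNReal.ofReal (2 * Real.pi) * ENNReal.ofReal (r / 2)) ≤
      ∫⁻ w, (Metric.ball 0 r).indicator (fun w => ‖g (z + w)‖ₑ ^ 2) w := by
  set f : ℂ → ENNReal := (Metric.ball 0 r).indicator fun w => ‖g (z + w)‖ₑ ^ 2 with hf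
  have hfm : Measurable f :=
    ((hg.comp (measurable_const_add z)).enorm.pow_const 2).indicator measurableSet_ball
  have hpm : Measurable fun p : ℝ × ℝ => ENNReal.ofReal p.1 • f (Complex.polarCoord.symm p) := by
    refine measurable_fst.ennreal_ofReal.mul (hfm.comp ?_)
    rw [funext Complex.polarCoord_symm_apply]
    fun_prop
  rw [← Complex.lintegral_comp_polarCoord_symm, polarCoord_target, Measure.volume_eq_prod,
    ← Measure.prod_restrict, lintegral_prod _ hpm.aemeasurable]
  have hsub : Ioo (r / 2) r ⊆ Ioi (0 : ℝ) := fun ρ hρ => lt_trans (by linarith) hρ.1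
  -- Only the annulus r/2 < ρ < r is kept: there the polar Jacobian is at least r/2, and the radial
  -- length is again r/2.
  refine le_trans ?_ (lintegral_mono_set hsub)
  have hconst : ‖A z‖ₑ ^ 2 * (ENNReal.ofReal (r / 2) * ENNReal.ofReal (2 * Real.pi) *
      ENNReal.ofReal (r / 2)) = ∫⁻ _ in Ioo (r / 2) r,
        ENNReal.ofReal (r / 2) * (‖A z‖ₑ ^ 2 * ENNReal.ofReal (2 * Real.pi)) := by
    rw [setLIntegral_const, Real.volume_Ioo, sub_half]
    ring
  rw [hconst]
  refine setLIntegral_mono' measurableSet_Ioo fun ρ hρ => ?_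
  have hρ0 : 0 < ρ := hsub hρ
  simp only [smul_eq_mul]
  rw [lintegral_const_mul' _ _ ENNReal.ofReal_ne_top]
  refine mul_le_mul' (ENNReal.ofReal_le_ofReal hρ.1.le) ?_
  have hsub' : Metric.closedBall z |ρ| ⊆ Metric.ball z r :=
    Metric.closedBall_subset_ball (by rw [abs_of_pos hρ0]; exact hρ.2)
  refine (enorm_sq_mul_le_lintegral_circle (ρ := ρ) ((hA.mono ?_).diffContOnCl)).trans_eq ?_
  · rwa [closure_ball _ (abs_pos.2 hρ0.ne').ne']
  · refine setLIntegral_congr_fun measurableSet_Ioo fun θ _ => ?_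
    have e1 : Complex.polarCoord.symm (ρ, θ) = circleMap 0 ρ θ := by
      rw [Complex.polarCoord_symm_apply, circleMap_zero, Complex.exp_mul_I]
      simp
    have e2 : circleMap z ρ θ = z + circleMap 0 ρ θ := by simp [circleMap]
    have e3 : circleMap 0 ρ θ ∈ Metric.ball (0 : ℂ) r := by
      rw [mem_ball_zero_iff, norm_circleMap_zero, abs_of_pos hρ0]
      exact hρ.2
    simp only [hf]
    rw [e1, indicator_of_mem e3, ← e2, hgA]
    rw [e2, mem_ball_iff_norm, add_sub_cancel_left]
    simpa using e3

/-- The discs of radius 1/4 about points with Re z ≥ 0 stay in Re w > -1/4. The area integral of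
|A|² over each is at most the width 1/2 times the uniform bound K² on lines, and it controls
|A(z)|². -/
theorem IsHardyFunction.exists_norm_le {A : ℂ → ℂ} (hA : IsHardyFunction A) :
    ∃ M : ℝ, ∀ z : ℂ, 0 ≤ z.re → ‖A z‖ ≤ M := by
  obtain ⟨K, hK⟩ := hA.bounded
  set U : Set ℂ := {z : ℂ | -(1 / 2 : ℝ) < z.re} with hU
  have hUo : IsOpen U := isOpen_re_gt _
  classical
  set g : ℂ → ℂ := U.piecewise A 0 with hg
  have hgm : Measurable g :=
    hA.holomorphic.continuousOn.measurable_piecewise continuousOn_const hUo.measurableSet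
  have hgA : ∀ z ∈ U, g z = A z := fun z hz => piecewise_eq_of_mem _ _ _ hz
  set c : ENNReal := ENNReal.ofReal (1 / 4 / 2) * ENNReal.ofReal (2 * Real.pi) *
    ENNReal.ofReal (1 / 4 / 2) with hc
  set Q : ENNReal := (K : ENNReal) ^ 2 * ENNReal.ofReal (1 / 2) with hQ
  have key : ∀ z : ℂ, 0 ≤ z.re → ‖A z‖ₑ ^ 2 * c ≤ Q := by
    intro z hz
    set f : ℂ → ENNReal := (Metric.ball 0 (1 / 4)).indicator fun w => ‖g (z + w)‖ₑ ^ 2 with hf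
    have hfm : Measurable f :=
      ((hgm.comp (measurable_const_add z)).enorm.pow_const 2).indicator measurableSet_ball
    have hball : Metric.ball z (1 / 4) ⊆ U := by
      intro w hw
      rw [mem_ball_iff_norm] at hw
      have h2 := (abs_lt.1 ((Complex.abs_re_le_norm (w - z)).trans_lt hw)).1
      simp only [hU, mem_ofPred_eq]
      rw [Complex.sub_re] at h2
      linarith
    have hlow : ‖A z‖ₑ ^ 2 * c ≤ ∫⁻ w, f w :=
      enorm_sq_mul_le_lintegral_ball (by norm_num) (hA.holomorphic.mono hball) hgm
        fun w hw => hgA w (hball hw)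
    have hup : ∫⁻ w, f w ≤ Q := by
      rw [lintegral_complex_eq_lintegral_lintegral hfm]
      have hx : ∀ x : ℝ, ∫⁻ y : ℝ, f (x + y * Complex.I) ≤
          (Ioo (-(1 / 4) : ℝ) (1 / 4)).indicator (fun _ => (K : ENNReal) ^ 2) x := by
        intro x
        by_cases hx : x ∈ Ioo (-(1 / 4) : ℝ) (1 / 4)
        · rw [indicator_of_mem hx]
          have hσ : -(1 / 2 : ℝ) < z.re + x := by linarith [hx.1]
          calc ∫⁻ y : ℝ, f (x + y * Complex.I)
              ≤ ∫⁻ y : ℝ, ‖A ((z.re + x : ℝ) + (z.im + y : ℝ) * Complex.I)‖ₑ ^ 2 := by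
                refine lintegral_mono fun y => ?_
                refine (indicator_le_self _ _ _).trans_eq ?_
                have : z + ((x : ℂ) + y * Complex.I) =
                    (z.re + x : ℝ) + (z.im + y : ℝ) * Complex.I := by
                  apply Complex.ext <;> simp
                rw [this, hgA]
                simpa [hU] using hσ
            _ = ∫⁻ y : ℝ, ‖A ((z.re + x : ℝ) + y * Complex.I)‖ₑ ^ 2 :=
                lintegral_add_left_eq_self
                  (fun y : ℝ => ‖A ((z.re + x : ℝ) + y * Complex.I)‖ₑ ^ 2) z.im
            _ = (eLpNorm (fun y : ℝ => A ((z.re + x : ℝ) + y * Complex.I)) 2 volume) ^ 2 := by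
                rw [eLpNorm_eq_lintegral_rpow_enorm_toReal (by simp) (by simp),
                  ← ENNReal.rpow_natCast, ← ENNReal.rpow_mul]
                simp
            _ ≤ _ := by gcongr; exact hK _ hσ
        · rw [indicator_of_notMem hx, nonpos_iff_eq_zero]
          refine (lintegral_congr fun y => ?_).trans lintegral_zero
          refine indicator_of_notMem (fun hw => hx ?_) _
          rw [mem_ball_zero_iff] at hw
          have := (Complex.abs_re_le_norm _).trans_lt hw
          simp only [Complex.add_re, Complex.ofReal_re, Complex.mul_re, Complex.I_re, mul_zero,
            Complex.ofReal_im, Complex.I_im, mul_one, sub_self, add_zero] at this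
          exact abs_lt.1 this
      refine (lintegral_mono hx).trans_eq ?_
      rw [lintegral_indicator measurableSet_Ioo, setLIntegral_const, Real.volume_Ioo, hQ]
      norm_num
    exact hlow.trans hup
  have hc0 : c ≠ 0 := by
    simp [hc, Real.pi_pos]
  have hctop : c ≠ ⊤ := by
    simp only [hc]; finiteness
  have hQtop : Q ≠ ⊤ := by
    simp only [hQ]; finiteness
  refine ⟨1 + (Q / c).toReal, fun z hz => ?_⟩
  have h1 : ‖A z‖ₑ ^ 2 ≤ Q / c := (ENNReal.le_div_iff_mul_le (Or.inl hc0) (Or.inl hctop)).2 (key z hz)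
  have h2 := ENNReal.toReal_mono (ENNReal.div_ne_top hQtop hc0) h1
  rw [ENNReal.toReal_pow, toReal_enorm] at h2
  nlinarith [sq_nonneg (‖A z‖ - 1), norm_nonneg (A z)]

/-- Each zero a is removed by the Blaschke factor (z-a)/(z+a), unimodular on the imaginary axis, so
by Phragmén–Lindelöf the quotient keeps the bound M. Cross-multiplication avoids dividing at the
zeros. -/
theorem norm_mul_prod_le_of_zeros {M : ℝ} {c : ℝ} (hc : c < 0) (N : ℕ) : ∀ D : ℂ → ℂ,
    DifferentiableOn ℂ D {z : ℂ | c < z.re} → (∀ z : ℂ, 0 ≤ z.re → ‖D z‖ ≤ M) →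
    (∀ n < N, D ((n : ℂ) + 1) = 0) → ∀ z : ℂ, 0 ≤ z.re →
    ‖D z‖ * ∏ n ∈ Finset.range N, ‖z + ((n : ℂ) + 1)‖ ≤
      M * ∏ n ∈ Finset.range N, ‖z - ((n : ℂ) + 1)‖ := by
  induction N with
  | zero => intro D _ hM _ z hz; simpa using hM z hz
  | succ N ih =>
    intro D hD hM h0 z hz
    set a : ℂ := (N : ℂ) + 1 with ha
    have haN : a = ((N + 1 : ℕ) : ℂ) := by push_cast; rfl
    have hare : a.re = N + 1 := by simp [ha]
    have hane : a ≠ 0 := by rw [haN]; exact_mod_cast N.succ_ne_zero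
    have hna : ‖a‖ = N + 1 := by rw [haN, Complex.norm_natCast]; push_cast; rfl
    have hDa : D a = 0 := h0 N (Nat.lt_succ_self N)
    have hUa : {z : ℂ | c < z.re} ∈ 𝓝 a :=
      (isOpen_re_gt c).mem_nhds (by
      simp only [mem_ofPred_eq, hare]
      linarith [N.cast_nonneg (α := ℝ)])
    -- The divided difference fills in the removable singularity of D(z)/(z-a).
    set E : ℂ → ℂ := fun z => dslope D a z * (z + a) with hE
    have hEd : DifferentiableOn ℂ E {z : ℂ | c < z.re} :=
      ((Complex.differentiableOn_dslope hUa).2 hD).mul (by fun_prop)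
    have hEz : ∀ z, z ≠ a → E z = D z / (z - a) * (z + a) := by
      intro z hz
      simp only [hE]
      rw [dslope_of_ne _ hz, slope_def_field, hDa, sub_zero]
    have hM0 : 0 ≤ M := (norm_nonneg _).trans (hM 0 le_rfl)
    have hEbig : ∀ z : ℂ, 0 ≤ z.re → 1 ≤ ‖z - a‖ → ‖E z‖ ≤ M * (1 + 2 * ‖a‖) := by
      intro z hz h1
      have hza : z ≠ a := by
        rintro rfl
        rw [sub_self, norm_zero] at h1
        linarith
      rw [hEz z hza, norm_mul, norm_div, div_mul_eq_mul_div, div_le_iff₀ (by linarith), mul_assoc]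
      refine mul_le_mul (hM z hz) ?_ (norm_nonneg _) hM0
      calc ‖z + a‖ = ‖(z - a) + 2 * a‖ := by ring_nf
        _ ≤ ‖z - a‖ + ‖2 * a‖ := norm_add_le _ _
        _ = ‖z - a‖ + 2 * ‖a‖ := by simp
        _ ≤ _ := by nlinarith [norm_nonneg a]
    have hEM : ∀ z : ℂ, 0 ≤ z.re → ‖E z‖ ≤ M := by
      intro z hz
      -- The allowed growth exp(B|z|^c) is used with c = 1 and B = 0: `hEbig` gives boundedness away
      -- from a.
      refine PhragmenLindelof.right_half_plane_of_bounded_on_real ?_ ⟨1, by norm_num, 0, ?_⟩ ?_ ?_ hz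
      · refine ⟨hEd.mono fun w hw => hc.trans hw, ?_⟩
        refine hEd.continuousOn.mono fun w hw => ?_
        rw [Complex.closure_setOfPred_lt_re] at hw
        exact hc.trans_le hw
      · refine Asymptotics.IsBigO.of_bound (M * (1 + 2 * ‖a‖)) ?_
        rw [eventually_inf_principal]
        filter_upwards [tendsto_norm_cobounded_atTop.eventually_ge_atTop (1 + ‖a‖)] with w hw hw0
        simp only [zero_mul, Real.exp_zero, norm_one, mul_one]
        refine hEbig w (le_of_lt hw0) ?_
        linarith [norm_sub_norm_le w a]
      · refine ⟨M * (1 + 2 * ‖a‖), ?_⟩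
        rw [eventually_map]
        filter_upwards [eventually_ge_atTop (1 + ‖a‖)] with x hx
        have hx0 : 0 ≤ x := le_trans (by positivity) hx
        refine hEbig x (by simpa using hx0) ?_
        have := norm_sub_norm_le (x : ℂ) a
        rw [Complex.norm_real, Real.norm_of_nonneg hx0] at this
        linarith
      · intro x
        have hxa : (x * Complex.I : ℂ) ≠ a := by
          intro h
          have := congrArg Complex.re h
          rw [hare] at this
          simp at this
          linarith [N.cast_nonneg (α := ℝ)]
        rw [hEz _ hxa, norm_mul, norm_div]
        have h1 : ‖(x * Complex.I : ℂ) - a‖ = ‖(x * Complex.I : ℂ) + a‖ := by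
          rw [← sq_eq_sq₀ (norm_nonneg _) (norm_nonneg _), Complex.sq_norm, Complex.sq_norm,
            Complex.normSq_apply, Complex.normSq_apply, haN]
          simp
          ring
        have h2 : ‖(x * Complex.I : ℂ) - a‖ ≠ 0 := norm_ne_zero_iff.2 (sub_ne_zero.2 hxa)
        rw [← h1, div_mul_cancel₀ _ h2]
        exact hM _ (by simp)
    have hE0 : ∀ n < N, E ((n : ℂ) + 1) = 0 := by
      intro n hn
      have : (n : ℂ) + 1 ≠ a := by
        rw [ha]
        intro h
        have : (n : ℂ) = N := add_right_cancel h
        exact hn.ne (by exact_mod_cast this)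
      rw [hEz _ this, h0 n (by omega)]
      simp
    have key := ih E hEd hEM hE0 z hz
    rw [Finset.prod_range_succ, Finset.prod_range_succ]
    have h3 : ‖D z‖ * ‖z + a‖ = ‖E z‖ * ‖z - a‖ := by
      by_cases hza : z = a
      · rw [hza, hDa]; simp
      · have : ‖z - a‖ ≠ 0 := norm_ne_zero_iff.2 (sub_ne_zero.2 hza)
        rw [hEz z hza, norm_mul, norm_div]
        field_simp
    calc _ = (‖D z‖ * ‖z + a‖) * ∏ n ∈ Finset.range N, ‖z + ((n : ℂ) + 1)‖ := by ring
      _ = (‖E z‖ * ∏ n ∈ Finset.range N, ‖z + ((n : ℂ) + 1)‖) * ‖z - a‖ := by rw [h3]; ring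
      _ ≤ (M * ∏ n ∈ Finset.range N, ‖z - ((n : ℂ) + 1)‖) * ‖z - a‖ := by gcongr
      _ = _ := by ring

/-- Carlson's theorem for functions bounded in a half-plane. -/
theorem eqOn_zero_of_bounded_of_zeros {D : ℂ → ℂ} {M c : ℝ} (hc : c < 0)
    (hD : DifferentiableOn ℂ D {z : ℂ | c < z.re}) (hM : ∀ z : ℂ, 0 ≤ z.re → ‖D z‖ ≤ M)
    (h0 : ∀ n : ℕ, D ((n : ℂ) + 1) = 0) : EqOn D 0 {z : ℂ | c < z.re} := by
  have hM0 : 0 ≤ M := (norm_nonneg _).trans (hM 0 le_rfl)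
  have key : ∀ x : ℝ, x ∈ Ioo (0 : ℝ) 1 → D x = 0 := by
    intro x hx
    have hx0 := hx.1
    have hx1 := hx.2
    -- Each factor (n+1-x)/(n+1+x) is at most e^{-x/(n+1)}, and is nonnegative because x < 1;
    -- divergence of the harmonic series sends the bound to 0.
    have hb : ∀ N : ℕ, ‖D x‖ ≤
        M * Real.exp (-(x * ∑ n ∈ Finset.range N, 1 / ((n : ℝ) + 1))) := by
      intro N
      have h1 := norm_mul_prod_le_of_zeros hc N D hD hM (fun n _ => h0 n) x (by simpa using hx0.le)
      have e1 : ∀ n : ℕ, ‖(x : ℂ) + ((n : ℂ) + 1)‖ = n + 1 + x := by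
        intro n
        rw [show (x : ℂ) + ((n : ℂ) + 1) = ((n + 1 + x : ℝ) : ℂ) by push_cast; ring,
          Complex.norm_real, Real.norm_of_nonneg (by positivity)]
      have e2 : ∀ n : ℕ, ‖(x : ℂ) - ((n : ℂ) + 1)‖ = n + 1 - x := by
        intro n
        rw [show (x : ℂ) - ((n : ℂ) + 1) = -((n + 1 - x : ℝ) : ℂ) by push_cast; ring, norm_neg,
          Complex.norm_real, Real.norm_of_nonneg]
        linarith [n.cast_nonneg (α := ℝ)]
      simp only [e1, e2] at h1
      have hpos : 0 < ∏ n ∈ Finset.range N, ((n : ℝ) + 1 + x) :=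
        Finset.prod_pos fun n _ => by positivity
      rw [← le_div_iff₀ hpos, mul_div_assoc, ← Finset.prod_div_distrib] at h1
      refine h1.trans (mul_le_mul_of_nonneg_left ?_ hM0)
      rw [Finset.mul_sum, ← Finset.sum_neg_distrib, Real.exp_sum]
      refine Finset.prod_le_prod (fun n _ => ?_) fun n _ => ?_
      · have := n.cast_nonneg (α := ℝ)
        exact div_nonneg (by linarith) (by linarith)
      · have hn := n.cast_nonneg (α := ℝ)
        refine le_trans ?_ (Real.add_one_le_exp _)
        have : ((n : ℝ) + 1 - x) / (n + 1 + x) = -(2 * x / (n + 1 + x)) + 1 := by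
          field_simp; ring
        rw [this]
        have h2 : x * (1 / ((n : ℝ) + 1)) ≤ 2 * x / (n + 1 + x) := by
          rw [mul_one_div, div_le_div_iff₀ (by positivity) (by positivity)]
          nlinarith
        linarith
    have hlim : Tendsto (fun N : ℕ =>
        M * Real.exp (-(x * ∑ n ∈ Finset.range N, 1 / ((n : ℝ) + 1)))) atTop (𝓝 0) := by
      have := Real.tendsto_exp_neg_atTop_nhds_zero.comp
        (Real.tendsto_sum_range_one_div_nat_succ_atTop.const_mul_atTop hx0)
      simpa using this.const_mul M
    exact norm_le_zero_iff.1 (ge_of_tendsto' hlim hb)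
  refine (hD.analyticOnNhd (isOpen_re_gt c)).eqOn_zero_of_preconnected_of_frequently_eq_zero
    (isPreconnected_re_gt c) (z₀ := ((1 / 2 : ℝ) : ℂ)) (by simp; linarith) ?_
  have ht : Tendsto (fun x : ℝ => (x : ℂ)) (𝓝[≠] (1 / 2 : ℝ)) (𝓝[≠] ((1 / 2 : ℝ) : ℂ)) :=
    (Complex.continuous_ofReal.tendsto _).inf
      (tendsto_principal_principal.2 fun x hx h => hx (Complex.ofReal_injective h))
  refine ht.frequently (Eventually.frequently ?_)
  filter_upwards [mem_nhdsWithin_of_mem_nhds (Ioo_mem_nhds (by norm_num : (0 : ℝ) < 1 / 2)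
    (by norm_num : (1 / 2 : ℝ) < 1))] with x hx
  exact key x hx

theorem IsCarlsonInterpolation.eqOn {A B : ℂ → ℂ} {a : ℕ → ℂ} (hA : IsCarlsonInterpolation A a)
    (hB : IsCarlsonInterpolation B a) : EqOn B A {z : ℂ | -(1 / 2 : ℝ) < z.re} := by
  obtain ⟨M₁, h₁⟩ := hA.hardy.exists_norm_le
  obtain ⟨M₂, h₂⟩ := hB.hardy.exists_norm_le
  have := eqOn_zero_of_bounded_of_zeros (D := fun z => B z - A z) (c := -(1 / 2)) (M := M₂ + M₁)
    (by norm_num) (hB.hardy.holomorphic.sub hA.hardy.holomorphic)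
    (fun z hz => (norm_sub_le _ _).trans (add_le_add (h₂ z hz) (h₁ z hz)))
    (fun n => by
      have e1 := hA.interpolates (n + 1)
      have e2 := hB.interpolates (n + 1)
      push_cast at e1 e2
      rw [e1, e2, sub_self])
  exact fun z hz => sub_eq_zero.1 (this hz)

/-! ### Cauchy integrals and the transform with kernel 1/(e^{v-z} - 1) -/

theorem differentiableAt_cauchyTransform {F : ℝ → ℂ} (hF : Integrable F) {g : ℝ → ℂ}
    (hg : Continuous g) {S : Set ℂ} (hS : IsClosed S) (hgS : ∀ v, F v ≠ 0 → g v ∈ S) {w : ℂ}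
    (hw : w ∉ S) : DifferentiableAt ℂ (fun w => ∫ v, F v * (g v - w)⁻¹) w := by
  obtain ⟨δ, hδ, hball⟩ := Metric.isOpen_iff.1 hS.isOpen_compl w hw
  have hdist : ∀ w' ∈ Metric.ball w (δ / 2), ∀ v, F v ≠ 0 → δ / 2 ≤ ‖g v - w'‖ := by
    intro w' hw' v hv
    by_contra! h
    refine hball (a := g v) ?_ (hgS v hv)
    rw [mem_ball_iff_norm] at *
    calc ‖g v - w‖ ≤ ‖g v - w'‖ + ‖w' - w‖ := norm_sub_le_norm_sub_add_norm_sub _ _ _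
      _ < δ := by linarith
  have hmeas : ∀ w' : ℂ, AEStronglyMeasurable (fun v => F v * (g v - w')⁻¹) := fun w' =>
    hF.aestronglyMeasurable.mul (hg.measurable.sub_const w').inv.aestronglyMeasurable
  have key := hasDerivAt_integral_of_dominated_loc_of_deriv_le (𝕜 := ℂ) (μ := volume)
    (F := fun w v => F v * (g v - w)⁻¹) (F' := fun w v => F v * ((g v - w) ^ 2)⁻¹)
    (bound := fun v => ‖F v‖ * ((δ / 2) ^ 2)⁻¹) (x₀ := w) (Metric.ball_mem_nhds w (half_pos hδ))
    (Eventually.of_forall hmeas)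
    (by
      refine (hF.norm.mul_const (δ / 2)⁻¹).mono' (hmeas w) (Eventually.of_forall fun v => ?_)
      by_cases hv : F v = 0
      · simp [hv]
      · rw [norm_mul, norm_inv]
        gcongr
        exact hdist w (Metric.mem_ball_self (half_pos hδ)) v hv)
    (hF.aestronglyMeasurable.mul
      ((hg.measurable.sub_const w).pow_const 2).inv.aestronglyMeasurable)
    (by
      filter_upwards with v w' hw'
      by_cases hv : F v = 0
      · simp [hv]
      · rw [norm_mul, norm_inv, norm_pow]
        gcongr
        exact hdist w' hw' v hv)
    (hF.norm.mul_const _)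
    (by
      filter_upwards with v w' hw'
      by_cases hv : F v = 0
      · simpa [hv] using hasDerivAt_const w' (0 : ℂ)
      · have h1 : g v - w' ≠ 0 := by
          intro h
          have := hdist w' hw' v hv
          rw [h, norm_zero] at this
          linarith
        have h2 := ((hasDerivAt_id' w').const_sub (g v)).fun_inv h1
        simpa using h2.const_mul (F v))
  exact key.2.differentiableAt

/-- The transform `z ↦ ∫ F(v) / (e^{v - z} - 1) dv`. -/
noncomputable def boseTransform (F : ℝ → ℂ) (z : ℂ) : ℂ :=
  ∫ v : ℝ, F v * (Complex.exp (v - z) - 1)⁻¹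

/-- In the variable e^z this is a Cauchy integral, which yields both the 2πi-periodicity and the
domain of holomorphy. -/
theorem boseTransform_eq (F : ℝ → ℂ) (z : ℂ) :
    boseTransform F z = Complex.exp z * ∫ v : ℝ, F v * (Complex.exp v - Complex.exp z)⁻¹ := by
  rw [boseTransform, ← integral_const_mul]
  congr 1
  ext v
  have h : Complex.exp v - Complex.exp z = Complex.exp z * (Complex.exp (v - z) - 1) := by
    rw [mul_sub, ← Complex.exp_add]; ring_nf
  rw [h, mul_inv]
  field_simp [Complex.exp_ne_zero z]

theorem boseTransform_add_int (F : ℝ → ℂ) (z : ℂ) (k : ℤ) :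
    boseTransform F (z + k * (2 * Real.pi * Complex.I)) = boseTransform F z := by
  rw [boseTransform_eq, boseTransform_eq, Complex.exp_periodic.int_mul k z]

theorem differentiableAt_boseTransform {F : ℝ → ℂ} (hF : Integrable F) {ξ : ℝ}
    (h0 : ∀ v ≤ ξ, F v = 0) {z : ℂ} (hz : ∀ v : ℝ, ξ ≤ v → Complex.exp z ≠ Complex.exp v) :
    DifferentiableAt ℂ (boseTransform F) z := by
  have h1 := differentiableAt_cauchyTransform hF (g := fun v => Complex.exp v) (by fun_prop)
    (S := (fun x : ℝ => (x : ℂ)) '' Ici (Real.exp ξ))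
    (Complex.isometry_ofReal.isClosedEmbedding.isClosedMap _ isClosed_Ici)
    (fun v hv => by
      refine ⟨Real.exp v, ?_, by simp⟩
      by_contra h
      exact hv (h0 v (by
        rw [mem_Ici, Real.exp_le_exp, not_le] at h
        exact h.le)))
    (w := Complex.exp z) (by
      rintro ⟨x, hx, hxz⟩
      have hx0 : 0 < x := (Real.exp_pos ξ).trans_le hx
      refine hz (Real.log x) ((Real.le_log_iff_exp_le hx0).2 hx) ?_
      rw [← hxz, ← Complex.ofReal_exp, Real.exp_log hx0])
  rw [funext (boseTransform_eq F)]
  exact Complex.differentiableAt_exp.mul (h1.comp z Complex.differentiableAt_exp)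

/-! ### Kernel estimates and the Sokhotski–Plemelj formula -/

theorem abs_exp_sub_one_le_norm (u : ℂ) : |Real.exp u.re - 1| ≤ ‖Complex.exp u - 1‖ := by
  have := abs_norm_sub_norm_le (Complex.exp u) 1
  rwa [Complex.norm_exp, norm_one] at this

theorem half_abs_le_abs_exp_sub_one {s : ℝ} (hs : |s| ≤ 1) : |s| / 2 ≤ |Real.exp s - 1| := by
  rcases le_total 0 s with h | h
  · rw [abs_of_nonneg h]
    have := Real.add_one_le_exp s
    exact le_trans (by linarith) (le_abs_self _)
  · rw [abs_of_nonpos h] at hs ⊢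
    have h1 := Real.exp_bound' (x := -s) (by linarith) hs (n := 1) one_pos
    have h2 : 1 - Real.exp s ≤ |Real.exp s - 1| := by rw [abs_sub_comm]; exact le_abs_self _
    have h3 : Real.exp s * (1 + -s) ≤ 1 := by
      calc _ ≤ Real.exp s * Real.exp (-s) := by
            gcongr; linarith [Real.add_one_le_exp (-s)]
        _ = 1 := by rw [← Real.exp_add]; simp
    nlinarith [Real.exp_pos s]

theorem half_norm_le_norm_exp_sub_one {u : ℂ} (hu : ‖u‖ ≤ 1 / 2) :
    ‖u‖ / 2 ≤ ‖Complex.exp u - 1‖ := by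
  have h1 := Complex.norm_exp_sub_one_sub_id_le (x := u) (by linarith)
  have h2 : ‖u‖ ≤ ‖Complex.exp u - 1‖ + ‖Complex.exp u - 1 - u‖ := by
    calc ‖u‖ = ‖(Complex.exp u - 1) - (Complex.exp u - 1 - u)‖ := by ring_nf
      _ ≤ _ := norm_sub_le _ _
  nlinarith [norm_nonneg u]

/-- The difference is (u - (e^u - 1))/(u(e^u - 1)), with numerator at most |u|² and denominator at
least |u|²/2. The kernel thus has the singularity of 1/u up to a bounded error. -/
theorem norm_inv_exp_sub_one_sub_inv_le {u : ℂ} (hu : ‖u‖ ≤ 1 / 2) :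
    ‖(Complex.exp u - 1)⁻¹ - u⁻¹‖ ≤ 2 := by
  by_cases h0 : u = 0
  · simp [h0]
  have hpos : 0 < ‖u‖ := norm_pos_iff.2 h0
  have h1 := half_norm_le_norm_exp_sub_one hu
  have h2 : Complex.exp u - 1 ≠ 0 := norm_pos_iff.1 (by linarith)
  have h3 := Complex.norm_exp_sub_one_sub_id_le (x := u) (by linarith)
  rw [inv_sub_inv h2 h0, norm_div, norm_mul, div_le_iff₀ (by positivity), norm_sub_rev]
  nlinarith

theorem intervalIntegral_inv_sub_mul_I {d η : ℝ} (hη : η ≠ 0) :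
    ∫ s in (-d)..d, ((s : ℂ) - η * Complex.I)⁻¹ =
      Complex.log (d - η * Complex.I) - Complex.log (-d - η * Complex.I) := by
  have hne : ∀ s : ℝ, (s : ℂ) - η * Complex.I ∈ Complex.slitPlane := fun s => by
    rw [Complex.mem_slitPlane_iff]
    right
    simpa using hη
  have h := intervalIntegral.integral_eq_sub_of_hasDerivAt (a := -d) (b := d)
    (f := fun s : ℝ => Complex.log (s - η * Complex.I))
    (f' := fun s : ℝ => ((s : ℂ) - η * Complex.I)⁻¹)
    (fun s _ => by
      have h1 : HasDerivAt (fun s : ℝ => (s : ℂ) - η * Complex.I) 1 s :=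
        (Complex.ofRealCLM.hasDerivAt (x := s)).sub_const _
      simpa using h1.clog_real (hne s))
    (by
      refine ContinuousOn.intervalIntegrable (Continuous.continuousOn ?_)
      exact (by fun_prop : Continuous fun s : ℝ => (s : ℂ) - η * Complex.I).inv₀
        fun s => Complex.slitPlane_ne_zero (hne s))
  rw [h]
  push_cast
  rfl

/-- As Im z decreases to 0, the endpoint -d - i Im z reaches the branch cut of the logarithm from
below, where the argument is -π; the moduli cancel and πi remains. -/
theorem tendsto_intervalIntegral_inv_im_pos {d v : ℝ} (hd : 0 < d) :
    Tendsto (fun z : ℂ => ∫ s in (-d)..d, ((s : ℂ) - z.im * Complex.I)⁻¹)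
      (𝓝[{z : ℂ | 0 < z.im}] (v : ℂ)) (𝓝 (Real.pi * Complex.I)) := by
  have him : Tendsto (fun z : ℂ => z.im) (𝓝[{z : ℂ | 0 < z.im}] (v : ℂ)) (𝓝 0) := by
    simpa using (Complex.continuous_im.tendsto (v : ℂ)).mono_left nhdsWithin_le_nhds
  have hcont : ∀ c : ℂ, Tendsto (fun z : ℂ => c - z.im * Complex.I)
      (𝓝[{z : ℂ | 0 < z.im}] (v : ℂ)) (𝓝 c) := fun c => by
    have : Continuous fun x : ℝ => c - x * Complex.I := by fun_prop
    simpa [Function.comp_def] using (this.tendsto 0).comp him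
  have h1 : Tendsto (fun z : ℂ => Complex.log (d - z.im * Complex.I))
      (𝓝[{z : ℂ | 0 < z.im}] (v : ℂ)) (𝓝 (Complex.log d)) :=
    (continuousAt_clog (Or.inl (by simpa using hd))).tendsto.comp (hcont d)
  have h2 : Tendsto (fun z : ℂ => Complex.log (-d - z.im * Complex.I))
      (𝓝[{z : ℂ | 0 < z.im}] (v : ℂ)) (𝓝 (Real.log ‖(-d : ℂ)‖ - Real.pi * Complex.I)) := by
    refine (Complex.tendsto_log_nhdsWithin_im_neg_of_re_neg_of_im_zero (z := -d)
      (by simpa using hd) (by simp)).comp (tendsto_nhdsWithin_iff.2 ⟨hcont _, ?_⟩)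
    filter_upwards [self_mem_nhdsWithin] with z hz
    simpa using hz
  have h3 := h1.sub h2
  rw [norm_neg, Complex.norm_real, Real.norm_of_nonneg hd.le, ← Complex.ofReal_log hd.le,
    sub_sub_cancel] at h3
  refine h3.congr' ?_
  filter_upwards [self_mem_nhdsWithin] with z hz
  exact (intervalIntegral_inv_sub_mul_I (ne_of_gt hz)).symm

theorem tendsto_intervalIntegral_inv_im_neg {d v : ℝ} (hd : 0 < d) :
    Tendsto (fun z : ℂ => ∫ s in (-d)..d, ((s : ℂ) - z.im * Complex.I)⁻¹)
      (𝓝[{z : ℂ | z.im < 0}] (v : ℂ)) (𝓝 (-(Real.pi * Complex.I))) := by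
  have him : Tendsto (fun z : ℂ => z.im) (𝓝[{z : ℂ | z.im < 0}] (v : ℂ)) (𝓝 0) := by
    simpa using (Complex.continuous_im.tendsto (v : ℂ)).mono_left nhdsWithin_le_nhds
  have hcont : ∀ c : ℂ, Tendsto (fun z : ℂ => c - z.im * Complex.I)
      (𝓝[{z : ℂ | z.im < 0}] (v : ℂ)) (𝓝 c) := fun c => by
    have : Continuous fun x : ℝ => c - x * Complex.I := by fun_prop
    simpa [Function.comp_def] using (this.tendsto 0).comp him
  have h1 : Tendsto (fun z : ℂ => Complex.log (d - z.im * Complex.I))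
      (𝓝[{z : ℂ | z.im < 0}] (v : ℂ)) (𝓝 (Complex.log d)) :=
    (continuousAt_clog (Or.inl (by simpa using hd))).tendsto.comp (hcont d)
  have h2 : Tendsto (fun z : ℂ => Complex.log (-d - z.im * Complex.I))
      (𝓝[{z : ℂ | z.im < 0}] (v : ℂ)) (𝓝 (Real.log ‖(-d : ℂ)‖ + Real.pi * Complex.I)) := by
    refine (Complex.tendsto_log_nhdsWithin_im_nonneg_of_re_neg_of_im_zero (z := -d)
      (by simpa using hd) (by simp)).comp (tendsto_nhdsWithin_iff.2 ⟨hcont _, ?_⟩)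
    filter_upwards [self_mem_nhdsWithin] with z hz
    have hz' : z.im < 0 := hz
    simpa using hz'.le
  have h3 := h1.sub h2
  rw [norm_neg, Complex.norm_real, Real.norm_of_nonneg hd.le, ← Complex.ofReal_log hd.le,
    sub_add_cancel_left] at h3
  refine h3.congr' ?_
  filter_upwards [self_mem_nhdsWithin] with z hz
  exact (intervalIntegral_inv_sub_mul_I (ne_of_lt hz)).symm

theorem intervalIntegrable_inv_sqrt_abs {d : ℝ} (hd : 0 ≤ d) :
    IntervalIntegrable (fun s : ℝ => (Real.sqrt |s|)⁻¹) volume (-d) d := by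
  have h1 : IntervalIntegrable (fun s : ℝ => (Real.sqrt |s|)⁻¹) volume 0 d := by
    refine (intervalIntegral.intervalIntegrable_rpow' (r := -(1 / 2)) (by norm_num)).congr ?_
    intro s hs
    rw [uIoc_of_le hd] at hs
    simp only
    rw [Real.rpow_neg hs.1.le, ← Real.sqrt_eq_rpow, abs_of_pos hs.1]
  have h2 := (IntervalIntegrable.iff_comp_neg (f := fun s : ℝ => (Real.sqrt |s|)⁻¹)).1 h1
  simp only [abs_neg, neg_zero] at h2
  exact h2.symm.trans h1

theorem norm_inv_exp_sub_one_le_of_far {s η : ℝ} (hs : 1 / 4 ≤ |s|) :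
    ‖(Complex.exp (s - η * Complex.I) - 1)⁻¹‖ ≤ 8 := by
  have h1 := abs_exp_sub_one_le_norm (s - η * Complex.I)
  have hre : ((s : ℂ) - η * Complex.I).re = s := by simp
  rw [hre] at h1
  have h2 : 1 / 8 ≤ |Real.exp s - 1| := by
    rcases le_total |s| 1 with h | h
    · linarith [half_abs_le_abs_exp_sub_one h]
    · rcases le_abs.1 h with h' | h'
      · have := Real.add_one_le_exp s
        exact le_trans (by linarith) (le_abs_self _)
      · have h3 := half_abs_le_abs_exp_sub_one (s := -1) (by simp)
        rw [abs_neg, abs_one, abs_of_nonpos (by simp)] at h3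
        have h4 : Real.exp s ≤ Real.exp (-1) := Real.exp_le_exp.2 (by linarith)
        rw [abs_sub_comm]
        exact le_trans (by linarith) (le_abs_self _)
  rw [norm_inv, inv_le_comm₀ (by linarith) (by norm_num)]
  linarith

theorem norm_inv_exp_sub_one_le {s η : ℝ} (hs0 : s ≠ 0) (hs : |s| ≤ 1) :
    ‖(Complex.exp (s - η * Complex.I) - 1)⁻¹‖ ≤ 2 * |s|⁻¹ := by
  have h1 := abs_exp_sub_one_le_norm (s - η * Complex.I)
  have hre : ((s : ℂ) - η * Complex.I).re = s := by simp
  rw [hre] at h1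
  have h2 := half_abs_le_abs_exp_sub_one hs
  have h3 : 0 < |s| := abs_pos.2 hs0
  rw [norm_inv, show 2 * |s|⁻¹ = (|s| / 2)⁻¹ by field_simp]
  gcongr
  linarith

theorem norm_ofReal_sub_mul_I_le {s η : ℝ} (hs : |s| ≤ 1 / 4) (hη : |η| ≤ 1 / 4) :
    ‖(s : ℂ) - η * Complex.I‖ ≤ 1 / 2 := by
  calc _ ≤ ‖(s : ℂ)‖ + ‖(η : ℂ) * Complex.I‖ := norm_sub_le _ _
    _ = |s| + |η| := by simp
    _ ≤ _ := by linarith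

theorem abs_im_le_norm_ofReal_sub_mul_I (s η : ℝ) : |η| ≤ ‖(s : ℂ) - η * Complex.I‖ := by
  simpa using Complex.abs_im_le_norm ((s : ℂ) - η * Complex.I)

section Jump

variable {F : ℝ → ℂ}

theorem integrable_boseTransform_integrand (hF : Integrable F) {z : ℂ} (h0 : z.im ≠ 0)
    (h1 : |z.im| ≤ 1 / 4) : Integrable fun v : ℝ => F v * (Complex.exp (v - z) - 1)⁻¹ := by
  refine hF.mul_bdd (c := 8 + 2 * |z.im|⁻¹) ?_ (Eventually.of_forall fun v => ?_)
  · exact ((by fun_prop : Measurable fun v : ℝ => Complex.exp (v - z) - 1).inv).aestronglyMeasurable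
  · have hz : (v : ℂ) - z = ((v - z.re : ℝ) : ℂ) - z.im * Complex.I := by
      apply Complex.ext <;> simp
    have h0' : 0 < |z.im| := abs_pos.2 h0
    rw [hz]
    rcases le_total |v - z.re| (1 / 4) with h | h
    · have h2 := half_norm_le_norm_exp_sub_one (norm_ofReal_sub_mul_I_le h h1)
      have h3 := abs_im_le_norm_ofReal_sub_mul_I (v - z.re) z.im
      have : ‖(Complex.exp (((v - z.re : ℝ) : ℂ) - z.im * Complex.I) - 1)⁻¹‖ ≤ (|z.im| / 2)⁻¹ := by
        rw [norm_inv]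
        gcongr
        linarith
      rw [show (|z.im| / 2)⁻¹ = 2 * |z.im|⁻¹ by field_simp] at this
      linarith
    · have := norm_inv_exp_sub_one_le_of_far (η := z.im) h
      have h2 : 0 ≤ 2 * |z.im|⁻¹ := by positivity
      linarith

theorem continuous_inv_exp_sub_one {η : ℝ} (h0 : η ≠ 0) (h1 : |η| ≤ 1 / 4) :
    ContinuousOn (fun s : ℝ => (Complex.exp (s - η * Complex.I) - 1)⁻¹) (Icc (-(1 / 4)) (1 / 4)) := by
  refine ContinuousOn.inv₀ (by fun_prop) fun s hs => ?_
  have h2 := half_norm_le_norm_exp_sub_one (norm_ofReal_sub_mul_I_le (abs_le.2 hs) h1)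
  have h3 := abs_im_le_norm_ofReal_sub_mul_I s η
  have h0' : 0 < |η| := abs_pos.2 h0
  exact norm_pos_iff.1 (by linarith)

/-- The part of `boseTransform F` that is continuous across the real axis. -/
noncomputable def boseRegular (F : ℝ → ℂ) (z : ℂ) : ℂ :=
  (∫ v : ℝ, (Icc (z.re - 1 / 4) (z.re + 1 / 4))ᶜ.indicator
      (fun v : ℝ => F v * (Complex.exp (v - z) - 1)⁻¹) v) +
    ((∫ s in (-(1 / 4 : ℝ))..(1 / 4), (F (z.re + s) - F z.re) *
        (Complex.exp (s - z.im * Complex.I) - 1)⁻¹) +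
      F z.re * ∫ s in (-(1 / 4 : ℝ))..(1 / 4), ((Complex.exp (s - z.im * Complex.I) - 1)⁻¹ -
        ((s : ℂ) - z.im * Complex.I)⁻¹))

/-- Near Re z, F(v) is replaced by F(Re z) and the kernel by 1/u. Only the remaining explicit
integral depends on the side of approach. -/
theorem boseTransform_eq_regular_add (hF : Integrable F) (hc : Continuous F) {z : ℂ}
    (h0 : z.im ≠ 0) (h1 : |z.im| ≤ 1 / 4) :
    boseTransform F z = boseRegular F z +
      F z.re * ∫ s in (-(1 / 4 : ℝ))..(1 / 4), ((s : ℂ) - z.im * Complex.I)⁻¹ := by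
  have hI := integrable_boseTransform_integrand hF h0 h1
  have hk : IntervalIntegrable (fun s : ℝ => (Complex.exp (s - z.im * Complex.I) - 1)⁻¹) volume
      (-(1 / 4)) (1 / 4) := by
    refine ContinuousOn.intervalIntegrable ?_
    rw [uIcc_of_le (by norm_num)]
    exact continuous_inv_exp_sub_one h0 h1
  have hl : IntervalIntegrable (fun s : ℝ => ((s : ℂ) - z.im * Complex.I)⁻¹) volume
      (-(1 / 4)) (1 / 4) := by
    refine Continuous.intervalIntegrable ?_ _ _
    refine Continuous.inv₀ (by fun_prop) fun s h => h0 ?_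
    simpa using congrArg Complex.im h
  have hFk : IntervalIntegrable (fun s : ℝ => (F (z.re + s) - F z.re) *
        (Complex.exp (s - z.im * Complex.I) - 1)⁻¹) volume (-(1 / 4)) (1 / 4) :=
    hk.continuousOn_mul (by fun_prop)
  rw [boseTransform, ← integral_add_compl (s := Icc (z.re - 1 / 4) (z.re + 1 / 4))
    measurableSet_Icc hI, ← integral_indicator measurableSet_Icc.compl, boseRegular, add_assoc,
    add_comm]
  congr 1
  have e1 : ∫ v in Icc (z.re - 1 / 4) (z.re + 1 / 4), F v * (Complex.exp (v - z) - 1)⁻¹ =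
      ∫ s in (-(1 / 4 : ℝ))..(1 / 4), F (z.re + s) *
        (Complex.exp (s - z.im * Complex.I) - 1)⁻¹ := by
    rw [integral_Icc_eq_integral_Ioc, ← intervalIntegral.integral_of_le (by linarith)]
    have := intervalIntegral.integral_comp_add_left (a := -(1 / 4 : ℝ)) (b := 1 / 4)
      (fun v : ℝ => F v * (Complex.exp (v - z) - 1)⁻¹) z.re
    rw [← sub_eq_add_neg] at this
    rw [← this]
    refine intervalIntegral.integral_congr fun s _ => ?_
    have hz : ((z.re + s : ℝ) : ℂ) - z = (s : ℂ) - z.im * Complex.I := by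
      apply Complex.ext <;> simp
    simp only [hz]
  rw [e1, ← intervalIntegral.integral_const_mul, ← intervalIntegral.integral_const_mul,
    ← intervalIntegral.integral_add hFk ((hk.sub hl).const_mul _),
    ← intervalIntegral.integral_add (hFk.add ((hk.sub hl).const_mul _)) (hl.const_mul _)]
  refine intervalIntegral.integral_congr fun s _ => ?_
  ring

/-- Dominated convergence in each of the three pieces. The Hölder bound is what makes the middle one
work: √|s| against a kernel of size 2/|s| leaves the integrable majorant |s|^{-1/2}. -/
theorem exists_tendsto_boseRegular (hF : Integrable F) (hc : Continuous F) {v₀ L : ℝ} (hL : 0 ≤ L)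
    (hH : ∀ u ∈ Icc (v₀ - 1) (v₀ + 1), ∀ v ∈ Icc (v₀ - 1) (v₀ + 1),
      ‖F v - F u‖ ≤ L * Real.sqrt |v - u|) :
    ∃ P : ℂ, Tendsto (boseRegular F) (𝓝[{z : ℂ | z.im ≠ 0}] (v₀ : ℂ)) (𝓝 P) := by
  set l := 𝓝[{z : ℂ | z.im ≠ 0}] (v₀ : ℂ) with hl
  have hz : Tendsto (fun z : ℂ => z) l (𝓝 (v₀ : ℂ)) := nhdsWithin_le_nhds
  have hre : Tendsto (fun z : ℂ => z.re) l (𝓝 v₀) := by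
    simpa using (Complex.continuous_re.tendsto (v₀ : ℂ)).mono_left nhdsWithin_le_nhds
  have him : Tendsto (fun z : ℂ => z.im) l (𝓝 0) := by
    simpa using (Complex.continuous_im.tendsto (v₀ : ℂ)).mono_left nhdsWithin_le_nhds
  have hre4 : ∀ᶠ z in l, z.re ∈ Icc (v₀ - 1 / 4) (v₀ + 1 / 4) :=
    hre.eventually (Icc_mem_nhds (by linarith) (by linarith))
  have him4 : ∀ᶠ z in l, |z.im| ≤ 1 / 4 := by
    filter_upwards [him.eventually (Icc_mem_nhds (by norm_num : (-(1 / 4) : ℝ) < 0)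
      (by norm_num : (0 : ℝ) < 1 / 4))] with z hz
    exact abs_le.2 hz
  have him0 : ∀ᶠ z in l, z.im ≠ 0 := self_mem_nhdsWithin
  have hk : ∀ s : ℝ, s ≠ 0 → Tendsto (fun z : ℂ => (Complex.exp (s - z.im * Complex.I) - 1)⁻¹) l
      (𝓝 (Complex.exp s - 1)⁻¹) := by
    intro s hs
    have h1 : Complex.exp s - 1 ≠ 0 := by
      rw [← Complex.ofReal_exp, ← Complex.ofReal_one, ← Complex.ofReal_sub, Complex.ofReal_ne_zero,
        sub_ne_zero]
      simpa using hs
    refine Tendsto.inv₀ ?_ h1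
    have : Continuous fun x : ℝ => Complex.exp (s - x * Complex.I) - 1 := by fun_prop
    simpa [Function.comp_def] using (this.tendsto 0).comp him
  have hne : ∀ᵐ s : ℝ, s ≠ 0 := by simp [ae_iff]
  have huIoc : ∀ s ∈ uIoc (-(1 / 4 : ℝ)) (1 / 4), |s| ≤ 1 / 4 := by
    intro s hs
    rw [uIoc_of_le (by norm_num)] at hs
    exact abs_le.2 ⟨hs.1.le, hs.2⟩
  have t1 : Tendsto (fun z : ℂ => ∫ v : ℝ, (Icc (z.re - 1 / 4) (z.re + 1 / 4))ᶜ.indicator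
      (fun v : ℝ => F v * (Complex.exp (v - z) - 1)⁻¹) v) l
      (𝓝 (∫ v : ℝ, (Icc (v₀ - 1 / 4) (v₀ + 1 / 4))ᶜ.indicator
      (fun v : ℝ => F v * (Complex.exp (v - v₀) - 1)⁻¹) v)) := by
    refine tendsto_integral_filter_of_dominated_convergence (fun v => ‖F v‖ * 8) ?_ ?_
      (hF.norm.mul_const 8) ?_
    · filter_upwards [him4, him0] with z h4 h0
      exact ((integrable_boseTransform_integrand hF h0 h4).indicator
        measurableSet_Icc.compl).aestronglyMeasurable
    · filter_upwards with z
      filter_upwards with v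
      by_cases hv : v ∈ Icc (z.re - 1 / 4) (z.re + 1 / 4)
      · rw [indicator_of_notMem (by simpa using hv), norm_zero]
        positivity
      · rw [indicator_of_mem hv, norm_mul]
        gcongr
        have hzv : (v : ℂ) - z = ((v - z.re : ℝ) : ℂ) - z.im * Complex.I := by
          apply Complex.ext <;> simp
        rw [hzv]
        refine norm_inv_exp_sub_one_le_of_far ?_
        by_contra! h
        have := abs_lt.1 h
        exact hv ⟨by linarith, by linarith⟩
    -- At the two endpoints the moving indicator need not converge; they form a null set.
    · have hne' : ∀ᵐ v : ℝ, v ≠ v₀ - 1 / 4 ∧ v ≠ v₀ + 1 / 4 :=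
        (show ∀ᵐ v : ℝ, v ≠ v₀ - 1 / 4 by simp [ae_iff]).and (by simp [ae_iff])
      filter_upwards [hne'] with v hv
      by_cases h : v ∈ Icc (v₀ - 1 / 4) (v₀ + 1 / 4)
      · rw [indicator_of_notMem (by simpa using h)]
        have h1 : v₀ - 1 / 4 < v := lt_of_le_of_ne h.1 (Ne.symm hv.1)
        have h2 : v < v₀ + 1 / 4 := lt_of_le_of_ne h.2 hv.2
        refine tendsto_const_nhds.congr' ?_
        filter_upwards [hre.eventually (Ioo_mem_nhds (by linarith : v - 1 / 4 < v₀)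
          (by linarith : v₀ < v + 1 / 4))] with z hz
        rw [indicator_of_notMem]
        simp only [mem_compl_iff, not_not]
        exact ⟨by linarith [hz.2], by linarith [hz.1]⟩
      · rw [indicator_of_mem h]
        have h1 : Complex.exp (v - v₀) - 1 ≠ 0 := by
          rw [← Complex.ofReal_sub, ← Complex.ofReal_exp, ← Complex.ofReal_one,
            ← Complex.ofReal_sub, Complex.ofReal_ne_zero, sub_ne_zero]
          intro h2
          rw [Real.exp_eq_one_iff, sub_eq_zero] at h2
          exact h (by rw [h2]; exact ⟨by linarith, by linarith⟩)
        have h2 : Tendsto (fun z : ℂ => F v * (Complex.exp (v - z) - 1)⁻¹) l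
            (𝓝 (F v * (Complex.exp (v - v₀) - 1)⁻¹)) := by
          refine (Tendsto.inv₀ ?_ h1).const_mul _
          have : Continuous fun z : ℂ => Complex.exp (v - z) - 1 := by fun_prop
          exact (this.tendsto _).comp hz
        refine h2.congr' ?_
        have h3 : ∀ᶠ z : ℂ in l, v ∉ Icc (z.re - 1 / 4) (z.re + 1 / 4) := by
          rw [mem_Icc, not_and_or, not_le, not_le] at h
          rcases h with h | h
          · filter_upwards [hre.eventually (lt_mem_nhds (by linarith : v + 1 / 4 < v₀))] with z hz
            exact fun h' => by linarith [h'.1]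
          · filter_upwards [hre.eventually (gt_mem_nhds (by linarith : v₀ < v - 1 / 4))] with z hz
            exact fun h' => by linarith [h'.2]
        filter_upwards [h3] with z h3
        rw [indicator_of_mem h3]
  have t2 : Tendsto (fun z : ℂ => ∫ s in (-(1 / 4 : ℝ))..(1 / 4), (F (z.re + s) - F z.re) *
        (Complex.exp (s - z.im * Complex.I) - 1)⁻¹) l
      (𝓝 (∫ s in (-(1 / 4 : ℝ))..(1 / 4), (F (v₀ + s) - F v₀) * (Complex.exp s - 1)⁻¹)) := by
    refine intervalIntegral.tendsto_integral_filter_of_dominated_convergence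
      (fun s => 2 * L * (Real.sqrt |s|)⁻¹) ?_ ?_
      ((intervalIntegrable_inv_sqrt_abs (by norm_num)).const_mul _) ?_
    · filter_upwards with z
      refine AEStronglyMeasurable.mul (by fun_prop) ?_
      exact ((by fun_prop : Measurable fun s : ℝ =>
        Complex.exp (s - z.im * Complex.I) - 1).inv).aestronglyMeasurable
    · filter_upwards [hre4] with z hz
      filter_upwards [hne] with s hs0 hs
      have hs4 := huIoc s hs
      have hs4' := abs_le.1 hs4
      have h1 := hH z.re ⟨by linarith [hz.1], by linarith [hz.2]⟩ (z.re + s)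
        ⟨by linarith [hz.1], by linarith [hz.2]⟩
      rw [add_sub_cancel_left] at h1
      have h2 := norm_inv_exp_sub_one_le (η := z.im) hs0 (by linarith)
      have h3 : 0 < |s| := abs_pos.2 hs0
      have h4 : 0 < Real.sqrt |s| := Real.sqrt_pos.2 h3
      rw [norm_mul]
      calc _ ≤ (L * Real.sqrt |s|) * (2 * |s|⁻¹) := by gcongr
        _ = 2 * L * (Real.sqrt |s| * |s|⁻¹) := by ring
        _ = _ := by
          congr 1
          nth_rewrite 2 [← Real.mul_self_sqrt h3.le]
          field_simp
    · filter_upwards [hne] with s hs0 _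
      refine Tendsto.mul ?_ (hk s hs0)
      have : Continuous fun x : ℝ => F (x + s) - F x := by fun_prop
      exact (this.tendsto v₀).comp hre
  have t3 : Tendsto (fun z : ℂ => ∫ s in (-(1 / 4 : ℝ))..(1 / 4),
      ((Complex.exp (s - z.im * Complex.I) - 1)⁻¹ - ((s : ℂ) - z.im * Complex.I)⁻¹)) l
      (𝓝 (∫ s in (-(1 / 4 : ℝ))..(1 / 4), ((Complex.exp s - 1)⁻¹ - (s : ℂ)⁻¹))) := by
    refine intervalIntegral.tendsto_integral_filter_of_dominated_convergence
      (fun _ => 2) ?_ ?_ intervalIntegrable_const ?_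
    · filter_upwards with z
      refine Measurable.aestronglyMeasurable (Measurable.sub ?_ ?_)
      · exact (by fun_prop : Measurable fun s : ℝ =>
          Complex.exp (s - z.im * Complex.I) - 1).inv
      · exact (by fun_prop : Measurable fun s : ℝ => (s : ℂ) - z.im * Complex.I).inv
    · filter_upwards [him4] with z hz
      filter_upwards with s hs
      exact norm_inv_exp_sub_one_sub_inv_le (norm_ofReal_sub_mul_I_le (huIoc s hs) hz)
    · filter_upwards [hne] with s hs0 _
      refine (hk s hs0).sub (Tendsto.inv₀ ?_ (by simpa using hs0))
      have : Continuous fun x : ℝ => (s : ℂ) - x * Complex.I := by fun_prop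
      simpa [Function.comp_def] using (this.tendsto 0).comp him
  exact ⟨_, t1.add (t2.add (((hc.tendsto v₀).comp hre).mul t3))⟩

/-- The Sokhotski–Plemelj formula for `boseTransform`. -/
theorem exists_tendsto_boseTransform (hF : Integrable F) (hc : Continuous F) {v₀ L : ℝ}
    (hL : 0 ≤ L) (hH : ∀ u ∈ Icc (v₀ - 1) (v₀ + 1), ∀ v ∈ Icc (v₀ - 1) (v₀ + 1),
      ‖F v - F u‖ ≤ L * Real.sqrt |v - u|) :
    ∃ P : ℂ, Tendsto (boseTransform F) (𝓝[{z : ℂ | 0 < z.im}] (v₀ : ℂ))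
        (𝓝 (P + F v₀ * (Real.pi * Complex.I))) ∧
      Tendsto (boseTransform F) (𝓝[{z : ℂ | z.im < 0}] (v₀ : ℂ))
        (𝓝 (P + F v₀ * -(Real.pi * Complex.I))) := by
  obtain ⟨P, hP⟩ := exists_tendsto_boseRegular hF hc hL hH
  have him4 : ∀ᶠ z : ℂ in 𝓝 (v₀ : ℂ), |z.im| ≤ 1 / 4 := by
    have him : Tendsto (fun z : ℂ => z.im) (𝓝 (v₀ : ℂ)) (𝓝 0) := by
      simpa using Complex.continuous_im.tendsto (v₀ : ℂ)
    filter_upwards [him.eventually (Icc_mem_nhds (by norm_num : (-(1 / 4) : ℝ) < 0)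
      (by norm_num : (0 : ℝ) < 1 / 4))] with z hz
    exact abs_le.2 hz
  have hFre : Tendsto (fun z : ℂ => F z.re) (𝓝 (v₀ : ℂ)) (𝓝 (F v₀)) := by
    simpa [Function.comp_def] using (hc.comp Complex.continuous_re).tendsto (v₀ : ℂ)
  refine ⟨P, ?_, ?_⟩
  · refine ((hP.mono_left (nhdsWithin_mono _ fun z hz => ne_of_gt hz)).add
      ((hFre.mono_left nhdsWithin_le_nhds).mul
        (tendsto_intervalIntegral_inv_im_pos (by norm_num : (0 : ℝ) < 1 / 4)))).congr' ?_
    filter_upwards [self_mem_nhdsWithin, nhdsWithin_le_nhds him4] with z hz h4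
    exact (boseTransform_eq_regular_add hF hc (ne_of_gt hz) h4).symm
  · refine ((hP.mono_left (nhdsWithin_mono _ fun z hz => ne_of_lt hz)).add
      ((hFre.mono_left nhdsWithin_le_nhds).mul
        (tendsto_intervalIntegral_inv_im_neg (by norm_num : (0 : ℝ) < 1 / 4)))).congr' ?_
    filter_upwards [self_mem_nhdsWithin, nhdsWithin_le_nhds him4] with z hz h4
    exact (boseTransform_eq_regular_add hF hc (ne_of_lt hz) h4).symm

end Jump

/-! ### The jump function: construction, support and Hölder bound -/

theorem laplaceTransform_natCast (F : ℝ → ℂ) (n : ℕ) :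
    laplaceTransform F n = ∫ v in Ioi (0 : ℝ), F v * Real.exp (-(n * v)) := by
  simp [laplaceTransform]

theorem HausdorffL2.exists_laplaceTransform_eq {g : ℕ → ℂ} (hg : HausdorffL2 g) :
    ∃ h : ℝ → ℂ, (∀ v ≤ 0, h v = 0) ∧ MemLp h 2 ∧ MemLp (expWeight h (-(1 / 2))) 2 ∧
      ∀ n : ℕ, laplaceTransform h n = g n := by
  obtain ⟨ψ, hψ, hg⟩ := hg.exists_moment
  -- Absorbing e^{-v/2} into h turns the moments at n + 1/2 into Laplace values at n; undoing it is
  -- the weight σ = -1/2.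
  set h : ℝ → ℂ := (Ioi 0).indicator fun v => ψ v * Real.exp (-((1 / 2 : ℝ) * v)) with hh
  have e : expWeight h (-(1 / 2)) = (Ioi 0).indicator ψ := by
    funext v
    by_cases hv : v ∈ Ioi (0 : ℝ)
    · simp only [expWeight, hh, indicator_of_mem hv]
      rw [mul_assoc, ← Complex.ofReal_mul, ← Real.exp_add]
      simp
    · simp [expWeight, indicator_of_notMem hv]
  have hw : MemLp (expWeight h (-(1 / 2))) 2 := by
    rw [e, memLp_indicator_iff_restrict measurableSet_Ioi]
    exact hψ
  have e0 : expWeight h 0 = h := by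
    funext v
    by_cases hv : v ∈ Ioi (0 : ℝ)
    · simp [expWeight, indicator_of_mem hv]
    · simp [expWeight, hh, indicator_of_notMem hv]
  refine ⟨h, fun v hv => indicator_of_notMem (by simpa using hv) _, ?_, hw, fun n => ?_⟩
  · have := memLp_expWeight hw (by norm_num : (-(1 / 2) : ℝ) ≤ 0)
    rwa [e0] at this
  · rw [laplaceTransform_natCast, hg]
    refine setIntegral_congr_fun measurableSet_Ioi fun v hv => ?_
    simp only [hh, indicator_of_mem hv]
    rw [mul_assoc, ← Complex.ofReal_mul, ← Real.exp_add]
    congr 3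
    ring

theorem ae_eq_of_laplaceTransform_natCast_eq {F G : ℝ → ℂ}
    (hF : IntegrableOn (fun v => F v * Real.exp (-(1 * v))) (Ioi 0))
    (hG : IntegrableOn (fun v => G v * Real.exp (-(1 * v))) (Ioi 0))
    (h : ∀ n : ℕ, 1 ≤ n → laplaceTransform F n = laplaceTransform G n) :
    ∀ᵐ v : ℝ, 0 < v → F v = G v := by
  -- Lerch's theorem is applied to (F-G)e^{-v}, so that the exponents 0, 1, … correspond to the
  -- arguments 1, 2, ….
  have key := ae_eq_zero_of_laplace_eq_zero (N := 0) (hF.sub hG) fun n _ => by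
    have h1 : (1 : ℝ) ≤ ((n + 1 : ℕ) : ℝ) := by push_cast; linarith [n.cast_nonneg (α := ℝ)]
    have e := h (n + 1) (by omega)
    rw [laplaceTransform_natCast, laplaceTransform_natCast, ← sub_eq_zero,
      ← integral_sub (integrableOn_mul_exp_neg_mono hF h1)
        (integrableOn_mul_exp_neg_mono hG h1)] at e
    rw [← e]
    refine integral_congr_ae (ae_of_all _ fun v => ?_)
    have : Real.exp (-(((n + 1 : ℕ) : ℝ) * v)) = Real.exp (-(1 * v)) * Real.exp (-(n * v)) := by
      rw [← Real.exp_add]; push_cast; ring_nf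
    simp only [this, Pi.sub_apply]
    push_cast
    ring
  filter_upwards [key] with v hv hv0
  have := hv hv0
  simp only [Pi.sub_apply, ← sub_mul] at this
  have hne : ((Real.exp (-(1 * v)) : ℝ) : ℂ) ≠ 0 := by exact_mod_cast (Real.exp_pos _).ne'
  exact sub_eq_zero.1 ((mul_eq_zero.1 this).resolve_right hne)

/-- G comes from (n^p a_n) and H from (a_n). The p-fold primitive of G has transform a_n at n ≥ 1,
hence equals H almost everywhere on v > 0. The weighted L² bound and the value at n = 0, which G
alone does not supply, are inherited from H. -/
theorem exists_iteratedPrimitive_laplaceTransform_eq {a : ℕ → ℂ} {p : ℕ}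
    (h : HausdorffL2 fun n => (n : ℂ) ^ p * a n) (h₀ : HausdorffL2 a) :
    ∃ G : ℝ → ℂ, (∀ v ≤ 0, G v = 0) ∧ MemLp G 2 ∧ MemLp (expWeight G (-(1 / 2))) 2 ∧
      MemLp (expWeight (iteratedPrimitive G p) (-(1 / 2))) 2 ∧
      ∀ n : ℕ, laplaceTransform (iteratedPrimitive G p) n = a n := by
  obtain ⟨G, hG0, hG2, hGw, hG⟩ := h.exists_laplaceTransform_eq
  obtain ⟨H, hH0, hH2, hHw, hH⟩ := h₀.exists_laplaceTransform_eq
  have hloc : LocallyIntegrable G := hG2.locallyIntegrable (by norm_num)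
  have hi : ∀ σ : ℝ, 0 < σ → IntegrableOn (fun v => G v * Real.exp (-(σ * v))) (Ioi 0) :=
    fun σ hσ => integrableOn_of_memLp_expWeight hGw (by linarith)
  have hae : ∀ᵐ v : ℝ, 0 < v → H v = iteratedPrimitive G p v := by
    refine ae_eq_of_laplaceTransform_natCast_eq
      (integrableOn_of_memLp_expWeight hHw (by norm_num))
      (integrableOn_iteratedPrimitive hloc hi p 1 one_pos) fun n hn => ?_
    have hn' : (n : ℂ) ≠ 0 := Nat.cast_ne_zero.2 (by omega)
    have := pow_mul_laplaceTransform_iteratedPrimitive hloc hi (z := n) (by simpa using Nat.lt_of_lt_of_le one_pos hn) p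
    rw [hG] at this
    rw [hH, mul_left_cancel₀ (pow_ne_zero p hn') this]
  refine ⟨G, hG0, hG2, hGw, hHw.ae_eq ?_, fun n => ?_⟩
  · filter_upwards [hae] with v hv
    by_cases hv0 : v ∈ Ioi (0 : ℝ)
    · simp only [expWeight, indicator_of_mem hv0, hv hv0]
    · simp only [expWeight, indicator_of_notMem hv0]
  · rw [← hH n]
    refine setIntegral_congr_ae measurableSet_Ioi ?_
    filter_upwards [hae] with v hv hv0
    rw [hv hv0]

theorem eq_zero_of_laplaceTransform_decay {F : ℝ → ℂ} (hF : IntegrableOn F (Ioi 0))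
    (hc : Continuous F) (h0 : ∀ v ≤ 0, F v = 0) {C m ξ : ℝ} (hξ : 0 < ξ)
    (h : ∀ n : ℕ, m < n → ‖laplaceTransform F n‖ ≤ C * Real.exp (-((n - m) * ξ))) :
    ∀ v ≤ ξ, F v = 0 := by
  -- The shift by m goes into the constant, and the choice of N ensures n > m.
  have hae := ae_eq_zero_of_laplace_decay (C := C * Real.exp (m * ξ)) (ξ₀ := ξ)
    (N := ⌊|m|⌋₊ + 1) hF fun n hn => by
      have hmn : m < n := (le_abs_self m).trans_lt
        ((Nat.lt_floor_add_one _).trans_le (by exact_mod_cast hn))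
      have := h n hmn
      rw [laplaceTransform_natCast] at this
      refine this.trans_eq ?_
      rw [mul_assoc, ← Real.exp_add]
      ring_nf
  have hIoo : EqOn F 0 (Ioo 0 ξ) := by
    refine Measure.eqOn_open_of_ae_eq (μ := volume) ?_ isOpen_Ioo hc.continuousOn continuousOn_const
    rw [EventuallyEq, ae_restrict_iff' measurableSet_Ioo]
    exact hae
  have hIcc : EqOn F 0 (Icc 0 ξ) := by
    rw [← closure_Ioo hξ.ne]
    exact hIoo.closure hc continuous_const
  intro v hv
  rcases le_total v 0 with hv0 | hv0
  · exact h0 v hv0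
  · exact hIcc ⟨hv0, hv⟩

theorem exists_norm_iteratedPrimitive_sub_le {G : ℝ → ℂ} (hG : MemLp G 2) (k : ℕ) (R : ℝ) :
    ∃ L : ℝ, 0 ≤ L ∧ ∀ u ∈ Icc (-R) R, ∀ v ∈ Icc (-R) R,
      ‖iteratedPrimitive G (k + 1) v - iteratedPrimitive G (k + 1) u‖ ≤
        L * Real.sqrt |v - u| := by
  obtain ⟨L, hL, h⟩ := exists_norm_integral_le_sqrt (memLp_iteratedPrimitive hG k R)
  refine ⟨L, hL, fun u hu v hv => ?_⟩
  have hint : ∀ a b : ℝ, IntervalIntegrable (iteratedPrimitive G k) volume a b := fun _ _ =>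
    ((locallyIntegrable_iteratedPrimitive (hG.locallyIntegrable (by norm_num)) k).integrableOn_isCompact
      isCompact_uIcc).intervalIntegrable
  have e : iteratedPrimitive G (k + 1) v - iteratedPrimitive G (k + 1) u =
      ∫ t in u..v, iteratedPrimitive G k t :=
    intervalIntegral.integral_interval_sub_left (hint 0 v) (hint 0 u)
  rw [e]
  exact h u hu v hv

/-! ### The cosine series in the strip -/

theorem integrable_add_indicator_inv_sqrt {F : ℝ → ℂ} (hF : Integrable F) (ξ L : ℝ) :
    Integrable fun v => ‖F v‖ +
      L * (Ioc ξ (ξ + 1)).indicator (fun v => (Real.sqrt |v - ξ|)⁻¹) v := by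
  refine hF.norm.add (Integrable.const_mul ?_ _)
  rw [integrable_indicator_iff measurableSet_Ioc]
  have h := (intervalIntegrable_inv_sqrt_abs zero_le_one).comp_sub_right ξ
  refine h.1.mono_set fun v hv => ?_
  constructor <;> linarith [hv.1, hv.2]

/-- The exponentials sum to at most 1/(e^s - 1) with s = v - ξ. The Hölder bound at the tip reduces
the singularity 1/s to s^{-1/2}, so the series is majorised uniformly up to the edge of the strip.
-/
theorem summable_integral_norm_mul_exp_neg {F : ℝ → ℂ} (hF : Integrable F) {ξ L : ℝ} (hL : 0 ≤ L)
    (h : ∀ v ∈ Ioc ξ (ξ + 1), ‖F v‖ ≤ L * Real.sqrt |v - ξ|) :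
    Summable fun n : ℕ => ∫ v in Ioi ξ, ‖F v‖ * Real.exp (-((n + 1) * (v - ξ))) := by
  have hint : ∀ n : ℕ, IntegrableOn (fun v => ‖F v‖ * Real.exp (-((n + 1) * (v - ξ)))) (Ioi ξ) := by
    intro n
    refine hF.norm.integrableOn.mono' (hF.norm.aestronglyMeasurable.restrict.mul
      (Continuous.aestronglyMeasurable (by fun_prop))) ?_
    filter_upwards [self_mem_ae_restrict measurableSet_Ioi] with v (hv : ξ < v)
    rw [Real.norm_of_nonneg (by positivity)]
    refine mul_le_of_le_one_right (norm_nonneg _) (Real.exp_le_one_iff.2 ?_)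
    have : 0 ≤ v - ξ := by linarith
    nlinarith [n.cast_nonneg (α := ℝ)]
  refine summable_of_sum_range_le (c := ∫ v in Ioi ξ, (‖F v‖ +
      L * (Ioc ξ (ξ + 1)).indicator (fun v => (Real.sqrt |v - ξ|)⁻¹) v))
    (fun n => integral_nonneg fun v => by positivity) fun N => ?_
  rw [← integral_finsetSum _ fun n _ => hint n]
  refine setIntegral_mono_on (integrable_finsetSum _ fun n _ => hint n)
    (integrable_add_indicator_inv_sqrt hF ξ L).integrableOn measurableSet_Ioi fun v hv => ?_
  have hs : 0 < v - ξ := sub_pos.2 hv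
  set s := v - ξ with hsdef
  have hq : Real.exp (-s) < 1 := by
    rw [Real.exp_lt_one_iff]; linarith
  have hsum : ∑ n ∈ Finset.range N, Real.exp (-(((n : ℕ) + 1) * s)) ≤ (Real.exp s - 1)⁻¹ := by
    have e : ∀ n : ℕ, Real.exp (-(((n : ℕ) + 1) * s)) = Real.exp (-s) * Real.exp (-s) ^ n := by
      intro n
      rw [← Real.exp_nat_mul, ← Real.exp_add]
      ring_nf
    simp only [e, ← Finset.mul_sum]
    have hg := (summable_geometric_of_lt_one (Real.exp_pos (-s)).le hq).sum_le_tsum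
      (Finset.range N) fun n _ => by positivity
    rw [tsum_geometric_of_lt_one (Real.exp_pos (-s)).le hq] at hg
    refine (mul_le_mul_of_nonneg_left hg (Real.exp_pos (-s)).le).trans_eq ?_
    rw [Real.exp_neg]
    have h1 : Real.exp s ≠ 0 := (Real.exp_pos s).ne'
    have h2 : Real.exp s - 1 ≠ 0 := (sub_pos.2 (Real.one_lt_exp_iff.2 hs)).ne'
    field_simp
  rw [← Finset.mul_sum]
  refine (mul_le_mul_of_nonneg_left hsum (norm_nonneg _)).trans ?_
  have hexp : s + 1 ≤ Real.exp s := Real.add_one_le_exp s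
  by_cases hv1 : v ∈ Ioc ξ (ξ + 1)
  · have hsq : 0 < Real.sqrt s := Real.sqrt_pos.2 hs
    have hFv := h v hv1
    rw [← hsdef, abs_of_pos hs] at hFv
    rw [indicator_of_mem hv1, ← hsdef, abs_of_pos hs]
    have h1 : (Real.exp s - 1)⁻¹ ≤ s⁻¹ := inv_anti₀ hs (by linarith)
    have h2 : ‖F v‖ * (Real.exp s - 1)⁻¹ ≤ L * Real.sqrt s * s⁻¹ :=
      mul_le_mul hFv h1 (inv_nonneg.2 (by linarith)) (by positivity)
    have h3 : Real.sqrt s * s⁻¹ = (Real.sqrt s)⁻¹ := by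
      nth_rw 2 [← Real.mul_self_sqrt hs.le]
      field_simp
    rw [mul_assoc, h3] at h2
    linarith [norm_nonneg (F v)]
  · have hs1 : 1 < s := by
      by_contra hle
      exact hv1 ⟨hv, by linarith⟩
    rw [indicator_of_notMem hv1, mul_zero, add_zero]
    exact mul_le_of_le_one_right (norm_nonneg _) (inv_le_one_of_one_le₀ (by linarith))

theorem norm_mul_cexp_le {F : ℝ → ℂ} {ξ : ℝ} (h0 : ∀ v ≤ ξ, F v = 0) {z : ℂ}
    (hz : z.re ≤ ξ) (n : ℕ) (v : ℝ) :
    ‖F v * Complex.exp (-((n + 1) * (v - z)))‖ ≤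
      (Ioi ξ).indicator (fun v => ‖F v‖ * Real.exp (-((n + 1) * (v - ξ)))) v := by
  by_cases hv : v ∈ Ioi ξ
  · rw [indicator_of_mem hv, norm_mul, Complex.norm_exp]
    refine mul_le_mul_of_nonneg_left (Real.exp_le_exp.2 ?_) (norm_nonneg _)
    have : (-(((n : ℂ) + 1) * (v - z))).re = -((n + 1) * (v - z.re)) := by
      simp
    rw [this]
    have : (0 : ℝ) ≤ n := n.cast_nonneg
    nlinarith
  · rw [indicator_of_notMem hv, h0 v (not_lt.1 hv)]
    simp

section

variable {F : ℝ → ℂ} {ξ : ℝ}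

theorem integrable_mul_cexp (hF : Integrable F) (h0 : ∀ v ≤ ξ, F v = 0) {z : ℂ}
    (hz : z.re ≤ ξ) (n : ℕ) : Integrable fun v : ℝ => F v * Complex.exp (-((n + 1) * (v - z))) := by
  refine hF.mono (hF.aestronglyMeasurable.mul
    (Continuous.aestronglyMeasurable (by fun_prop))) (ae_of_all _ fun v => ?_)
  refine (norm_mul_cexp_le h0 hz n v).trans ?_
  by_cases hv : v ∈ Ioi ξ
  · rw [indicator_of_mem hv]
    refine mul_le_of_le_one_right (norm_nonneg _) (Real.exp_le_one_iff.2 ?_)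
    have : 0 ≤ v - ξ := sub_nonneg.2 (le_of_lt hv)
    have : (0 : ℝ) ≤ n := n.cast_nonneg
    nlinarith
  · rw [indicator_of_notMem hv]
    exact norm_nonneg _

theorem integral_norm_mul_cexp_le (hF : Integrable F) (h0 : ∀ v ≤ ξ, F v = 0) {z : ℂ}
    (hz : z.re ≤ ξ) (n : ℕ) :
    ∫ v : ℝ, ‖F v * Complex.exp (-((n + 1) * (v - z)))‖ ≤
      ∫ v in Ioi ξ, ‖F v‖ * Real.exp (-((n + 1) * (v - ξ))) := by
  rw [← integral_indicator measurableSet_Ioi]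
  refine integral_mono (integrable_mul_cexp hF h0 hz n).norm ?_ fun v => norm_mul_cexp_le h0 hz n v
  have := (integrable_mul_cexp hF h0 (z := ξ) (by simp) n).norm
  refine this.congr (ae_of_all _ fun v => ?_)
  by_cases hv : v ∈ Ioi ξ
  · simp [indicator_of_mem hv, Complex.norm_exp]
  · simp [indicator_of_notMem hv, h0 v (not_lt.1 hv)]

/-- For v > ξ ≥ Re z, ∑ e^{-(n+1)(v-z)} is a geometric series with sum 1/(e^{v-z} - 1). -/
theorem hasSum_integral_mul_cexp (hF : Integrable F) (h0 : ∀ v ≤ ξ, F v = 0)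
    (hu : Summable fun n : ℕ => ∫ v in Ioi ξ, ‖F v‖ * Real.exp (-((n + 1) * (v - ξ))))
    {z : ℂ} (hz : z.re ≤ ξ) :
    HasSum (fun n : ℕ => ∫ v : ℝ, F v * Complex.exp (-((n + 1) * (v - z))))
      (boseTransform F z) := by
  have h := hasSum_integral_of_summable_integral_norm (E := ℂ) (μ := volume)
    (F := fun (n : ℕ) (v : ℝ) => F v * Complex.exp (-((n + 1) * (v - z))))
    (fun n => integrable_mul_cexp hF h0 hz n)
    (.of_nonneg_of_le (fun n => integral_nonneg fun v => norm_nonneg _)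
      (fun n => integral_norm_mul_cexp_le hF h0 hz n) hu)
  suffices e : boseTransform F z =
      ∫ v : ℝ, ∑' n : ℕ, F v * Complex.exp (-(((n : ℂ) + 1) * (v - z))) by
    rw [e]
    exact h
  unfold boseTransform
  refine integral_congr_ae (ae_of_all _ fun v => ?_)
  by_cases hv : v ≤ ξ
  · simp [h0 v hv]
  · have hq : ‖Complex.exp (-(v - z))‖ < 1 := by
      rw [Complex.norm_exp]
      rw [Real.exp_lt_one_iff]
      simp only [Complex.neg_re, Complex.sub_re, Complex.ofReal_re]
      linarith [not_le.1 hv]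
    have e : ∀ n : ℕ, Complex.exp (-(((n : ℂ) + 1) * (v - z))) =
        Complex.exp (-(v - z)) * Complex.exp (-(v - z)) ^ n := by
      intro n
      rw [← Complex.exp_nat_mul, ← Complex.exp_add]
      ring_nf
    simp only [e, tsum_mul_left, tsum_geometric_of_norm_lt_one hq]
    have h1 : Complex.exp (v - z) * Complex.exp (-(v - z)) = 1 := by
      rw [← Complex.exp_add]; simp
    have h2 : Complex.exp (-(v - z)) ≠ 0 := Complex.exp_ne_zero _
    have h3 : 1 - Complex.exp (-(v - z)) ≠ 0 := fun h => by
      rw [sub_eq_zero] at h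
      rw [← h, norm_one] at hq
      exact lt_irrefl _ hq
    have h4 : Complex.exp (v - z) - 1 = (1 - Complex.exp (-(v - z))) / Complex.exp (-(v - z)) := by
      rw [eq_div_iff h2, sub_mul, h1, one_mul]
    rw [h4, inv_div, div_eq_mul_inv]

theorem integral_mul_cexp_eq (hξ : 0 < ξ) (h0 : ∀ v ≤ ξ, F v = 0) (z : ℂ) (n : ℕ) :
    ∫ v : ℝ, F v * Complex.exp (-((n + 1) * (v - z))) =
      laplaceTransform F ((n + 1 : ℕ) : ℂ) * Complex.exp (((n + 1 : ℕ) : ℂ) * z) := by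
  rw [laplaceTransform, ← integral_mul_const,
    setIntegral_eq_integral_of_forall_compl_eq_zero fun v hv => ?_]
  · refine integral_congr_ae (ae_of_all _ fun v => ?_)
    simp only
    rw [mul_assoc, ← Complex.exp_add]
    push_cast
    ring_nf
  · rw [h0 v ((not_lt.1 hv).trans hξ.le)]
    simp

variable {a : ℤ → ℂ}

/-- The cosine splits into exponentials at ±iθ, both with real part below ξ in the strip. The
Weierstrass test gives uniformity, and by symmetry the frequencies n and -n contribute equally. -/
theorem hasSumUniformlyOn_cos (hξ : 0 < ξ) (hF : Integrable F) (h0 : ∀ v ≤ ξ, F v = 0)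
    (hu : Summable fun n : ℕ => ∫ v in Ioi ξ, ‖F v‖ * Real.exp (-((n + 1) * (v - ξ))))
    (ha : ∀ n : ℕ, laplaceTransform F n = a n) (hsymm : ∀ n : ℤ, a (-n) = a n) (c : ℂ) :
    HasSumUniformlyOn (fun (n : ℤ) (θ : ℂ) => c * (a n * Complex.cos (n * θ)))
      (fun θ => c * (a 0 + boseTransform F (Complex.I * θ) + boseTransform F (-(Complex.I * θ))))
      (strip ξ) := by
  set u : ℕ → ℝ := fun n => ∫ v in Ioi ξ, ‖F v‖ * Real.exp (-((n + 1) * (v - ξ))) with hudef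
  have hterm : ∀ (n : ℕ) (z : ℂ), z.re ≤ ξ →
      ‖a ((n : ℤ) + 1) * Complex.exp (((n : ℂ) + 1) * z)‖ ≤ u n := by
    intro n z hz
    have e := integral_mul_cexp_eq hξ h0 z n
    rw [ha] at e
    push_cast at e
    rw [← e]
    exact (norm_integral_le_integral_norm _).trans (integral_norm_mul_cexp_le hF h0 hz n)
  have hsum : ∀ z : ℂ, z.re ≤ ξ →
      HasSum (fun n : ℕ => a ((n : ℤ) + 1) * Complex.exp (((n : ℂ) + 1) * z))
        (boseTransform F z) := by
    intro z hz
    refine (hasSum_integral_mul_cexp hF h0 hu hz).congr_fun ?_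
    intro n
    have e := integral_mul_cexp_eq hξ h0 z n
    rw [ha] at e
    push_cast at e
    exact e.symm
  have hre : ∀ θ ∈ strip ξ, (Complex.I * θ).re ≤ ξ ∧ (-(Complex.I * θ)).re ≤ ξ := by
    intro θ hθ
    have := abs_lt.1 (show |θ.im| < ξ from hθ)
    simp only [Complex.mul_re, Complex.neg_re, Complex.I_re, Complex.I_im]
    constructor <;> linarith [this.1, this.2]
  have hcos : ∀ (n : ℕ) (θ : ℂ), a ((n : ℤ) + 1) * Complex.cos (((n : ℂ) + 1) * θ) =
      (a ((n : ℤ) + 1) * Complex.exp (((n : ℂ) + 1) * (Complex.I * θ)) +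
        a ((n : ℤ) + 1) * Complex.exp (((n : ℂ) + 1) * (-(Complex.I * θ)))) / 2 := by
    intro n θ
    rw [Complex.cos]
    ring_nf
  have hcosle : ∀ (n : ℕ), ∀ θ ∈ strip ξ,
      ‖a ((n : ℤ) + 1) * Complex.cos (((n : ℂ) + 1) * θ)‖ ≤ u n := by
    intro n θ hθ
    rw [hcos, norm_div]
    have h1 := hterm n _ (hre θ hθ).1
    have h2 := hterm n _ (hre θ hθ).2
    have h3 := norm_add_le (a ((n : ℤ) + 1) * Complex.exp (((n : ℂ) + 1) * (Complex.I * θ)))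
      (a ((n : ℤ) + 1) * Complex.exp (((n : ℂ) + 1) * (-(Complex.I * θ))))
    rw [Complex.norm_ofNat]
    linarith
  have hneg : ∀ (n : ℕ) (θ : ℂ), a (-((n : ℤ) + 1)) * Complex.cos (((-((n : ℤ) + 1) : ℤ) : ℂ) * θ) =
      a ((n : ℤ) + 1) * Complex.cos (((n : ℂ) + 1) * θ) := by
    intro n θ
    rw [hsymm]
    push_cast
    rw [neg_mul, Complex.cos_neg]
  -- u n bounds the frequency n + 1, hence the shift; the truncated subtraction at n = 0 is shielded
  -- by the case distinction.
  set w : ℤ → ℝ := fun n => ‖c‖ * (if n = 0 then ‖a 0‖ else u (n.natAbs - 1)) with hw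
  have hwsum : Summable w := by
    refine Summable.mul_left _ (Summable.of_nat_of_neg_add_one ?_ ?_)
    · rw [← summable_nat_add_iff 1]
      refine hu.congr fun n => ?_
      rw [if_neg (by positivity)]
      congr 1
    · refine hu.congr fun n => ?_
      rw [if_neg (by omega)]
      congr 1
  have hbound : ∀ (n : ℤ) (θ : ℂ), θ ∈ strip ξ → ‖c * (a n * Complex.cos (n * θ))‖ ≤ w n := by
    intro n θ hθ
    rw [norm_mul]
    refine mul_le_mul_of_nonneg_left ?_ (norm_nonneg c)
    rcases n with n | n
    · rcases n with _ | n
      · simp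
      · rw [if_neg (by simp; omega)]
        have e : (Int.ofNat (n + 1)).natAbs - 1 = n := by
          simp only [Int.ofNat_eq_natCast, Int.natAbs_natCast, Nat.add_sub_cancel]
        rw [e]
        simpa only [Int.ofNat_eq_natCast, Nat.cast_add, Nat.cast_one, Int.cast_add,
          Int.cast_natCast, Int.cast_one] using hcosle n θ hθ
    · have e : (Int.negSucc n).natAbs - 1 = n := by simp
      rw [if_neg (by simp), e, Int.negSucc_eq, hneg]
      exact hcosle n θ hθ
  refine (HasSumUniformlyOn.of_norm_le_summable hwsum hbound).congr_right fun θ hθ => ?_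
  refine HasSum.tsum_eq ?_
  refine HasSum.mul_left _ ?_
  have hS : HasSum (fun n : ℕ => a ((n : ℤ) + 1) * Complex.cos (((n : ℂ) + 1) * θ))
      ((boseTransform F (Complex.I * θ) + boseTransform F (-(Complex.I * θ))) / 2) := by
    simp only [hcos]
    exact ((hsum _ (hre θ hθ).1).add (hsum _ (hre θ hθ).2)).div_const 2
  have hpos : HasSum (fun n : ℕ => a (n : ℤ) * Complex.cos (((n : ℤ) : ℂ) * θ))
      (a 0 + (boseTransform F (Complex.I * θ) + boseTransform F (-(Complex.I * θ))) / 2) := by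
    rw [← hasSum_nat_add_iff' 1]
    simpa using hS
  have := HasSum.of_nat_of_neg_add_one (f := fun n : ℤ => a n * Complex.cos (n * θ)) hpos
    (m' := (boseTransform F (Complex.I * θ) + boseTransform F (-(Complex.I * θ))) / 2)
    (by simp only [hneg]; exact hS)
  rw [show a 0 + boseTransform F (Complex.I * θ) + boseTransform F (-(Complex.I * θ)) =
    a 0 + (boseTransform F (Complex.I * θ) + boseTransform F (-(Complex.I * θ))) / 2 +
      (boseTransform F (Complex.I * θ) + boseTransform F (-(Complex.I * θ))) / 2 by ring]
  exact this

end

/-! ### The cut plane and the discontinuities -/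

/-- e^{iθ} = e^v means θ = 2πn - iv: the term in iθ is singular only on the lower cuts, and the term
in -iθ only on the upper ones. -/
theorem exp_I_mul_ne {ξ : ℝ} {θ : ℂ} (hθ : θ ∉ lowerCuts ξ) (v : ℝ) (hv : ξ ≤ v) :
    Complex.exp (Complex.I * θ) ≠ Complex.exp v := by
  intro h
  obtain ⟨n, hn⟩ := Complex.exp_eq_exp_iff_exists_int.1 h
  refine hθ ⟨n, -v, by linarith, ?_⟩
  have : θ = -Complex.I * (Complex.I * θ) := by
    rw [← mul_assoc, neg_mul, Complex.I_mul_I]; ring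
  rw [this, hn]
  push_cast
  linear_combination (-(n : ℂ) * 2 * Real.pi) * Complex.I_mul_I

theorem exp_neg_I_mul_ne {ξ : ℝ} {θ : ℂ} (hθ : θ ∉ upperCuts ξ) (v : ℝ) (hv : ξ ≤ v) :
    Complex.exp (-(Complex.I * θ)) ≠ Complex.exp v := by
  intro h
  obtain ⟨n, hn⟩ := Complex.exp_eq_exp_iff_exists_int.1 h
  refine hθ ⟨-n, v, hv, ?_⟩
  have : θ = Complex.I * (-(Complex.I * θ)) := by
    rw [mul_neg, ← mul_assoc, Complex.I_mul_I]; ring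
  rw [this, hn]
  push_cast
  linear_combination ((n : ℂ) * 2 * Real.pi) * Complex.I_mul_I

theorem notMem_lowerCuts_of_neg_lt_im {ξ : ℝ} {θ : ℂ} (h : -ξ < θ.im) : θ ∉ lowerCuts ξ := by
  rintro ⟨k, v, hv, rfl⟩
  have : (2 * (k : ℂ) * Real.pi + v * Complex.I).im = v := by simp
  rw [this] at h
  linarith

theorem notMem_upperCuts_of_im_lt {ξ : ℝ} {θ : ℂ} (h : θ.im < ξ) : θ ∉ upperCuts ξ := by
  rintro ⟨k, v, hv, rfl⟩
  have : (2 * (k : ℂ) * Real.pi + v * Complex.I).im = v := by simp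
  rw [this] at h
  linarith

theorem strip_subset_cutDomain (ξ : ℝ) : strip ξ ⊆ cutDomain ξ := by
  intro θ hθ
  have := abs_lt.1 (show |θ.im| < ξ from hθ)
  rintro (h | h)
  · exact notMem_upperCuts_of_im_lt this.2 h
  · exact notMem_lowerCuts_of_neg_lt_im this.1 h

theorem isOpen_strip (ξ : ℝ) : IsOpen (strip ξ) :=
  isOpen_lt (continuous_abs.comp Complex.continuous_im) continuous_const

/-- The sum `c (a₀ + ∑_{n ≥ 1} 2 aₙ cos nθ)` for the moments `aₙ` of `F`, expressed through the
singular integrals of `F` on the two families of cuts. -/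
noncomputable def cosineSum (F : ℝ → ℂ) (a₀ c θ : ℂ) : ℂ :=
  c * (a₀ + boseTransform F (Complex.I * θ) + boseTransform F (-(Complex.I * θ)))

section

variable {F : ℝ → ℂ} {ξ : ℝ}

theorem differentiableAt_boseTransform_I_mul (hF : Integrable F) (h0 : ∀ v ≤ ξ, F v = 0) {θ : ℂ}
    (hθ : θ ∉ lowerCuts ξ) : DifferentiableAt ℂ (fun θ => boseTransform F (Complex.I * θ)) θ :=
  (differentiableAt_boseTransform hF h0 (exp_I_mul_ne hθ)).comp θ
    (differentiableAt_id.const_mul Complex.I)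

theorem differentiableAt_boseTransform_neg_I_mul (hF : Integrable F) (h0 : ∀ v ≤ ξ, F v = 0)
    {θ : ℂ} (hθ : θ ∉ upperCuts ξ) :
    DifferentiableAt ℂ (fun θ => boseTransform F (-(Complex.I * θ))) θ :=
  DifferentiableAt.comp (g := boseTransform F) (f := fun θ => -(Complex.I * θ)) θ
    (differentiableAt_boseTransform hF h0 (exp_neg_I_mul_ne hθ)) (by fun_prop)

theorem differentiableOn_cosineSum (hF : Integrable F) (h0 : ∀ v ≤ ξ, F v = 0) (a₀ c : ℂ) :
    DifferentiableOn ℂ (cosineSum F a₀ c) (cutDomain ξ) := by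
  intro θ hθ
  have hu : θ ∉ upperCuts ξ := fun h => hθ (Or.inl h)
  have hl : θ ∉ lowerCuts ξ := fun h => hθ (Or.inr h)
  exact ((((differentiableAt_const a₀).add
    (differentiableAt_boseTransform_I_mul hF h0 hl)).add
    (differentiableAt_boseTransform_neg_I_mul hF h0 hu)).const_mul c).differentiableWithinAt

/-- Only the term in -iθ jumps. Passing to the right of the cut means passing below the real axis in
-iθ, so the discontinuity of if is i/(2π) · (-2πi)F(v) = F(v). -/
theorem hasJump_cosineSum_upper (hF : Integrable F) (hc : Continuous F) (hξ : 0 < ξ)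
    (h0 : ∀ v ≤ ξ, F v = 0) {v L : ℝ} (hv : ξ < v) (hL : 0 ≤ L)
    (hH : ∀ s ∈ Icc (v - 1) (v + 1), ∀ t ∈ Icc (v - 1) (v + 1),
      ‖F t - F s‖ ≤ L * Real.sqrt |t - s|) (a₀ : ℂ) (k : ℤ) :
    HasJump (fun θ => Complex.I * cosineSum F a₀ (1 / (2 * (Real.pi : ℂ))) θ)
      (2 * k * Real.pi + v * Complex.I) (F v) := by
  obtain ⟨P, hpos, hneg⟩ := exists_tendsto_boseTransform hF hc hL hH
  set z : ℂ := 2 * k * Real.pi + v * Complex.I with hz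
  have hzre : z.re = 2 * k * Real.pi := by simp [hz]
  have hzim : z.im = v := by simp [hz]
  have hreg : ∀ s : Set ℂ, Tendsto (fun θ => boseTransform F (Complex.I * θ)) (𝓝[s] z)
      (𝓝 (boseTransform F (Complex.I * z))) := fun s =>
    ((differentiableAt_boseTransform_I_mul hF h0
      (notMem_lowerCuts_of_neg_lt_im (by rw [hzim]; linarith))).continuousAt).tendsto.mono_left
      nhdsWithin_le_nhds
  -- The period 2πik brings the point of the k-th cut to the real number v.
  set w : ℂ → ℂ := fun θ => -(Complex.I * θ) + k * (2 * Real.pi * Complex.I) with hw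
  have hwz : w z = v := by
    simp only [hw, hz]
    linear_combination (-(v : ℂ)) * Complex.I_mul_I
  have hwc : Tendsto w (𝓝 z) (𝓝 (v : ℂ)) := by
    rw [← hwz]
    exact Continuous.tendsto (by fun_prop) z
  have hwim : ∀ θ, (w θ).im = z.re - θ.re := by
    intro θ
    rw [hzre]
    simp [hw]
    ring
  have hB : ∀ θ, boseTransform F (-(Complex.I * θ)) = boseTransform F (w θ) := fun θ =>
    (boseTransform_add_int F _ k).symm
  have hr : Tendsto w (𝓝[{θ : ℂ | z.re < θ.re}] z) (𝓝[{z : ℂ | z.im < 0}] (v : ℂ)) :=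
    tendsto_nhdsWithin_of_tendsto_nhds_of_eventually_within _ (hwc.mono_left nhdsWithin_le_nhds)
      (eventually_nhdsWithin_of_forall fun θ (hθ : z.re < θ.re) => by
        rw [mem_ofPred_eq, hwim]; linarith)
  have hl : Tendsto w (𝓝[{θ : ℂ | θ.re < z.re}] z) (𝓝[{z : ℂ | 0 < z.im}] (v : ℂ)) :=
    tendsto_nhdsWithin_of_tendsto_nhds_of_eventually_within _ (hwc.mono_left nhdsWithin_le_nhds)
      (eventually_nhdsWithin_of_forall fun θ (hθ : θ.re < z.re) => by
        rw [mem_ofPred_eq, hwim]; linarith)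
  simp only [cosineSum, hB]
  refine ⟨_, _, (((tendsto_const_nhds.add (hreg _)).add (hneg.comp hr)).const_mul _).const_mul _,
    (((tendsto_const_nhds.add (hreg _)).add (hpos.comp hl)).const_mul _).const_mul _, ?_⟩
  have hπ : (Real.pi : ℂ) ≠ 0 := by exact_mod_cast Real.pi_ne_zero
  field_simp
  linear_combination (2 * Real.pi * F v) * Complex.I_sq

/-- The sum is even, and θ ↦ -θ exchanges upper and lower cuts as well as left and right; the latter
reverses the sign. -/
theorem hasJump_cosineSum_lower (hF : Integrable F) (hc : Continuous F) (hξ : 0 < ξ)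
    (h0 : ∀ v ≤ ξ, F v = 0) {v L : ℝ} (hv : ξ < v) (hL : 0 ≤ L)
    (hH : ∀ s ∈ Icc (v - 1) (v + 1), ∀ t ∈ Icc (v - 1) (v + 1),
      ‖F t - F s‖ ≤ L * Real.sqrt |t - s|) (a₀ : ℂ) (k : ℤ) :
    HasJump (fun θ => Complex.I * cosineSum F a₀ (1 / (2 * (Real.pi : ℂ))) θ)
      (2 * k * Real.pi - v * Complex.I) (-F v) := by
  have heven : ∀ θ, cosineSum F a₀ (1 / (2 * (Real.pi : ℂ))) (-θ) =
      cosineSum F a₀ (1 / (2 * (Real.pi : ℂ))) θ := by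
    intro θ
    simp only [cosineSum, mul_neg, neg_neg]
    ring
  obtain ⟨gr, gl, hr, hl, h⟩ := hasJump_cosineSum_upper hF hc hξ h0 hv hL hH a₀ (-k)
  set z : ℂ := 2 * k * Real.pi - v * Complex.I with hz
  have hz' : 2 * ((-k : ℤ) : ℂ) * Real.pi + v * Complex.I = -z := by
    rw [hz]; push_cast; ring
  rw [hz'] at hr hl
  have hn : ∀ s : Set ℂ, Tendsto (fun θ : ℂ => -θ) (𝓝[s] z) (𝓝 (-z)) := fun s =>
    (continuous_neg.tendsto z).mono_left nhdsWithin_le_nhds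
  refine ⟨gl, gr, ?_, ?_, by rw [h]; ring⟩
  · refine (hl.comp (tendsto_nhdsWithin_of_tendsto_nhds_of_eventually_within _ (hn _)
      (eventually_nhdsWithin_of_forall fun θ (hθ : z.re < θ.re) => ?_))).congr fun θ => ?_
    · simpa using hθ
    · simp only [Function.comp_apply, heven]
  · refine (hr.comp (tendsto_nhdsWithin_of_tendsto_nhds_of_eventually_within _ (hn _)
      (eventually_nhdsWithin_of_forall fun θ (hθ : θ.re < z.re) => ?_))).congr fun θ => ?_
    · simpa using hθ
    · simp only [Function.comp_apply, heven]

end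

/-! ### Assembly -/

theorem proposition5 (a : ℤ → ℂ) (p : ℕ) (C m ξ₀ : ℝ)
    (hsymm : ∀ n : ℤ, a (-n) = a n)
    (hp : 1 ≤ p) (hm : 0 < m) (hξ : 0 < ξ₀)
    (hHausdorff : HausdorffL2 (fun n : ℕ => (n : ℂ) ^ p * a n))
    (hHausdorff₀ : HausdorffL2 (fun n : ℕ => a n))
    (hdecay : ∀ n : ℕ, m < n → ‖a n‖ ≤ C * Real.exp (-((n - m) * ξ₀))) :
    ∃ f : ℂ → ℂ,
      -- uniform convergence of the cosine series in the strip, to an analytic function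
      HasSumUniformlyOn
        (fun (n : ℤ) (θ : ℂ) => 1 / (2 * (Real.pi : ℂ)) * (a n * Complex.cos (n * θ)))
        f (strip ξ₀) ∧
      AnalyticOnNhd ℂ f (strip ξ₀) ∧
      -- holomorphic extension to the doubly cut domain
      DifferentiableOn ℂ f (cutDomain ξ₀) ∧
      -- the Carlsonian interpolation of the coefficients exists and is unique
      ∃ A : ℂ → ℂ, IsCarlsonInterpolation A (fun n : ℕ => a n) ∧
        (∀ B : ℂ → ℂ, IsCarlsonInterpolation B (fun n : ℕ => a n) →
          EqOn B A {z : ℂ | -(1 / 2 : ℝ) < z.re}) ∧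
        -- the jump function, extended by zero where there is no cut
        ∃ F : ℝ → ℂ,
          (∀ v : ℝ, v ≤ ξ₀ → F v = 0) ∧
          (∀ (k : ℤ) (v : ℝ), ξ₀ < v →
            HasJump (fun θ => Complex.I * f θ) (2 * k * Real.pi + v * Complex.I) (F v) ∧
            HasJump (fun θ => Complex.I * f θ) (2 * k * Real.pi - v * Complex.I) (-F v)) ∧
          -- smoothness and exponential bounds
          ContDiff ℝ ((p - 1 : ℕ) : WithTop ℕ∞) F ∧
          (∀ σ : ℝ, -(1 / 2 : ℝ) ≤ σ →
            Integrable (fun ν : ℝ => A (σ + ν * Complex.I)) ∧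
            ∀ v : ℝ, 0 < v →
              ‖F v‖ ≤ (1 / (2 * Real.pi) * ∫ ν : ℝ, ‖A (σ + ν * Complex.I)‖) *
                Real.exp (σ * v)) ∧
          -- the interpolation is the Laplace transform of the jump function
          (∀ σ ν : ℝ, -(1 / 2 : ℝ) < σ →
            IntegrableOn
              (fun v : ℝ => F v * Complex.exp (-((σ + ν * Complex.I) * v))) (Ioi 0) ∧
            A (σ + ν * Complex.I) =
              ∫ v in Ioi (0 : ℝ), F v * Complex.exp (-((σ + ν * Complex.I) * v))) ∧
          -- the Plancherel equality
          (∀ σ : ℝ, -(1 / 2 : ℝ) ≤ σ →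
            Integrable (fun ν : ℝ => ‖A (σ + ν * Complex.I)‖ ^ 2) ∧
            IntegrableOn (fun v : ℝ => ‖F v * (Real.exp (-(σ * v)) : ℂ)‖ ^ 2) (Ioi 0) ∧
            ∫ ν : ℝ, ‖A (σ + ν * Complex.I)‖ ^ 2 =
              2 * Real.pi *
                ∫ v in Ioi (0 : ℝ), ‖F v * (Real.exp (-(σ * v)) : ℂ)‖ ^ 2) := by
  obtain ⟨k, rfl⟩ : ∃ k, p = k + 1 := ⟨p - 1, by omega⟩
  obtain ⟨G, hG0, hG2, hGw, hFw, hFa⟩ :=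
    exists_iteratedPrimitive_laplaceTransform_eq hHausdorff hHausdorff₀
  have hGloc : LocallyIntegrable G := hG2.locallyIntegrable (by norm_num)
  have hFc := continuous_iteratedPrimitive_succ hGloc k
  have hF0 := iteratedPrimitive_eq_zero hG0 (k + 1)
  have hsmooth := contDiff_iteratedPrimitive_succ hGloc k
  have hHolder := exists_norm_iteratedPrimitive_sub_le hG2 k
  have hpow : ∀ z : ℂ, 0 < z.re →
      z ^ (k + 1) * laplaceTransform (iteratedPrimitive G (k + 1)) z = laplaceTransform G z :=
    fun z hz => pow_mul_laplaceTransform_iteratedPrimitive hGloc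
      (fun σ hσ => integrableOn_of_memLp_expWeight hGw (by linarith)) hz _
  set F := iteratedPrimitive G (k + 1) with hF
  have hFi : ∀ σ : ℝ, -(1 / 2 : ℝ) < σ →
      IntegrableOn (fun v => F v * Real.exp (-(σ * v))) (Ioi 0) :=
    fun σ hσ => integrableOn_of_memLp_expWeight hFw hσ
  -- The weight σ = 0 is admissible because it exceeds -1/2.
  have hFion : IntegrableOn F (Ioi 0) := by simpa using hFi 0 (by norm_num)
  have hFint : Integrable F := by
    rw [← integrableOn_univ, ← Iic_union_Ioi (a := (0 : ℝ))]
    exact ((integrableOn_zero (s := Iic (0 : ℝ))).congr_fun (fun v hv => (hF0 v hv).symm)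
      measurableSet_Iic).union hFion
  have hsupp : ∀ v ≤ ξ₀, F v = 0 :=
    eq_zero_of_laplaceTransform_decay hFion hFc hF0 hξ fun n hn => by
      rw [hFa]; exact hdecay n hn
  have hsummable : Summable fun n : ℕ =>
      ∫ v in Ioi ξ₀, ‖F v‖ * Real.exp (-((n + 1) * (v - ξ₀))) := by
    obtain ⟨L, hL, hH⟩ := hHolder (ξ₀ + 1)
    refine summable_integral_norm_mul_exp_neg hFint hL fun v hv => ?_
    have := hH ξ₀ ⟨by linarith, by linarith⟩ v ⟨by linarith [hv.1], hv.2⟩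
    rwa [hsupp ξ₀ le_rfl, sub_zero] at this
  have hA := isHardyFunction_hardyLaplace hFw
  have hAeq : ∀ z : ℂ, -(1 / 2 : ℝ) < z.re → hardyLaplace F hFw z = laplaceTransform F z :=
    fun z hz => if_pos hz
  have hAa : IsCarlsonInterpolation (hardyLaplace F hFw) fun n : ℕ => a n :=
    ⟨hA, fun n => by
      rw [hAeq _ (by rw [Complex.natCast_re]; linarith [n.cast_nonneg (α := ℝ)]), hFa]⟩
  have hB := isHardyFunction_hardyLaplace hGw
  -- z^p A is the Hardy function of G; this relation makes A integrable on lines.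
  have hAB := pow_mul_eq_of_re_pos (p := k + 1) (by norm_num : -(1 / 2 : ℝ) < 0)
    hA.holomorphic hB.holomorphic fun z hz => by
      rw [hAeq z (by linarith), hpow z hz]
      exact (if_pos (by linarith : -(1 / 2 : ℝ) < z.re)).symm
  have hD := differentiableOn_cosineSum hFint hsupp (a 0) (1 / (2 * (Real.pi : ℂ)))
  refine ⟨cosineSum F (a 0) (1 / (2 * (Real.pi : ℂ))),
    hasSumUniformlyOn_cos hξ hFint hsupp hsummable hFa hsymm _,
    (hD.mono (strip_subset_cutDomain ξ₀)).analyticOnNhd (isOpen_strip ξ₀), hD,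
    hardyLaplace F hFw, hAa, fun B hB => hAa.eqOn hB, F, hsupp, fun j v hv => ?_,
    hsmooth, fun σ hσ => ?_, fun σ ν hσ => ?_,
    fun σ hσ => hardyLaplace_plancherel hFw hσ⟩
  · obtain ⟨L, hL, hH⟩ := hHolder (v + 1)
    -- As v > ξ₀ > 0, the Hölder constant for radius v + 1 covers the window around v.
    have hsub : Icc (v - 1) (v + 1) ⊆ Icc (-(v + 1)) (v + 1) :=
      Icc_subset_Icc (by linarith) le_rfl
    exact ⟨hasJump_cosineSum_upper hFint hFc hξ hsupp hv hL
        (fun s hs t ht => hH s (hsub hs) t (hsub ht)) (a 0) j,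
      hasJump_cosineSum_lower hFint hFc hξ hsupp hv hL
        (fun s hs t ht => hH s (hsub hs) t (hsub ht)) (a 0) j⟩
  · have hI := hA.integrable_line hB hp hAB hσ
    exact ⟨hI, fun v _ => norm_le_integral_hardyLaplace hFw hFc hF0 hσ hI v⟩
  · have hre : ((σ : ℂ) + ν * Complex.I).re = σ := by simp
    exact ⟨integrableOn_mul_cexp_neg (hFi σ hσ) hre.ge, hAeq _ (by rwa [hre])⟩
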